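/- Let $-3<\gamma<0$. Let $a_{jk}(v)=(\delta_{jk}|v|^2-v_jv_k)|v|^\gamma$ on $\mathbb R^3$ and $$Q(G,F)(v)=\sum_{j,k=1}^3\partial_j\int_{\mathbb R^3}a_{jk}(v-w)\big[G(w)\,\partial_kF(v)-\partial_kG(w)\,F(v)\big]\,dw$$ be the Landau collision operator. Let $\mu(v)=(2\pi)^{-3/2}e^{-|v|^2/2}$, $\Gamma(f,h)=\mu^{-1/2}Q(\sqrt\mu f,\sqrt\mu h)$, and $\mathcal Lf=-\Gamma(\sqrt\mu,f)-\Gamma(f,\sqrt\mu)$. With $\bar a_{jk}=a_{jk}*\mu$ put $$\|f\|_A^2=\sum_{j,k=1}^3\int_{\mathbb R^3}\Big(\bar a_{jk}\,\partial_jf\,\partial_kf+\tfrac14\,\bar a_{jk}v_jv_kf^2\Big)\,dv\in[0,\infty],$$ with weak derivatives and with value $\infty$ if $f$ has no weak gradient. Let $T>0$. For $f_0\in L^2(\mathbb R^3)$ and $g:\,]0,T[\times\mathbb R^3\to\mathbb R$ consider the Cauchy problem $$\partial_tf+\mathcal Lf=g,\qquad f|_{t=0}=f_0 .$$ A (weak)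 solution on $[0,T]$ is an $f\in C([0,T];L^2(\mathbb R^3))$ with $f(0)=f_0$ and $\int_0^T\|f(s)\|_A^2\,ds<\infty$ such that $$(f(t),\varphi)_{L^2}+\int_0^t\langle\mathcal Lf(s),\varphi\rangle\,ds=(f_0,\varphi)_{L^2}+\int_0^t(g(s),\varphi)_{L^2}\,ds$$ for all $t\in[0,T]$ and $\varphi\in C_c^\infty(\mathbb R^3)$, where $\langle\mathcal Lf,\varphi\rangle$ is the distributional pairing (the outer derivative $\partial_j$ in $Q$ is moved onto the test function). The source $g$ is called analytic with constant $A>0$ if $g\in C^\infty(]0,T[\times\mathbb R^3)$ and $\|\partial_{t,v}^\alpha g\|_{L^2(]0,T[\times\mathbb R^3)}\le A^{|\alpha|+1}\alpha!$ for all $\alpha\in\mathbb N^4$. Then for all $M\ge0$ and $A>0$ there is a constant $C_6>0$, depending only on $\gamma,T,M,A$, such that for every $f_0\in L^2(\mathbb R^3)$ with $\|f_0\|_{L^2}\le M$, every $g$ that is analytic with constant $A$, and every solution $f$ of the Cauchy problem on $[0,T]$, the map $f:\,]0,T]\to L^2(\mathbb R^3)$ is differentiable (at $t=T$ from the left) and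 $$\sup_{t\in]0,T]}\|t\,\partial_tf(t)\|_{L^2(\mathbb R^3)}^2+\int_0^T\|t\,\partial_tf(t)\|_A^2\,dt\le C_6^2 .$$ -/

import Mathlib

open MeasureTheory Set
open scoped ENNReal ContDiff

namespace Landau

/-- The velocity space `ℝ³` with its Euclidean norm. -/
abbrev V3 : Type := EuclideanSpace ℝ (Fin 3)

/-- The real Hilbert space `L²(ℝ³)`. -/
abbrev L2 : Type := Lp ℝ 2 (volume : Measure V3)

/-- The `j`-th standard basis vector of `ℝ³`. -/
noncomputable def basisVec (j : Fin 3) : V3 := EuclideanSpace.single j 1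

/-- Smooth compactly supported test functions on `ℝ³`. -/
def IsTest (φ : V3 → ℝ) : Prop := ContDiff ℝ ∞ φ ∧ HasCompactSupport φ

/-- `G` is the weak (distributional) gradient of `f`, both being locally integrable. -/
def HasWeakGradient (f : V3 → ℝ) (G : V3 → V3) : Prop :=
  LocallyIntegrable f volume ∧ LocallyIntegrable G volume ∧
    ∀ φ : V3 → ℝ, IsTest φ → ∀ j : Fin 3,
      ∫ v, f v * fderiv ℝ φ v (basisVec j) = - ∫ v, G v j * φ v

open Classical in
/-- The weak gradient of `f` (unique up to null sets); `0` if there is none. -/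
noncomputable def weakGrad (f : V3 → ℝ) : V3 → V3 :=
  if h : ∃ G, HasWeakGradient f G then h.choose else 0

/-- The Maxwellian `μ(v) = (2π)^{-3/2} exp(-|v|²/2)`. -/
noncomputable def mu (v : V3) : ℝ :=
  (2 * Real.pi) ^ (-(3 / 2) : ℝ) * Real.exp (-(‖v‖ ^ 2 / 2))

/-- `√μ`. -/
noncomputable def sqrtMu (v : V3) : ℝ := Real.sqrt (mu v)

/-- The Landau kernel `a_{jk}(z) = (δ_{jk}|z|² - z_j z_k)|z|^γ`. -/
noncomputable def aCoef (γ : ℝ) (j k : Fin 3) (z : V3) : ℝ :=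
  ((if j = k then ‖z‖ ^ 2 else 0) - z j * z k) * ‖z‖ ^ γ

/-- `ā_{jk} = a_{jk} * μ`. -/
noncomputable def aBar (γ : ℝ) (j k : Fin 3) (v : V3) : ℝ :=
  ∫ w, aCoef γ j k (v - w) * mu w

open Classical in
/-- `‖f‖_A² = ∑_{jk} ∫ (ā_{jk} ∂_j f ∂_k f + ¼ ā_{jk} v_j v_k f²) dv`, with values in `[0, ∞]`;
it is `∞` if `f` has no weak gradient. (The integrand is nonnegative, because the matrix
`(ā_{jk})` is.) -/
noncomputable def normASq (γ : ℝ) (f : V3 → ℝ) : ℝ≥0∞ :=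
  if ∃ G, HasWeakGradient f G then
    ∫⁻ v, ENNReal.ofReal (∑ j, ∑ k,
      (aBar γ j k v * weakGrad f v j * weakGrad f v k
        + 1 / 4 * aBar γ j k v * v j * v k * f v ^ 2))
  else ⊤

/-- The `j`-th component of the flux of the collision operator,
`∑_k ∫ a_{jk}(v - w) [G(w) ∂_k F(v) - ∂_k G(w) F(v)] dw`, so that `Q(G, F) = ∑_j ∂_j (flux_j)`. -/
noncomputable def flux (γ : ℝ) (G F : V3 → ℝ) (j : Fin 3) (v : V3) : ℝ :=
  ∑ k, ∫ w, aCoef γ j k (v - w) * (G w * weakGrad F v k - weakGrad G w k * F v)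

/-- The distributional pairing `⟨Q(G, F), ψ⟩` of the Landau collision operator. -/
noncomputable def pairQ (γ : ℝ) (G F ψ : V3 → ℝ) : ℝ :=
  - ∑ j, ∫ v, flux γ G F j v * fderiv ℝ ψ v (basisVec j)

/-- The distributional pairing `⟨Γ(f, h), φ⟩`, where `Γ(f, h) = μ^{-1/2} Q(√μ f, √μ h)`. -/
noncomputable def pairGamma (γ : ℝ) (f h φ : V3 → ℝ) : ℝ :=
  pairQ γ (fun v => sqrtMu v * f v) (fun v => sqrtMu v * h v) (fun v => (sqrtMu v)⁻¹ * φ v)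

/-- The distributional pairing `⟨𝓛 f, φ⟩`, where `𝓛 = 𝓛₁ + 𝓛₂`, `𝓛₁ f = -Γ(√μ, f)` and
`𝓛₂ f = -Γ(f, √μ)`. -/
noncomputable def pairL (γ : ℝ) (f φ : V3 → ℝ) : ℝ :=
  - pairGamma γ sqrtMu f φ - pairGamma γ f sqrtMu φ

/-- `f ∈ C([0,T]; L²(ℝ³))`, with `∫₀ᵀ ‖f(s)‖_A² ds < ∞`, is a weak solution on `[0, T]` of
`∂ₜ f + 𝓛 f = g`, `f|_{t=0} = f₀`. -/
structure IsWeakSolution (γ T : ℝ) (f₀ : L2) (g : ℝ × V3 → ℝ) (f : ℝ → L2) : Prop where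
  continuousOn : ContinuousOn f (Icc 0 T)
  initial : f 0 = f₀
  energy : ∫⁻ s in Ioc 0 T, normASq γ (f s) < ⊤
  weak : ∀ φ : V3 → ℝ, IsTest φ → ∀ t ∈ Icc 0 T,
    (∫ v, f t v * φ v) + ∫ s in (0 : ℝ)..t, pairL γ (f s) φ
      = (∫ v, f₀ v * φ v) + ∫ s in (0 : ℝ)..t, ∫ v, g (s, v) * φ v

/-- The directional derivative of `u` on `ℝ × ℝ³` in the direction `e`. -/
noncomputable def dirDeriv (e : ℝ × V3) (u : ℝ × V3 → ℝ) : ℝ × V3 → ℝ :=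
  fun x => fderiv ℝ u x e

/-- The mixed partial derivative `∂ₜᵏ ∂ᵥ^β u` on `ℝ × ℝ³`. -/
noncomputable def mixedPartial (k : ℕ) (β : Fin 3 → ℕ) (u : ℝ × V3 → ℝ) : ℝ × V3 → ℝ :=
  (dirDeriv (1, 0))^[k] ((dirDeriv (0, basisVec 0))^[β 0]
    ((dirDeriv (0, basisVec 1))^[β 1] ((dirDeriv (0, basisVec 2))^[β 2] u)))

/-- `g` is analytic on the open set `Ω ⊆ ℝ × ℝ³` with constant `A`, in the `L²` sense: `g` is
smooth on `Ω` and `‖∂^α g‖_{L²(Ω)} ≤ A^{|α|+1} α!` for every multi-index `α = (k, β)`. -/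
structure IsAnalyticL2 (A : ℝ) (Ω : Set (ℝ × V3)) (g : ℝ × V3 → ℝ) : Prop where
  smooth : ContDiffOn ℝ ∞ g Ω
  bound : ∀ (k : ℕ) (β : Fin 3 → ℕ),
    eLpNorm (mixedPartial k β g) 2 (volume.restrict Ω)
      ≤ ENNReal.ofReal (A ^ (k + ∑ i, β i + 1) * (k.factorial * ∏ i, (β i).factorial : ℕ))

end Landau

/-! The equation is treated as an abstract evolution problem u' + Lu = g for an embedding V → H =
L²(ℝ³), where L comes from a time-independent bounded bilinear form b on V that is coercive up to a
multiple of the H-norm. Two things are needed: the linearized Landau operator fits this frame, and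
the frame controls t ∂ₜf.

The Landau operator. Put D = ∇ + v/2. Since a(z)z = 0, the drift terms in -Γ(√μ, f) cancel and its
pairing with φ is exactly ∫ ā Df · Dφ (`pairGamma_local`). A measurable factorization ā = SᵀS
(`nonempty_root`, resting on the lower bound `exists_aBar_lower`) realizes V as the closed subspace
of pairs (f, S Df) in L² × L², and test functions are dense in it (`dense_testSpace`). In -Γ(f, √μ)
both f and φ carry a derivative under the kernel a(v - w). Integrating by parts in both variables
moves these derivatives to the kernel, which becomes at worst as singular as |z|^γ, and this is
locally integrable because γ > -3 (`double_integration_by_parts`). With the Gaussian weights this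
part is a bounded form on L² (`exists_coupling_bound'`), so b is bounded and coercive modulo L²
(`exists_energyForm`). The norm of V differs from ‖f‖² + ‖f‖_A² only by the cross term between S∇f
and S(vf/2). That term integrates to order zero, because div(āv) = 2(3+γ)(|·|^γ * μ) is bounded.
Hence the A-norm is controlled by the norm of V (`exists_normASq_le`).

The abstract estimate. Formally u' and u'' solve the same equation with sources g' and g''. The
functional α‖u‖² + βt²‖u'‖² + t⁴‖u''‖² satisfies a Grönwall inequality: the terms produced by
differentiating the weights are rewritten with the equation, ‖u'‖² = (g, u') - b(u, u'), and the
products of V-norms are absorbed by the dissipation of two neighbouring levels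
(`energy_inequality`). No symmetry of b enters. Only ‖u‖ is needed at the initial time, since the
other weights vanish there. A weak solution has no time derivative a priori, so the estimate is
applied to third backward difference quotients of iterated time primitives
(`exists_regularization`). The third difference kills the polynomials in t that the initial datum
leaves behind. The bound of u'' makes the first derivatives uniformly Lipschitz away from t = 0;
interpolation then gives their convergence in H, and coercivity gives it in V. The same Lipschitz
bound yields the one-sided derivative at t = T (`smoothing_estimate`).

Of the analyticity of g only the L² bounds of ∂ₜᵏg for k ≤ 3 are used. A Sobolev inequality in time
turns them into uniform bounds of the slices for k ≤ 2 (`exists_source`). -/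

namespace Landau

/-! ### Backward difference quotients in time -/

section DifferenceQuotients

variable {E F : Type*} [NormedAddCommGroup E] [NormedSpace ℝ E]
  [NormedAddCommGroup F] [NormedSpace ℝ F]

/-- The backward difference quotient with step `h`. -/
noncomputable def diffq (h : ℝ) (w : ℝ → E) (t : ℝ) : E := h⁻¹ • (w t - w (t - h))

/-- The third iterated backward difference quotient. -/
noncomputable def diffq3 (h : ℝ) (w : ℝ → E) : ℝ → E := diffq h (diffq h (diffq h w))

lemma map_diffq (L : E →L[ℝ] F) (h : ℝ) (w : ℝ → E) (t : ℝ) :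
    L (diffq h w t) = diffq h (fun s => L (w s)) t := by
  simp [diffq]

lemma map_diffq3 (L : E →L[ℝ] F) (h : ℝ) (w : ℝ → E) (t : ℝ) :
    L (diffq3 h w t) = diffq3 h (fun s => L (w s)) t := by
  simp only [diffq3, map_diffq]

lemma diffq_add (h : ℝ) (w w' : ℝ → E) (t : ℝ) :
    diffq h (fun s => w s + w' s) t = diffq h w t + diffq h w' t := by
  simp only [diffq, ← smul_add]; congr 1; abel

lemma diffq3_add (h : ℝ) (w w' : ℝ → E) (t : ℝ) :
    diffq3 h (fun s => w s + w' s) t = diffq3 h w t + diffq3 h w' t := by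
  simp only [diffq3]
  rw [show diffq h (fun s => w s + w' s) = fun s => diffq h w s + diffq h w' s from
    funext (diffq_add h w w')]
  rw [show diffq h (fun s => diffq h w s + diffq h w' s)
    = fun s => diffq h (diffq h w) s + diffq h (diffq h w') s from funext (diffq_add h _ _)]
  exact diffq_add h _ _ t

lemma hasDerivAt_diffq {h a T : ℝ} (hh : 0 < h) {w w' : ℝ → E}
    (hw : ∀ s ∈ Ioo a T, HasDerivAt w (w' s) s) :
    ∀ s ∈ Ioo (a + h) T, HasDerivAt (diffq h w) (diffq h w' s) s := by
  intro s hs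
  have h1 := hw s ⟨by linarith [hs.1], hs.2⟩
  have h2 := hw (s - h) ⟨by linarith [hs.1], by linarith [hs.2]⟩
  have h3 : HasDerivAt (fun s => w (s - h)) (w' (s - h)) s := by
    simpa using HasDerivAt.comp_sub_const s h h2
  exact (h1.sub h3).const_smul h⁻¹

lemma hasDerivAt_diffq3 {h T : ℝ} (hh : 0 < h) {w w' : ℝ → E}
    (hw : ∀ s ∈ Ioo 0 T, HasDerivAt w (w' s) s) :
    ∀ s ∈ Ioo (3 * h) T, HasDerivAt (diffq3 h w) (diffq3 h w' s) s := by
  have := hasDerivAt_diffq hh (hasDerivAt_diffq hh (hasDerivAt_diffq hh hw))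
  intro s hs
  exact this s ⟨by linarith [hs.1], hs.2⟩

/-- Mean value inequality for s ↦ w s - s • x. A difference quotient is an average of the
derivative, so it stays in every closed ball that contains the derivative. -/
lemma norm_diffq_sub_le {h t K : ℝ} (hh : 0 < h) {w p : ℝ → E} {x : E}
    (hw : ∀ s ∈ Icc (t - h) t, HasDerivAt w (p s) s) (hK : ∀ s ∈ Icc (t - h) t, ‖p s - x‖ ≤ K) :
    ‖diffq h w t - x‖ ≤ K := by
  have h1 : ∀ s ∈ Icc (t - h) t,
      HasDerivWithinAt (fun s => w s - s • x) (p s - x) (Icc (t - h) t) s := by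
    intro s hs
    have := (hw s hs).fun_sub ((hasDerivAt_id' s).smul_const x)
    simpa using this.hasDerivWithinAt
  have h2 := (convex_Icc (t - h) t).norm_image_sub_le_of_norm_hasDerivWithin_le h1 hK
    (left_mem_Icc.2 (by linarith)) (right_mem_Icc.2 (by linarith))
  have h3 : diffq h w t - x = h⁻¹ • (w t - t • x - (w (t - h) - (t - h) • x)) := by
    have : w t - t • x - (w (t - h) - (t - h) • x) = (w t - w (t - h)) - h • x := by
      rw [sub_smul]; abel
    rw [this, smul_sub, smul_smul, inv_mul_cancel₀ hh.ne', one_smul, diffq]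
  rw [h3, norm_smul, norm_inv, Real.norm_of_nonneg hh.le]
  rw [show t - (t - h) = h by ring, Real.norm_of_nonneg hh.le] at h2
  rw [inv_mul_le_iff₀ hh]; linarith

lemma norm_diffq_le {h t K : ℝ} (hh : 0 < h) {w p : ℝ → E}
    (hw : ∀ s ∈ Icc (t - h) t, HasDerivAt w (p s) s) (hK : ∀ s ∈ Icc (t - h) t, ‖p s‖ ≤ K) :
    ‖diffq h w t‖ ≤ K := by
  simpa using norm_diffq_sub_le hh (x := 0) hw (by simpa using hK)

/-- The third difference quotient of a third primitive is an average. -/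
lemma norm_diffq3_sub_le {h t T K : ℝ} (hh : 0 < h) (ht : t ∈ Ioo (3 * h) T) {w p q r : ℝ → E}
    {x : E} (hw : ∀ s ∈ Ioo 0 T, HasDerivAt w (p s) s)
    (hp : ∀ s ∈ Ioo 0 T, HasDerivAt p (q s) s)
    (hq : ∀ s ∈ Ioo 0 T, HasDerivAt q (r s) s)
    (hK : ∀ s ∈ Icc (t - 3 * h) t, ‖r s - x‖ ≤ K) :
    ‖diffq3 h w t - x‖ ≤ K := by
  have ht1 := ht.1
  have ht2 := ht.2
  -- Three nested mean value estimates, each of which trades one difference quotient for one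
  -- derivative.
  have w2 := hasDerivAt_diffq hh (hasDerivAt_diffq hh hw)
  have p1 := hasDerivAt_diffq hh hp
  refine norm_diffq_sub_le hh (p := diffq h (diffq h p))
    (fun s hs => w2 s ⟨by linarith [hs.1], by linarith [hs.2]⟩) fun s hs => ?_
  refine norm_diffq_sub_le hh (p := diffq h q)
    (fun s' hs' => p1 s' ⟨by linarith [hs.1, hs'.1], by linarith [hs.2, hs'.2]⟩) fun s' hs' => ?_
  refine norm_diffq_sub_le hh (p := r)
    (fun u hu => hq u ⟨by linarith [hs.1, hs'.1, hu.1], by linarith [hs.2, hs'.2, hu.2]⟩)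
    fun u hu => hK u ⟨by linarith [hs.1, hs'.1, hu.1], by linarith [hs.2, hs'.2, hu.2]⟩

/-- If `g` and its first two difference quotients are bounded, then so are the third difference
quotients of its first three primitives. -/
lemma norm_diffq3_primitive_le {h t T K : ℝ} (hh : 0 < h) (ht : t ∈ Ioo (3 * h) T)
    {G₃ G₂ G₁ g : ℝ → E} (h3 : ∀ s ∈ Ioo 0 T, HasDerivAt G₃ (G₂ s) s)
    (h2 : ∀ s ∈ Ioo 0 T, HasDerivAt G₂ (G₁ s) s) (h1 : ∀ s ∈ Ioo 0 T, HasDerivAt G₁ (g s) s)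
    (hg0 : ∀ s ∈ Ioo 0 T, ‖g s‖ ≤ K) (hg1 : ∀ s ∈ Ioo h T, ‖diffq h g s‖ ≤ K)
    (hg2 : ∀ s ∈ Ioo (2 * h) T, ‖diffq h (diffq h g) s‖ ≤ K) :
    ‖diffq3 h G₃ t‖ ≤ K ∧ ‖diffq3 h G₂ t‖ ≤ K ∧ ‖diffq3 h G₁ t‖ ≤ K := by
  have ht1 := ht.1
  have ht2 := ht.2
  refine ⟨?_, ?_, ?_⟩
  · simpa using norm_diffq3_sub_le hh ht (x := 0) h3 h2 h1
      (by simpa using fun s hs1 hs2 => hg0 s ⟨by linarith, by linarith⟩)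
  · have w2 := hasDerivAt_diffq hh (hasDerivAt_diffq hh h2)
    have p1 := hasDerivAt_diffq hh h1
    refine norm_diffq_le hh (p := diffq h (diffq h G₁))
      (fun s hs => w2 s ⟨by linarith [hs.1], by linarith [hs.2]⟩) fun s hs => ?_
    exact norm_diffq_le hh (p := diffq h g)
      (fun s' hs' => p1 s' ⟨by linarith [hs.1, hs'.1], by linarith [hs.2, hs'.2]⟩)
      fun s' hs' => hg1 s' ⟨by linarith [hs.1, hs'.1], by linarith [hs.2, hs'.2]⟩
  · have w2 := hasDerivAt_diffq hh (hasDerivAt_diffq hh h1)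
    exact norm_diffq_le hh (p := diffq h (diffq h g))
      (fun s hs => w2 s ⟨by linarith [hs.1], by linarith [hs.2]⟩)
      fun s hs => hg2 s ⟨by linarith [hs.1], by linarith [hs.2]⟩

end DifferenceQuotients

/-! ### The weighted energy estimate -/

section Energy

variable {H V : Type*} [NormedAddCommGroup H] [InnerProductSpace ℝ H]
  [NormedAddCommGroup V] [InnerProductSpace ℝ V]

/-- The constants of the energy estimate for `u' + L u = g` with `b` bounded by `B`. -/
noncomputable def energyConst (T M K B C : ℝ) : ℝ :=
  Real.exp ((2 + 2 * C) * T) *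
    ((((4 * B ^ 2 + 1) * B ^ 2 + 1) * (M + 1) ^ 2)
      + K ^ 2 * (((4 * B ^ 2 + 1) * B ^ 2 + 1) + (4 * B ^ 2 + 1) * (1 + T ^ 2)
          + 4 * T ^ 2 + T ^ 4) * T)

/-- The differential inequality at one instant, with all norms and forms replaced by real numbers:
xᵢ is the H-norm and Nᵢ the V-norm of the i-th time derivative, bᵢⱼ the values of the form, sᵢ and
i₀ᵢ the source terms, τ the time elapsed. The left side is the derivative of the weighted energy
plus the dissipation τ²N₁² that is to be kept. -/
lemma energy_inequality {τ T K B C x0 x1 x2 N0 N1 N2 b00 b01 b11 b12 b22 s0 s1 s2 i01 i02 : ℝ}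
    (hτ : 0 ≤ τ) (hτT : τ ≤ T)
    (c0 : N0 ^ 2 ≤ b00 + C * x0 ^ 2) (c1 : N1 ^ 2 ≤ b11 + C * x1 ^ 2)
    (c2 : N2 ^ 2 ≤ b22 + C * x2 ^ 2) (hb01 : -b01 ≤ B * N0 * N1) (hb12 : -b12 ≤ B * N1 * N2)
    (hs0 : s0 ≤ K * x0) (hs1 : s1 ≤ K * x1) (hs2 : s2 ≤ K * x2) (hi01 : i01 ≤ K * x1)
    (hi02 : i02 ≤ K * x2) (e1 : x1 ^ 2 = i01 - b01) (e2 : x2 ^ 2 = i02 - b12) :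
    ((4 * B ^ 2 + 1) * B ^ 2 + 1) * (2 * (s0 - b00))
      + (4 * B ^ 2 + 1) * (2 * τ * x1 ^ 2 + τ ^ 2 * (2 * (s1 - b11)))
      + (4 * τ ^ 3 * x2 ^ 2 + τ ^ 4 * (2 * (s2 - b22))) + τ ^ 2 * N1 ^ 2
    ≤ (2 + 2 * C) * (((4 * B ^ 2 + 1) * B ^ 2 + 1) * x0 ^ 2
        + (4 * B ^ 2 + 1) * (τ ^ 2 * x1 ^ 2) + τ ^ 4 * x2 ^ 2)
      + K ^ 2 * (((4 * B ^ 2 + 1) * B ^ 2 + 1) + (4 * B ^ 2 + 1) * (1 + T ^ 2)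
          + 4 * T ^ 2 + T ^ 4) := by
  have hT2 : τ ^ 2 ≤ T ^ 2 := by gcongr
  have hT4 : τ ^ 4 ≤ T ^ 4 := by gcongr
  have d0 : 2 * (s0 - b00) ≤ (2 + 2 * C) * x0 ^ 2 + K ^ 2 - 2 * N0 ^ 2 := by
    linarith [sq_nonneg (K - x0), sq_nonneg x0]
  have d1 : 2 * τ * x1 ^ 2 + τ ^ 2 * (2 * (s1 - b11))
      ≤ (2 + 2 * C) * (τ ^ 2 * x1 ^ 2) + K ^ 2 * (1 + T ^ 2) - τ ^ 2 * N1 ^ 2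
        + B ^ 2 * N0 ^ 2 := by
    -- The derivative of the weight τ² produces 2τx₁², which Grönwall cannot absorb uniformly as τ →
    -- 0. The equation tested with u' replaces x₁² by Kx₁ + BN₀N₁; Young's inequality then costs
    -- only B²N₀² from level 0 and half of the dissipation of level 1. Level 2 is treated in the
    -- same way.
    have a1 : 2 * τ * x1 ^ 2 ≤ 2 * τ * (K * x1 + B * N0 * N1) := by
      apply mul_le_mul_of_nonneg_left _ (by positivity); linarith
    have a2 : τ ^ 2 * (2 * (s1 - b11)) ≤ τ ^ 2 * (K ^ 2 + x1 ^ 2 - 2 * N1 ^ 2 + 2 * C * x1 ^ 2) := by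
      apply mul_le_mul_of_nonneg_left _ (by positivity)
      linarith [sq_nonneg (K - x1)]
    have a3 : τ ^ 2 * K ^ 2 ≤ T ^ 2 * K ^ 2 := by gcongr
    linarith [sq_nonneg (K - τ * x1), sq_nonneg (B * N0 - τ * N1)]
  have d2 : 4 * τ ^ 3 * x2 ^ 2 + τ ^ 4 * (2 * (s2 - b22))
      ≤ (2 + 2 * C) * (τ ^ 4 * x2 ^ 2) + K ^ 2 * (4 * T ^ 2 + T ^ 4) - τ ^ 4 * N2 ^ 2
        + 4 * B ^ 2 * (τ ^ 2 * N1 ^ 2) := by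
    have a1 : 4 * τ ^ 3 * x2 ^ 2 ≤ 4 * τ ^ 3 * (K * x2 + B * N1 * N2) := by
      apply mul_le_mul_of_nonneg_left _ (by positivity); linarith
    have a2 : τ ^ 4 * (2 * (s2 - b22)) ≤ τ ^ 4 * (K ^ 2 + x2 ^ 2 - 2 * N2 ^ 2 + 2 * C * x2 ^ 2) := by
      apply mul_le_mul_of_nonneg_left _ (by positivity)
      linarith [sq_nonneg (K - x2)]
    have a3 : τ ^ 4 * K ^ 2 ≤ T ^ 4 * K ^ 2 := by gcongr
    have a4 : 4 * τ ^ 2 * K ^ 2 ≤ 4 * T ^ 2 * K ^ 2 := by gcongr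
    linarith [sq_nonneg (2 * τ * K - τ ^ 2 * x2), sq_nonneg (2 * B * (τ * N1) - τ ^ 2 * N2)]
  -- Choice of weights: level 2 costs 4B²τ²N₁², so the factor 4B² + 1 on level 1 leaves exactly
  -- τ²N₁². Level 1 then costs (4B² + 1)B²N₀², which the factor on level 0 dominates.
  have m0 := mul_le_mul_of_nonneg_left d0 (show 0 ≤ (4 * B ^ 2 + 1) * B ^ 2 + 1 by positivity)
  have m1 := mul_le_mul_of_nonneg_left d1 (show 0 ≤ 4 * B ^ 2 + 1 by positivity)
  have p0 : 0 ≤ ((4 * B ^ 2 + 1) * B ^ 2 + 2) * N0 ^ 2 := by positivity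
  have p2 : 0 ≤ τ ^ 4 * N2 ^ 2 := by positivity
  linarith

/-- Grönwall's argument for curves that are regular enough to be differentiated classically. The
weights vanish at time a, so only `ι (U0 a)` enters the constant, and no information on the
derivatives at a is required. -/
theorem energy_estimate (ι : V →L[ℝ] H) (b : V →L[ℝ] V →L[ℝ] ℝ) {B C : ℝ}
    (hC : 0 ≤ C) (hbB : ∀ u v, |b u v| ≤ B * ‖u‖ * ‖v‖)
    (hcoer : ∀ u, ‖u‖ ^ 2 ≤ b u u + C * ‖ι u‖ ^ 2)
    {a₀ a t T M K : ℝ} (ha₀ : 0 ≤ a₀) (ha : a ∈ Ioo a₀ T) (ht : t ∈ Ico a T)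
    (hM : 0 ≤ M)
    {U0 U1 U2 : ℝ → V} {d g0 g1 g2 : ℝ → H}
    (hU0 : ∀ t ∈ Ioo a₀ T, HasDerivAt U0 (U1 t) t)
    (hU1 : ∀ t ∈ Ioo a₀ T, HasDerivAt U1 (U2 t) t)
    (hU2 : ∀ t ∈ Ioo a₀ T, HasDerivAt (fun s => ι (U2 s)) (d t) t)
    (e0 : ∀ t ∈ Ioo a₀ T, ∀ φ, inner ℝ (ι (U1 t)) (ι φ) + b (U0 t) φ = inner ℝ (g0 t) (ι φ))
    (e1 : ∀ t ∈ Ioo a₀ T, ∀ φ, inner ℝ (ι (U2 t)) (ι φ) + b (U1 t) φ = inner ℝ (g1 t) (ι φ))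
    (e2 : ∀ t ∈ Ioo a₀ T, ∀ φ, inner ℝ (d t) (ι φ) + b (U2 t) φ = inner ℝ (g2 t) (ι φ))
    (hg0 : ∀ t ∈ Ioo a₀ T, ‖g0 t‖ ≤ K) (hg1 : ∀ t ∈ Ioo a₀ T, ‖g1 t‖ ≤ K)
    (hg2 : ∀ t ∈ Ioo a₀ T, ‖g2 t‖ ≤ K) (hstart : ‖ι (U0 a)‖ ≤ M + 1) :
    (t - a) ^ 2 * ‖ι (U1 t)‖ ^ 2 + (t - a) ^ 4 * ‖ι (U2 t)‖ ^ 2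
      + ∫ s in a..t, (s - a) ^ 2 * ‖U1 s‖ ^ 2 ≤ energyConst T M K B C := by
  set α : ℝ := (4 * B ^ 2 + 1) * B ^ 2 + 1 with hα
  set β : ℝ := 4 * B ^ 2 + 1 with hβ
  set K' : ℝ := K ^ 2 * (α + β * (1 + T ^ 2) + 4 * T ^ 2 + T ^ 4) with hK'
  set lam : ℝ := 2 + 2 * C with hlam
  have hα1 : 1 ≤ α := by rw [hα]; nlinarith [mul_nonneg (show 0 ≤ 4 * B ^ 2 + 1 by positivity) (sq_nonneg B)]
  have hβ1 : 1 ≤ β := by rw [hβ]; nlinarith [sq_nonneg B]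
  have hT : 0 < T := lt_of_le_of_lt ha₀ (ha.1.trans ha.2)
  have hK'0 : 0 ≤ K' := by positivity
  set Φ : ℝ → ℝ := fun s => α * ‖ι (U0 s)‖ ^ 2 + β * ((s - a) ^ 2 * ‖ι (U1 s)‖ ^ 2)
    + (s - a) ^ 4 * ‖ι (U2 s)‖ ^ 2 with hΦ
  set J : ℝ → ℝ := fun s => ∫ r in a..s, (r - a) ^ 2 * ‖U1 r‖ ^ 2 with hJ
  have hsub : ∀ s ∈ Icc a t, s ∈ Ioo a₀ T := fun s hs => ⟨ha.1.trans_le hs.1, hs.2.trans_lt ht.2⟩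
  have hcont : ∀ s ∈ Ioo a₀ T, ContinuousAt (fun r => (r - a) ^ 2 * ‖U1 r‖ ^ 2) s := fun s hs =>
    ((continuousAt_id.sub continuousAt_const).pow 2).mul ((hU1 s hs).continuousAt.norm.pow 2)
  have hJd : ∀ s ∈ Icc a t, HasDerivAt J ((s - a) ^ 2 * ‖U1 s‖ ^ 2) s := by
    intro s hs
    apply intervalIntegral.integral_hasDerivAt_right
    · apply ContinuousOn.intervalIntegrable
      intro r hr
      rw [uIcc_of_le hs.1] at hr
      exact (hcont r (hsub r ⟨hr.1, hr.2.trans hs.2⟩)).continuousWithinAt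
    · apply ContinuousOn.stronglyMeasurableAtFilter (s := Ioo a₀ T) isOpen_Ioo
        (fun r hr => (hcont r hr).continuousWithinAt) s (hsub s hs)
    · exact hcont s (hsub s hs)
  have hΦd : ∀ s ∈ Icc a t, HasDerivAt Φ
      (α * (2 * inner ℝ (ι (U0 s)) (ι (U1 s)))
        + β * (2 * (s - a) * ‖ι (U1 s)‖ ^ 2 + (s - a) ^ 2 * (2 * inner ℝ (ι (U1 s)) (ι (U2 s))))
        + (4 * (s - a) ^ 3 * ‖ι (U2 s)‖ ^ 2
          + (s - a) ^ 4 * (2 * inner ℝ (ι (U2 s)) (d s)))) s := by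
    intro s hs
    have k0 := ((ι.hasFDerivAt.comp_hasDerivAt s (hU0 s (hsub s hs))).norm_sq).const_mul α
    have k1 := (ι.hasFDerivAt.comp_hasDerivAt s (hU1 s (hsub s hs))).norm_sq
    have k2 := (hU2 s (hsub s hs)).norm_sq
    have q2 : HasDerivAt (fun r : ℝ => (r - a) ^ 2) (2 * (s - a)) s := by
      simpa using ((hasDerivAt_id' s).sub_const a).fun_pow 2
    have q4 : HasDerivAt (fun r : ℝ => (r - a) ^ 4) (4 * (s - a) ^ 3) s := by
      simpa using ((hasDerivAt_id' s).sub_const a).fun_pow 4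
    exact (k0.add ((q2.mul k1).const_mul β)).add (q4.mul k2)
  -- Grönwall in integrated form: W is nonincreasing. The dissipation integral J may sit inside the
  -- exponential factor because J ≥ 0, so the extra term -λJ has the right sign.
  set W : ℝ → ℝ := fun s => Real.exp (-(lam * (s - a))) * (Φ s + J s) - K' * (s - a) with hW
  have hJ0 : ∀ s ∈ Icc a t, 0 ≤ J s := fun s hs =>
    intervalIntegral.integral_nonneg hs.1 fun r _ => by positivity
  have hWd : ∀ s ∈ Icc a t, ∃ w ≤ 0, HasDerivAt W w s := by
    intro s hs
    have hs' := hsub s hs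
    have ed : HasDerivAt (fun r => Real.exp (-(lam * (r - a))))
        (Real.exp (-(lam * (s - a))) * (-(lam * 1))) s :=
      (((hasDerivAt_id s).sub_const a).const_mul lam).neg.exp
    have hd := (ed.mul ((hΦd s hs).add (hJd s hs))).sub
      (((hasDerivAt_id s).sub_const a).const_mul K')
    refine ⟨_, ?_, hd⟩
    have hin : ∀ x y : H, inner ℝ x y ≤ ‖x‖ * ‖y‖ := fun x y => real_inner_le_norm x y
    have key := energy_inequality (τ := s - a) (T := T) (K := K) (B := B) (C := C)
      (x0 := ‖ι (U0 s)‖) (x1 := ‖ι (U1 s)‖) (x2 := ‖ι (U2 s)‖) (N0 := ‖U0 s‖) (N1 := ‖U1 s‖)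
      (N2 := ‖U2 s‖) (b00 := b (U0 s) (U0 s)) (b01 := b (U0 s) (U1 s)) (b11 := b (U1 s) (U1 s))
      (b12 := b (U1 s) (U2 s)) (b22 := b (U2 s) (U2 s)) (s0 := inner ℝ (g0 s) (ι (U0 s)))
      (s1 := inner ℝ (g1 s) (ι (U1 s))) (s2 := inner ℝ (g2 s) (ι (U2 s)))
      (i01 := inner ℝ (g0 s) (ι (U1 s))) (i02 := inner ℝ (g1 s) (ι (U2 s)))
      (by linarith [hs.1]) (by linarith [hs'.2, ha.1])
      (hcoer _) (hcoer _) (hcoer _) ((neg_le_abs _).trans (hbB _ _))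
      ((neg_le_abs _).trans (hbB _ _))
      ((hin _ _).trans (mul_le_mul_of_nonneg_right (hg0 s hs') (norm_nonneg _)))
      ((hin _ _).trans (mul_le_mul_of_nonneg_right (hg1 s hs') (norm_nonneg _)))
      ((hin _ _).trans (mul_le_mul_of_nonneg_right (hg2 s hs') (norm_nonneg _)))
      ((hin _ _).trans (mul_le_mul_of_nonneg_right (hg0 s hs') (norm_nonneg _)))
      ((hin _ _).trans (mul_le_mul_of_nonneg_right (hg1 s hs') (norm_nonneg _)))
      (by rw [← e0 s hs', real_inner_self_eq_norm_sq]; ring)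
      (by rw [← e1 s hs', real_inner_self_eq_norm_sq]; ring)
    have f0 : inner ℝ (ι (U0 s)) (ι (U1 s)) = inner ℝ (g0 s) (ι (U0 s)) - b (U0 s) (U0 s) := by
      rw [real_inner_comm]; exact eq_sub_iff_add_eq.2 (e0 s hs' (U0 s))
    have f1 : inner ℝ (ι (U1 s)) (ι (U2 s)) = inner ℝ (g1 s) (ι (U1 s)) - b (U1 s) (U1 s) := by
      rw [real_inner_comm]; exact eq_sub_iff_add_eq.2 (e1 s hs' (U1 s))
    have f2 : inner ℝ (ι (U2 s)) (d s) = inner ℝ (g2 s) (ι (U2 s)) - b (U2 s) (U2 s) := by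
      rw [real_inner_comm]; exact eq_sub_iff_add_eq.2 (e2 s hs' (U2 s))
    rw [f0, f1, f2]
    have hE0 := Real.exp_pos (-(lam * (s - a)))
    have hE1 : Real.exp (-(lam * (s - a))) ≤ 1 := by
      rw [Real.exp_le_one_iff, neg_nonpos]
      exact mul_nonneg (by positivity) (by linarith [hs.1])
    have hJs := mul_nonneg (show 0 ≤ lam by positivity) (hJ0 s hs)
    have key' := mul_le_mul_of_nonneg_left key hE0.le
    have h5 : Real.exp (-(lam * (s - a))) * K' ≤ K' := mul_le_of_le_one_left hK'0 hE1
    have h6 := mul_nonneg hE0.le hJs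
    have h7 : (Φ + J) s = α * ‖ι (U0 s)‖ ^ 2 + β * ((s - a) ^ 2 * ‖ι (U1 s)‖ ^ 2)
      + (s - a) ^ 4 * ‖ι (U2 s)‖ ^ 2 + J s := rfl
    rw [h7]
    have h8 : Real.exp (-(lam * (s - a))) * K' = Real.exp (-(lam * (s - a))) *
      (K ^ 2 * (α + β * (1 + T ^ 2) + 4 * T ^ 2 + T ^ 4)) := rfl
    simp only [mul_add] at key' h8 ⊢
    linarith
  have hanti : AntitoneOn W (Icc a t) := by
    apply antitoneOn_of_deriv_nonpos (convex_Icc a t)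
    · intro s hs
      obtain ⟨w, -, hw⟩ := hWd s hs
      exact hw.continuousAt.continuousWithinAt
    · intro s hs
      obtain ⟨w, -, hw⟩ := hWd s (interior_subset hs)
      exact hw.differentiableAt.differentiableWithinAt
    · intro s hs
      obtain ⟨w, hw0, hw⟩ := hWd s (interior_subset hs)
      rwa [hw.deriv]
  have hfin := hanti (left_mem_Icc.2 ht.1) (right_mem_Icc.2 ht.1) ht.1
  have hJa : J a = 0 := by simp [hJ]
  have hta : t - a ≤ T := by linarith [ht.2, ha.1]
  have hΦa : Φ a ≤ α * (M + 1) ^ 2 := by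
    simp only [hΦ, sub_self]
    have : ‖ι (U0 a)‖ ^ 2 ≤ (M + 1) ^ 2 := by gcongr
    nlinarith
  have h1 : Real.exp (-(lam * (t - a))) * (Φ t + J t) ≤ α * (M + 1) ^ 2 + K' * T := by
    simp only [hW, hJa, sub_self, mul_zero, neg_zero, Real.exp_zero, one_mul, add_zero,
      sub_zero] at hfin
    have := mul_le_mul_of_nonneg_left hta hK'0
    linarith
  have h2 : Φ t + J t ≤ energyConst T M K B C := by
    have h3 : Φ t + J t
        = Real.exp (lam * (t - a)) * (Real.exp (-(lam * (t - a))) * (Φ t + J t)) := by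
      rw [← mul_assoc, ← Real.exp_add]; simp
    rw [h3]
    calc _ ≤ Real.exp (lam * (t - a)) * (α * (M + 1) ^ 2 + K' * T) := by gcongr
      _ ≤ Real.exp (lam * T) * (α * (M + 1) ^ 2 + K' * T) := by
        have : lam * (t - a) ≤ lam * T := by gcongr
        gcongr
  have h4 : (t - a) ^ 2 * ‖ι (U1 t)‖ ^ 2 + (t - a) ^ 4 * ‖ι (U2 t)‖ ^ 2 ≤ Φ t := by
    have h5 : 0 ≤ (t - a) ^ 2 * ‖ι (U1 t)‖ ^ 2 := by positivity
    have h6 : 0 ≤ α * ‖ι (U0 t)‖ ^ 2 := by positivity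
    have h7 := mul_le_mul_of_nonneg_right hβ1 h5
    simp only [hΦ]
    linarith
  linarith

end Energy
end Landau

/-! ### Regularization in time of weak solutions -/

namespace Landau

section Approximation

variable {E : Type*} [NormedAddCommGroup E] [NormedSpace ℝ E]

lemma diffq3_congr {h T t : ℝ} (hh : 0 < h) (ht : t ∈ Ioo (3 * h) T) {w w' : ℝ → E}
    (hw : ∀ s ∈ Ioo 0 T, w s = w' s) : diffq3 h w t = diffq3 h w' t := by
  have h1 := ht.1
  have h2 := ht.2
  simp only [diffq3, diffq]
  rw [hw t ⟨by linarith, h2⟩, hw (t - h) ⟨by linarith, by linarith⟩,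
    hw (t - h - h) ⟨by linarith, by linarith⟩, hw (t - h - h - h) ⟨by linarith, by linarith⟩]

/-- Integrating the equation up to three times turns the initial datum into polynomials of degree at
most two. This is why third differences are taken. -/
lemma diffq3_quadratic {h : ℝ} (c₀ c₁ c₂ t : ℝ) :
    diffq3 h (fun s => c₀ + s * c₁ + s ^ 2 * c₂) t = 0 := by
  simp only [diffq3, diffq, smul_eq_mul]
  ring

lemma hasDerivAt_primitive [CompleteSpace E] {T : ℝ} {w : ℝ → E} (hw : ContinuousOn w (Ioo 0 T))
    (hi : IntegrableOn w (Ioc 0 T)) :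
    ∀ t ∈ Ioo 0 T, HasDerivAt (fun t => ∫ s in (0 : ℝ)..t, w s) (w t) t := by
  intro t ht
  apply intervalIntegral.integral_hasDerivAt_right
  · rw [intervalIntegrable_iff_integrableOn_Ioc_of_le ht.1.le]
    exact hi.mono_set (Ioc_subset_Ioc_right ht.2.le)
  · exact hw.stronglyMeasurableAtFilter isOpen_Ioo t ht
  · exact hw.continuousAt (Ioo_mem_nhds ht.1 ht.2)

lemma continuousOn_primitive_Icc {T : ℝ} (hT : 0 ≤ T) {w : ℝ → E}
    (hi : IntegrableOn w (Ioc 0 T)) :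
    ContinuousOn (fun t => ∫ s in (0 : ℝ)..t, w s) (Icc 0 T) := by
  have := intervalIntegral.continuousOn_primitive_interval (a := 0) (b := T) (f := w)
    (μ := volume) (by rwa [uIcc_of_le hT, integrableOn_Icc_iff_integrableOn_Ioc])
  rwa [uIcc_of_le hT] at this

omit [NormedSpace ℝ E] in
lemma integrableOn_Ioc_of_continuousOn {T : ℝ} {w : ℝ → E} (hw : ContinuousOn w (Icc 0 T)) :
    IntegrableOn w (Ioc 0 T) :=
  hw.integrableOn_Icc.mono_set Ioc_subset_Icc_self

omit [NormedSpace ℝ E] in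
lemma intervalIntegrable_of_mem_Icc {T t : ℝ} {w : ℝ → E} (ht : t ∈ Icc 0 T)
    (hw : IntegrableOn w (Ioc 0 T)) : IntervalIntegrable w volume 0 t :=
  (intervalIntegrable_iff_integrableOn_Ioc_of_le ht.1).2
    (hw.mono_set (Ioc_subset_Ioc_right ht.2))

variable {H V : Type*} [NormedAddCommGroup H] [InnerProductSpace ℝ H] [CompleteSpace H]
  [NormedAddCommGroup V] [InnerProductSpace ℝ V] [CompleteSpace V]

/-- Regularization in time of a weak solution of an evolution equation. -/
theorem exists_regularization (ι : V →L[ℝ] H) (b : V →L[ℝ] V →L[ℝ] ℝ) {T K : ℝ} (hT : 0 < T)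
    {f g : ℝ → H} {ft : ℝ → V} {D : Set V} (hD : Dense D)
    (hf : ContinuousOn f (Icc 0 T)) (hft : IntegrableOn ft (Ioc 0 T))
    (hlift : ∀ᵐ s ∂volume.restrict (Ioc 0 T), ι (ft s) = f s)
    (hgc : ContinuousOn g (Ioo 0 T)) (hg0 : ∀ s ∈ Ioo 0 T, ‖g s‖ ≤ K)
    (hg1 : ∀ h > 0, ∀ s ∈ Ioo h T, ‖diffq h g s‖ ≤ K)
    (hg2 : ∀ h > 0, ∀ s ∈ Ioo (2 * h) T, ‖diffq h (diffq h g) s‖ ≤ K)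
    (hweak : ∀ φ ∈ D, ∀ t ∈ Icc 0 T, inner ℝ (f t) (ι φ) + ∫ s in (0 : ℝ)..t, b (ft s) φ
      = inner ℝ (f 0) (ι φ) + ∫ s in (0 : ℝ)..t, inner ℝ (g s) (ι φ)) :
    ∃ (U0 U1 U2 : ℝ → ℝ → V) (d g0 g1 g2 : ℝ → ℝ → H), ∀ h > 0, ∀ t ∈ Ioo (3 * h) T,
      HasDerivAt (U0 h) (U1 h t) t ∧ HasDerivAt (U1 h) (U2 h t) t ∧
      HasDerivAt (fun s => ι (U2 h s)) (d h t) t ∧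
      (∀ φ, inner ℝ (ι (U1 h t)) (ι φ) + b (U0 h t) φ = inner ℝ (g0 h t) (ι φ)) ∧
      (∀ φ, inner ℝ (ι (U2 h t)) (ι φ) + b (U1 h t) φ = inner ℝ (g1 h t) (ι φ)) ∧
      (∀ φ, inner ℝ (d h t) (ι φ) + b (U2 h t) φ = inner ℝ (g2 h t) (ι φ)) ∧
      ‖g0 h t‖ ≤ K ∧ ‖g1 h t‖ ≤ K ∧ ‖g2 h t‖ ≤ K ∧
      ∀ x ε, (∀ s ∈ Icc (t - 3 * h) t, ‖f s - x‖ ≤ ε) → ‖ι (U0 h t) - x‖ ≤ ε := by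
  have hgi : IntegrableOn g (Ioc 0 T) := by
    rw [integrableOn_Ioc_iff_integrableOn_Ioo]
    refine Integrable.of_bound (C := K) (hgc.aestronglyMeasurable measurableSet_Ioo) ?_
    exact (ae_restrict_mem measurableSet_Ioo).mono hg0
  have hfi : IntegrableOn f (Ioc 0 T) :=
    (hf.integrableOn_Icc).mono_set Ioc_subset_Icc_self
  -- The lift `ft` is merely integrable in V, but its primitives are continuous in V, so that P2 and
  -- P3 are classically differentiable there. The curves U0, U1, U2 will be the third differences of
  -- P3, P2, P1.
  set P1 : ℝ → V := fun t => ∫ s in (0 : ℝ)..t, ft s with hP1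
  set P2 : ℝ → V := fun t => ∫ s in (0 : ℝ)..t, P1 s with hP2
  set P3 : ℝ → V := fun t => ∫ s in (0 : ℝ)..t, P2 s with hP3
  set G1 : ℝ → H := fun t => ∫ s in (0 : ℝ)..t, g s with hG1
  set G2 : ℝ → H := fun t => ∫ s in (0 : ℝ)..t, G1 s with hG2
  set G3 : ℝ → H := fun t => ∫ s in (0 : ℝ)..t, G2 s with hG3
  have cP1 := continuousOn_primitive_Icc hT.le hft
  have cP2 := continuousOn_primitive_Icc hT.le (integrableOn_Ioc_of_continuousOn cP1)
  have cP3 := continuousOn_primitive_Icc hT.le (integrableOn_Ioc_of_continuousOn cP2)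
  have cG1 := continuousOn_primitive_Icc hT.le hgi
  have cG2 := continuousOn_primitive_Icc hT.le (integrableOn_Ioc_of_continuousOn cG1)
  have cG3 := continuousOn_primitive_Icc hT.le (integrableOn_Ioc_of_continuousOn cG2)
  have dP2 := hasDerivAt_primitive (cP1.mono Ioo_subset_Icc_self) (integrableOn_Ioc_of_continuousOn cP1)
  have dP3 := hasDerivAt_primitive (cP2.mono Ioo_subset_Icc_self) (integrableOn_Ioc_of_continuousOn cP2)
  have dG1 := hasDerivAt_primitive hgc hgi
  have dG2 := hasDerivAt_primitive (cG1.mono Ioo_subset_Icc_self) (integrableOn_Ioc_of_continuousOn cG1)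
  have dG3 := hasDerivAt_primitive (cG2.mono Ioo_subset_Icc_self) (integrableOn_Ioc_of_continuousOn cG2)
  have hιP1 : ∀ t ∈ Icc 0 T, ι (P1 t) = ∫ s in (0 : ℝ)..t, f s := by
    intro t ht
    rw [hP1, ← ι.intervalIntegral_comp_comm (intervalIntegrable_of_mem_Icc ht hft)]
    apply intervalIntegral.integral_congr_ae
    rw [uIoc_of_le ht.1]
    have := ae_restrict_of_ae_restrict_of_subset (Ioc_subset_Ioc_right ht.2) hlift
    exact (ae_restrict_iff' measurableSet_Ioc).1 this
  -- P1 need not be differentiable in V at every point. Its image in H is, because it is the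
  -- primitive of the continuous curve f. This is why the derivative of U2 is claimed only after
  -- applying ι.
  have dιP1 : ∀ t ∈ Ioo 0 T, HasDerivAt (fun t => ι (P1 t)) (f t) t := by
    intro t ht
    refine (hasDerivAt_primitive (hf.mono Ioo_subset_Icc_self) hfi t ht).congr_of_eventuallyEq ?_
    filter_upwards [Ioo_mem_nhds ht.1 ht.2] with s hs using hιP1 s (Ioo_subset_Icc_self hs)
  have dιP2 : ∀ t ∈ Ioo 0 T, HasDerivAt (fun t => ι (P2 t)) (ι (P1 t)) t := fun t ht =>
    ι.hasFDerivAt.comp_hasDerivAt t (dP2 t ht)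
  have dιP3 : ∀ t ∈ Ioo 0 T, HasDerivAt (fun t => ι (P3 t)) (ι (P2 t)) t := fun t ht =>
    ι.hasFDerivAt.comp_hasDerivAt t (dP3 t ht)
  -- the integrated equations
  have E1 : ∀ φ, ∀ t ∈ Icc 0 T, innerSL ℝ (ι φ) (f t) + b.flip φ (P1 t)
      = innerSL ℝ (ι φ) (f 0) + innerSL ℝ (ι φ) (G1 t) := by
    intro φ t ht
    -- After one integration in time both sides are continuous in φ for the norm of V, so the
    -- identity passes from the dense set D to all of V.
    have hcl : IsClosed {φ : V | innerSL ℝ (ι φ) (f t) + b.flip φ (P1 t)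
      = innerSL ℝ (ι φ) (f 0) + innerSL ℝ (ι φ) (G1 t)} := by
      apply isClosed_eq
      · simp only [innerSL_apply_apply, ContinuousLinearMap.flip_apply]; fun_prop
      · simp only [innerSL_apply_apply]; fun_prop
    have hsub : D ⊆ {φ : V | innerSL ℝ (ι φ) (f t) + b.flip φ (P1 t)
      = innerSL ℝ (ι φ) (f 0) + innerSL ℝ (ι φ) (G1 t)} := by
      intro ψ hψ
      have := hweak ψ hψ t ht
      simp only [mem_ofPred_eq]
      rw [hP1, hG1, ← (b.flip ψ).intervalIntegral_comp_comm (intervalIntegrable_of_mem_Icc ht hft),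
        ← (innerSL ℝ (ι ψ)).intervalIntegral_comp_comm (intervalIntegrable_of_mem_Icc ht hgi)]
      simpa only [innerSL_apply_apply, ContinuousLinearMap.flip_apply, real_inner_comm]
        using this
    exact (hcl.closure_subset_iff.2 hsub) (hD φ)
  have E2 : ∀ φ, ∀ t ∈ Icc 0 T, innerSL ℝ (ι φ) (ι (P1 t)) + b.flip φ (P2 t)
      = t * innerSL ℝ (ι φ) (f 0) + innerSL ℝ (ι φ) (G2 t) := by
    intro φ t ht
    have iL : ∀ (L : H →L[ℝ] ℝ) {w : ℝ → H}, IntegrableOn w (Ioc 0 T) →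
      IntervalIntegrable (fun s => L (w s)) volume 0 t := fun L w hw =>
        intervalIntegrable_of_mem_Icc ht (L.integrable_comp hw)
    have iL' : ∀ (L : V →L[ℝ] ℝ) {w : ℝ → V}, IntegrableOn w (Ioc 0 T) →
      IntervalIntegrable (fun s => L (w s)) volume 0 t := fun L w hw =>
        intervalIntegrable_of_mem_Icc ht (L.integrable_comp hw)
    rw [hιP1 t ht, hP2, hG2, ← (b.flip φ).intervalIntegral_comp_comm (intervalIntegrable_of_mem_Icc ht (integrableOn_Ioc_of_continuousOn cP1)),
        ← (innerSL ℝ (ι φ)).intervalIntegral_comp_comm (intervalIntegrable_of_mem_Icc ht (integrableOn_Ioc_of_continuousOn cG1)),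
        ← (innerSL ℝ (ι φ)).intervalIntegral_comp_comm (intervalIntegrable_of_mem_Icc ht hfi),
        ← intervalIntegral.integral_add (iL _ hfi) (iL' _ (integrableOn_Ioc_of_continuousOn cP1))]
    rw [intervalIntegral.integral_congr (g := fun s => innerSL ℝ (ι φ) (f 0) +
      innerSL ℝ (ι φ) (G1 s)), intervalIntegral.integral_add (by simp) (iL _ (integrableOn_Ioc_of_continuousOn cG1))]
    · simp
    · intro s hs
      rw [uIcc_of_le ht.1] at hs
      exact E1 φ s ⟨hs.1, hs.2.trans ht.2⟩
  have E3 : ∀ φ, ∀ t ∈ Icc 0 T, innerSL ℝ (ι φ) (ι (P2 t)) + b.flip φ (P3 t)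
      = t ^ 2 * (innerSL ℝ (ι φ) (f 0) / 2) + innerSL ℝ (ι φ) (G3 t) := by
    intro φ t ht
    have iL : ∀ (L : H →L[ℝ] ℝ) {w : ℝ → H}, IntegrableOn w (Ioc 0 T) →
      IntervalIntegrable (fun s => L (w s)) volume 0 t := fun L w hw =>
        intervalIntegrable_of_mem_Icc ht (L.integrable_comp hw)
    have iL' : ∀ (L : V →L[ℝ] ℝ) {w : ℝ → V}, IntegrableOn w (Ioc 0 T) →
      IntervalIntegrable (fun s => L (w s)) volume 0 t := fun L w hw =>
        intervalIntegrable_of_mem_Icc ht (L.integrable_comp hw)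
    have : innerSL ℝ (ι φ) (ι (P2 t)) = ((innerSL ℝ (ι φ)).comp ι) (P2 t) := rfl
    rw [this]
    simp only [hP2, hG3, hP3]
    rw [← (b.flip φ).intervalIntegral_comp_comm (intervalIntegrable_of_mem_Icc ht (integrableOn_Ioc_of_continuousOn cP2)),
        ← (innerSL ℝ (ι φ)).intervalIntegral_comp_comm (intervalIntegrable_of_mem_Icc ht (integrableOn_Ioc_of_continuousOn cG2)),
        ← ((innerSL ℝ (ι φ)).comp ι).intervalIntegral_comp_comm (intervalIntegrable_of_mem_Icc ht (integrableOn_Ioc_of_continuousOn cP1)),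
        ← intervalIntegral.integral_add (iL' _ (integrableOn_Ioc_of_continuousOn cP1)) (iL' _ (integrableOn_Ioc_of_continuousOn cP2))]
    rw [intervalIntegral.integral_congr (g := fun s => s * innerSL ℝ (ι φ) (f 0) +
      innerSL ℝ (ι φ) (G2 s)), intervalIntegral.integral_add _ (iL _ (integrableOn_Ioc_of_continuousOn cG2))]
    · rw [intervalIntegral.integral_mul_const, integral_id]; ring
    · exact (by fun_prop : Continuous fun s : ℝ => s * innerSL ℝ (ι φ) (f 0)).intervalIntegrable _ _
    · intro s hs
      rw [uIcc_of_le ht.1] at hs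
      exact E2 φ s ⟨hs.1, hs.2.trans ht.2⟩
  -- difference quotients of the integrated equations
  have key : ∀ (φ : V) (h : ℝ), 0 < h → ∀ t ∈ Ioo (3 * h) T, ∀ (p G : ℝ → H) (P : ℝ → V)
      (c₀ c₁ c₂ : ℝ),
      (∀ s ∈ Icc 0 T, innerSL ℝ (ι φ) (p s) + b.flip φ (P s) = (c₀ + s * c₁ + s ^ 2 * c₂)
        + innerSL ℝ (ι φ) (G s)) →
      inner ℝ (diffq3 h p t) (ι φ) + b (diffq3 h P t) φ = inner ℝ (diffq3 h G t) (ι φ) := by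
    intro φ h hh t ht p G P c₀ c₁ c₂ hE
    have := diffq3_congr hh ht (fun s hs => hE s (Ioo_subset_Icc_self hs))
    -- The third difference commutes with continuous linear maps and removes the polynomial part;
    -- what remains is the equation for the regularized curves, without the initial datum.
    rw [diffq3_add, diffq3_add, diffq3_quadratic, ← map_diffq3, ← map_diffq3, ← map_diffq3,
      zero_add] at this
    simpa only [innerSL_apply_apply, ContinuousLinearMap.flip_apply, real_inner_comm]
        using this
  refine ⟨fun h => diffq3 h P3, fun h => diffq3 h P2, fun h => diffq3 h P1, fun h => diffq3 h f,
    fun h => diffq3 h G3, fun h => diffq3 h G2, fun h => diffq3 h G1, fun h hh t ht => ?_⟩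
  have hb := norm_diffq3_primitive_le hh ht dG3 dG2 dG1 hg0 (hg1 h hh) (hg2 h hh)
  refine ⟨hasDerivAt_diffq3 hh dP3 t ht, hasDerivAt_diffq3 hh dP2 t ht, ?_, ?_, ?_, ?_,
    hb.1, hb.2.1, hb.2.2, ?_⟩
  · simp only [map_diffq3]
    exact hasDerivAt_diffq3 hh dιP1 t ht
  · intro φ
    simp only [map_diffq3 ι]
    exact key φ h hh t ht _ _ _ 0 0 (innerSL ℝ (ι φ) (f 0) / 2) fun s hs => by
      rw [E3 φ s hs]; ring
  · intro φ
    simp only [map_diffq3 ι]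
    exact key φ h hh t ht _ _ _ 0 (innerSL ℝ (ι φ) (f 0)) 0 fun s hs => by
      rw [E2 φ s hs]; ring
  · intro φ
    exact key φ h hh t ht _ _ _ (innerSL ℝ (ι φ) (f 0)) 0 0 fun s hs => by
      rw [E1 φ s hs]; ring
  · intro x ε hx
    rw [map_diffq3]
    exact norm_diffq3_sub_le hh ht dιP3 dιP2 dιP1 hx

end Approximation
end Landau

/-! ### Smoothing for the abstract evolution equation -/

namespace Landau

section Smoothing

open Filter Topology

variable {H V : Type*} [NormedAddCommGroup H] [InnerProductSpace ℝ H]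
  [NormedAddCommGroup V] [InnerProductSpace ℝ V]

/-- A bound of `y = w'` in terms of `w` and a Lipschitz constant of `y`. -/
lemma norm_deriv_le_of_lipschitz {E : Type*} [NormedAddCommGroup E] [NormedSpace ℝ E]
    {w y z : ℝ → E} {t s L e : ℝ} (hs : 0 < s)
    (hw : ∀ r ∈ Icc (t - s) t, HasDerivAt w (y r) r)
    (hy : ∀ r ∈ Icc (t - s) t, HasDerivAt y (z r) r)
    (hL : ∀ r ∈ Icc (t - s) t, ‖z r‖ ≤ L) (he : ∀ r ∈ Icc (t - s) t, ‖w r‖ ≤ e) :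
    ‖y t‖ ≤ L * s + 2 * e / s := by
  have ht : t ∈ Icc (t - s) t := right_mem_Icc.2 (by linarith)
  have hL0 : 0 ≤ L := (norm_nonneg _).trans (hL t ht)
  have h1 : ∀ r ∈ Icc (t - s) t, ‖y r - y t‖ ≤ L * s := by
    intro r hr
    have := (convex_Icc (t - s) t).norm_image_sub_le_of_norm_hasDerivWithin_le
      (fun r hr => (hy r hr).hasDerivWithinAt) hL ht hr
    refine this.trans (mul_le_mul_of_nonneg_left ?_ hL0)
    rw [Real.norm_eq_abs, abs_le]; constructor <;> linarith [hr.1, hr.2]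
  have h2 := norm_diffq_sub_le hs hw h1
  have h3 : ‖diffq s w t‖ ≤ 2 * e / s := by
    rw [diffq, norm_smul, norm_inv, Real.norm_of_nonneg hs.le, inv_mul_le_iff₀ hs,
      mul_div_cancel₀ _ hs.ne']
    linarith [norm_sub_le (w t) (w (t - s)), he t ht, he (t - s) (left_mem_Icc.2 (by linarith))]
  have h4 : y t = diffq s w t - (diffq s w t - y t) := by abel
  rw [h4]
  linarith [norm_sub_le (diffq s w t) (diffq s w t - y t)]

variable [CompleteSpace H] [CompleteSpace V]

/-- Smoothing for the abstract evolution equation `f' + L f = g`. -/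
theorem smoothing_estimate (ι : V →L[ℝ] H) (b : V →L[ℝ] V →L[ℝ] ℝ) {B C : ℝ}
    (hC : 0 ≤ C) (hbB : ∀ u v, |b u v| ≤ B * ‖u‖ * ‖v‖)
    (hcoer : ∀ u, ‖u‖ ^ 2 ≤ b u u + C * ‖ι u‖ ^ 2) {T K M : ℝ} (hT : 0 < T) (hK : 0 ≤ K)
    (hM : 0 ≤ M) {f g : ℝ → H} {ft : ℝ → V} {D : Set V} (hD : Dense D)
    (hf : ContinuousOn f (Icc 0 T)) (hf0 : ‖f 0‖ ≤ M) (hft : IntegrableOn ft (Ioc 0 T))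
    (hlift : ∀ᵐ s ∂volume.restrict (Ioc 0 T), ι (ft s) = f s)
    (hgc : ContinuousOn g (Ioo 0 T)) (hg0 : ∀ s ∈ Ioo 0 T, ‖g s‖ ≤ K)
    (hg1 : ∀ h > 0, ∀ s ∈ Ioo h T, ‖diffq h g s‖ ≤ K)
    (hg2 : ∀ h > 0, ∀ s ∈ Ioo (2 * h) T, ‖diffq h (diffq h g) s‖ ≤ K)
    (hweak : ∀ φ ∈ D, ∀ t ∈ Icc 0 T, inner ℝ (f t) (ι φ) + ∫ s in (0 : ℝ)..t, b (ft s) φ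
      = inner ℝ (f 0) (ι φ) + ∫ s in (0 : ℝ)..t, inner ℝ (g s) (ι φ)) :
    ∃ F : ℝ → V, (∀ t ∈ Ioo 0 T, HasDerivAt f (ι (F t)) t) ∧
      (∀ t ∈ Ioo 0 T, t ^ 2 * ‖ι (F t)‖ ^ 2 ≤ energyConst T M K B C) ∧
      (∫⁻ t in Ioo 0 T, ENNReal.ofReal (t ^ 2 * ‖F t‖ ^ 2)
        ≤ ENNReal.ofReal (energyConst T M K B C)) ∧
      ∃ d, HasDerivWithinAt f d (Iic T) T ∧ T ^ 2 * ‖d‖ ^ 2 ≤ energyConst T M K B C := by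
  obtain ⟨U0, U1, U2, d, g0, g1, g2, hU⟩ :=
    exists_regularization ι b hT hD hf hft hlift hgc hg0 hg1 hg2 hweak
  set Λ := energyConst T M K B C with hΛ
  have huc : ∀ ε > 0, ∃ ρ > 0, ∀ s ∈ Icc 0 T, ∀ t ∈ Icc 0 T, |s - t| < ρ → ‖f s - f t‖ ≤ ε := by
    intro ε hε
    obtain ⟨ρ, hρ, h⟩ := Metric.uniformContinuousOn_iff.1
      (isCompact_Icc.uniformContinuousOn_of_continuous hf) ε hε
    exact ⟨ρ, hρ, fun s hs t ht hst => by
      rw [← dist_eq_norm]; exact (h s hs t ht (by rwa [Real.dist_eq])).le⟩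
  obtain ⟨η, hη, hηT, hηM⟩ : ∃ η > 0, η ≤ T / 2 ∧ ∀ s ∈ Icc 0 η, ‖f s‖ ≤ M + 1 := by
    obtain ⟨ρ, hρ, h⟩ := huc 1 one_pos
    refine ⟨min (ρ / 2) (T / 2), by positivity, min_le_right _ _, fun s hs => ?_⟩
    have h1 : s ≤ ρ / 2 := hs.2.trans (min_le_left _ _)
    have h2 : s ≤ T / 2 := hs.2.trans (min_le_right _ _)
    have := h s ⟨hs.1, by linarith⟩ 0 ⟨le_rfl, hT.le⟩ (by
      rw [sub_zero, abs_of_nonneg hs.1]; linarith)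
    have h3 : f s = f 0 + (f s - f 0) := by abel
    rw [h3]
    linarith [norm_add_le (f 0) (f s - f 0)]
  -- The estimate starts at time 4h, where U0 averages f over [h, 4h]. Since 4h ≤ η, that interval
  -- lies where ‖f‖ ≤ M + 1.
  set h : ℕ → ℝ := fun n => η / (4 * (n + 1)) with hh
  have hpos : ∀ n, 0 < h n := fun n => by positivity
  have h4 : ∀ n, 4 * h n ≤ η := by
    intro n
    have : h n ≤ η / 4 := by
      simp only [hh]
      gcongr
      have : (0 : ℝ) ≤ n := n.cast_nonneg
      linarith
    linarith
  have hlim : Tendsto h atTop (𝓝 0) := by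
    have : Tendsto (fun n : ℕ => (η / 4) * (1 / ((n : ℝ) + 1))) atTop (𝓝 ((η / 4) * 0)) :=
      tendsto_one_div_add_atTop_nhds_zero_nat.const_mul _
    rw [mul_zero] at this
    refine this.congr fun n => ?_
    simp only [hh]; field_simp
  have hsmall : ∀ r > 0, ∀ᶠ n in atTop, h n < r := fun r hr => hlim.eventually (gt_mem_nhds hr)
  have hen : ∀ n, ∀ t ∈ Ico (4 * h n) T,
      (t - 4 * h n) ^ 2 * ‖ι (U1 (h n) t)‖ ^ 2 + (t - 4 * h n) ^ 4 * ‖ι (U2 (h n) t)‖ ^ 2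
      + ∫ s in (4 * h n)..t, (s - 4 * h n) ^ 2 * ‖U1 (h n) s‖ ^ 2 ≤ Λ := by
    intro n t ht
    have hp := hpos n
    have h4n := h4 n
    have hU' := hU (h n) hp
    have ha : 4 * h n ∈ Ioo (3 * h n) T := ⟨by linarith, by linarith⟩
    refine energy_estimate ι b hC hbB hcoer (a₀ := 3 * h n) (by positivity) ha ht hM
      (fun t ht => (hU' t ht).1) (fun t ht => (hU' t ht).2.1) (fun t ht => (hU' t ht).2.2.1)
      (fun t ht => (hU' t ht).2.2.2.1) (fun t ht => (hU' t ht).2.2.2.2.1)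
      (fun t ht => (hU' t ht).2.2.2.2.2.1) (fun t ht => (hU' t ht).2.2.2.2.2.2.1)
      (fun t ht => (hU' t ht).2.2.2.2.2.2.2.1) (fun t ht => (hU' t ht).2.2.2.2.2.2.2.2.1) ?_
    have := (hU' _ ha).2.2.2.2.2.2.2.2.2 0 (M + 1) fun s hs => by
      rw [sub_zero]
      exact hηM s ⟨by linarith [hs.1], by linarith [hs.2]⟩
    simpa using this
  have hI0 : ∀ n, ∀ t ∈ Ico (4 * h n) T,
      0 ≤ ∫ s in (4 * h n)..t, (s - 4 * h n) ^ 2 * ‖U1 (h n) s‖ ^ 2 := fun n t ht =>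
    intervalIntegral.integral_nonneg ht.1 fun s _ => by positivity
  have hΛ0 : 0 ≤ Λ := by
    have := hen 0 (4 * h 0) ⟨le_rfl, by linarith [h4 0]⟩
    simpa using this
  -- a bound of the second derivatives
  have hL : ∀ δ > 0, ∃ L ≥ 0, ∀ᶠ n in atTop, ∀ t ∈ Ioo δ T, ‖ι (U2 (h n) t)‖ ≤ L := by
    intro δ hδ
    -- Once 4h < δ/2, the weight (t - 4h)⁴ of the second derivative is at least (δ/2)⁴ for t > δ.
    refine ⟨√(Λ / (δ / 2) ^ 4), Real.sqrt_nonneg _, ?_⟩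
    filter_upwards [hsmall (δ / 8) (by positivity)] with n hn t ht
    apply Real.le_sqrt_of_sq_le
    have ht' : t ∈ Ico (4 * h n) T := ⟨by linarith [ht.1], ht.2⟩
    rw [le_div_iff₀ (by positivity), mul_comm]
    have h5 : (δ / 2) ^ 4 ≤ (t - 4 * h n) ^ 4 := by
      have : δ / 2 ≤ t - 4 * h n := by linarith [ht.1]
      gcongr
    have h6 := mul_le_mul_of_nonneg_right h5 (sq_nonneg ‖ι (U2 (h n) t)‖)
    have h7 : 0 ≤ (t - 4 * h n) ^ 2 * ‖ι (U1 (h n) t)‖ ^ 2 := by positivity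
    linarith [hen n t ht', hI0 n t ht']
  -- uniform convergence of the regularizations
  have hU0 : ∀ δ > 0, ∀ ε > 0, ∀ᶠ n in atTop, ∀ t ∈ Ioo δ T, ‖ι (U0 (h n) t) - f t‖ ≤ ε := by
    intro δ hδ ε hε
    obtain ⟨ρ, hρ, huc⟩ := huc ε hε
    filter_upwards [hsmall (δ / 3) (by positivity), hsmall (ρ / 3) (by positivity)] with n h1 h2 t ht
    refine (hU (h n) (hpos n) t ⟨by linarith [ht.1], ht.2⟩).2.2.2.2.2.2.2.2.2 _ _ fun s hs => ?_
    refine huc s ⟨by linarith [hs.1, ht.1], by linarith [hs.2, ht.2]⟩ t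
      ⟨by linarith [ht.1], ht.2.le⟩ ?_
    rw [abs_lt]; constructor <;> linarith [hs.1, hs.2]
  have hcH : ∀ δ > 0, ∀ ε > 0, ∃ N, ∀ n ≥ N, ∀ m ≥ N, ∀ t ∈ Ioo δ T,
      ‖ι (U1 (h n) t) - ι (U1 (h m) t)‖ ≤ ε := by
    intro δ hδ ε hε
    obtain ⟨L, hL0, hL⟩ := hL (δ / 2) (by positivity)
    -- Interpolation: a derivative that is 2L-Lipschitz, of a function of size e, is at most 2Ls +
    -- 2e/s. The step s makes the first term at most ε/2, and e = εs/4 makes the second one equal to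
    -- ε/2.
    set s : ℝ := min (δ / 2) (ε / (4 * (L + 1))) with hs
    have hs0 : 0 < s := by positivity
    have hsε : 2 * L * s ≤ ε / 2 := by
      have : s ≤ ε / (4 * (L + 1)) := min_le_right _ _
      rw [le_div_iff₀ (by positivity)] at this
      nlinarith
    obtain ⟨N, hN⟩ := eventually_atTop.1 ((hL.and (hU0 (δ / 2) (by positivity) (ε * s / 8)
      (by positivity))).and (hsmall (δ / 6) (by positivity)))
    refine ⟨N, fun n hn m hm t ht => ?_⟩
    obtain ⟨⟨n1, n2⟩, n3⟩ := hN n hn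
    obtain ⟨⟨m1, m2⟩, m3⟩ := hN m hm
    have hr : ∀ r ∈ Icc (t - s) t, r ∈ Ioo (δ / 2) T := fun r hr =>
      ⟨by linarith [hr.1, ht.1, min_le_left (δ / 2) (ε / (4 * (L + 1)))], hr.2.trans_lt ht.2⟩
    have hUn := fun r hr' => hU (h n) (hpos n) r ⟨by linarith [(hr r hr').1], (hr r hr').2⟩
    have hUm := fun r hr' => hU (h m) (hpos m) r ⟨by linarith [(hr r hr').1], (hr r hr').2⟩
    have := norm_deriv_le_of_lipschitz (w := fun r => ι (U0 (h n) r) - ι (U0 (h m) r))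
      (y := fun r => ι (U1 (h n) r) - ι (U1 (h m) r))
      (z := fun r => ι (U2 (h n) r) - ι (U2 (h m) r)) (t := t) (L := 2 * L) (e := ε * s / 4) hs0
      (fun r hr' => (ι.hasFDerivAt.comp_hasDerivAt r (hUn r hr').1).fun_sub
        (ι.hasFDerivAt.comp_hasDerivAt r (hUm r hr').1))
      (fun r hr' => (ι.hasFDerivAt.comp_hasDerivAt r (hUn r hr').2.1).fun_sub
        (ι.hasFDerivAt.comp_hasDerivAt r (hUm r hr').2.1))
      (fun r hr' => by
        linarith [norm_sub_le (ι (U2 (h n) r)) (ι (U2 (h m) r)), n1 r (hr r hr'), m1 r (hr r hr')])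
      (fun r hr' => by
        have h1 : ι (U0 (h n) r) - ι (U0 (h m) r)
          = (ι (U0 (h n) r) - f r) - (ι (U0 (h m) r) - f r) := by abel
        rw [h1]
        linarith [norm_sub_le (ι (U0 (h n) r) - f r) (ι (U0 (h m) r) - f r), n2 r (hr r hr'),
          m2 r (hr r hr')])
    refine this.trans ?_
    have : 2 * (ε * s / 4) / s = ε / 2 := by field_simp; norm_num
    linarith
  have hcV : ∀ δ > 0, ∀ ε > 0, ∃ N, ∀ n ≥ N, ∀ m ≥ N, ∀ t ∈ Ioo δ T,
      ‖U1 (h n) t - U1 (h m) t‖ < ε := by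
    intro δ hδ ε hε
    obtain ⟨L, hL0, hL⟩ := hL δ hδ
    set e : ℝ := min 1 (ε ^ 2 / (2 * (2 * K + 2 * L + C + 1))) with he
    have he0 : 0 < e := by positivity
    have heε : (2 * K + 2 * L + C) * e < ε ^ 2 := by
      have : e ≤ ε ^ 2 / (2 * (2 * K + 2 * L + C + 1)) := min_le_right _ _
      rw [le_div_iff₀ (by positivity)] at this
      nlinarith [sq_pos_of_pos hε, mul_nonneg (show 0 ≤ 2 * K + 2 * L + C by positivity) he0.le]
    obtain ⟨N₁, hN₁⟩ := hcH δ hδ e he0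
    obtain ⟨N₂, hN₂⟩ := eventually_atTop.1 (hL.and (hsmall (δ / 3) (by positivity)))
    refine ⟨max N₁ N₂, fun n hn m hm t ht => ?_⟩
    obtain ⟨n1, n3⟩ := hN₂ n ((le_max_right _ _).trans hn)
    obtain ⟨m1, m3⟩ := hN₂ m ((le_max_right _ _).trans hm)
    have hc := hN₁ n ((le_max_left _ _).trans hn) m ((le_max_left _ _).trans hm) t ht
    have hUn := hU (h n) (hpos n) t ⟨by linarith [ht.1], ht.2⟩
    have hUm := hU (h m) (hpos m) t ⟨by linarith [ht.1], ht.2⟩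
    set u := U1 (h n) t - U1 (h m) t with hu
    have hιu : ‖ι u‖ ≤ e := by rw [hu, map_sub]; exact hc
    -- Convergence in V comes from the equation itself: for the difference u of two regularizations,
    -- b(u, u) is a bounded vector of H paired with ι u. Since ι u is small by the convergence in H,
    -- coercivity makes ‖u‖ small.
    have hb : b u u = inner ℝ ((g1 (h n) t - g1 (h m) t)
        - (ι (U2 (h n) t) - ι (U2 (h m) t))) (ι u) := by
      have e1 := eq_sub_iff_add_eq'.2 (hUn.2.2.2.2.1 u)
      have e2 := eq_sub_iff_add_eq'.2 (hUm.2.2.2.2.1 u)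
      have : b u u = b (U1 (h n) t) u - b (U1 (h m) t) u := by
        rw [← _root_.sub_apply, ← map_sub]
      rw [this, e1, e2]
      simp only [inner_sub_left]
      ring
    have hb' : b u u ≤ (2 * K + 2 * L) * e := by
      rw [hb]
      refine (real_inner_le_norm _ _).trans ?_
      gcongr
      have a1 := norm_sub_le (g1 (h n) t - g1 (h m) t) (ι (U2 (h n) t) - ι (U2 (h m) t))
      have a2 := norm_sub_le (g1 (h n) t) (g1 (h m) t)
      have a3 := norm_sub_le (ι (U2 (h n) t)) (ι (U2 (h m) t))
      linarith [hUn.2.2.2.2.2.2.2.1, hUm.2.2.2.2.2.2.2.1, n1 t ht, m1 t ht]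
    have hsq : ‖u‖ ^ 2 < ε ^ 2 := by
      have e2 : ‖ι u‖ ^ 2 ≤ e := by
        have e1 : e ≤ 1 := min_le_left _ _
        calc ‖ι u‖ ^ 2 ≤ e ^ 2 := by gcongr
          _ ≤ e := by nlinarith
      have := mul_le_mul_of_nonneg_left e2 hC
      linarith [hcoer u]
    exact lt_of_pow_lt_pow_left₀ 2 hε.le hsq
  have hF : ∀ t ∈ Ioo 0 T, ∃ v, Tendsto (fun n => U1 (h n) t) atTop (𝓝 v) := by
    intro t ht
    apply cauchySeq_tendsto_of_complete
    rw [Metric.cauchySeq_iff]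
    intro ε hε
    obtain ⟨N, hN⟩ := hcV (t / 2) (by linarith [ht.1]) ε hε
    exact ⟨N, fun m hm n hn => by
      rw [dist_eq_norm]; exact hN m hm n hn t ⟨by linarith [ht.1], ht.2⟩⟩
  choose! F hF using hF
  have hιF : ∀ t ∈ Ioo 0 T, Tendsto (fun n => ι (U1 (h n) t)) atTop (𝓝 (ι (F t))) := fun t ht =>
    (ι.continuous.tendsto _).comp (hF t ht)
  have hunif : ∀ δ > 0, TendstoUniformlyOn (fun n t => ι (U1 (h n) t)) (fun t => ι (F t)) atTop
      (Ioo δ T) := by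
    intro δ hδ
    apply UniformCauchySeqOn.tendstoUniformlyOn_of_tendsto
    · rw [Metric.uniformCauchySeqOn_iff]
      intro ε hε
      obtain ⟨N, hN⟩ := hcH δ hδ (ε / 2) (by positivity)
      exact ⟨N, fun m hm n hn t ht => by
        rw [dist_eq_norm]; linarith [hN m hm n hn t ht]⟩
    · exact fun t ht => hιF t ⟨hδ.trans ht.1, ht.2⟩
  have hderiv : ∀ t ∈ Ioo 0 T, HasDerivAt f (ι (F t)) t := by
    intro t ht
    have hδ : 0 < t / 2 := by linarith [ht.1]
    refine hasDerivAt_of_tendstoUniformlyOn (l := atTop) isOpen_Ioo (hunif (t / 2) hδ)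
      (f := fun n t => ι (U0 (h n) t)) ?_ ?_ ⟨by linarith, ht.2⟩
    · filter_upwards [hsmall (t / 6) (by linarith)] with n hn s hs
      exact ι.hasFDerivAt.comp_hasDerivAt s
        (hU (h n) (hpos n) s ⟨by linarith [hs.1], hs.2⟩).1
    · intro s hs
      rw [tendsto_iff_norm_sub_tendsto_zero, Metric.tendsto_atTop]
      intro ε hε
      obtain ⟨N, hN⟩ := eventually_atTop.1 (hU0 (t / 2) hδ (ε / 2) (by positivity))
      exact ⟨N, fun n hn => by
        rw [Real.dist_0_eq_abs, abs_of_nonneg (norm_nonneg _)]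
        linarith [hN n hn s hs]⟩
  have hbound : ∀ t ∈ Ioo 0 T, t ^ 2 * ‖ι (F t)‖ ^ 2 ≤ Λ := by
    intro t ht
    have h1 : Tendsto (fun n => (t - 4 * h n) ^ 2 * ‖ι (U1 (h n) t)‖ ^ 2) atTop
        (𝓝 ((t - 4 * 0) ^ 2 * ‖ι (F t)‖ ^ 2)) :=
      ((tendsto_const_nhds.sub (hlim.const_mul 4)).pow 2).mul ((hιF t ht).norm.pow 2)
    rw [mul_zero, sub_zero] at h1
    refine le_of_tendsto h1 ?_
    filter_upwards [hsmall (t / 4) (by linarith [ht.1])] with n hn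
    have ht' : t ∈ Ico (4 * h n) T := ⟨by linarith [ht.1], ht.2⟩
    have h7 : 0 ≤ (t - 4 * h n) ^ 4 * ‖ι (U2 (h n) t)‖ ^ 2 := by positivity
    linarith [hen n t ht', hI0 n t ht']
  refine ⟨F, hderiv, hbound, ?_, ?_⟩
  -- Fatou's lemma for the dissipation. The windows stay away from the end point T, where the
  -- regularized curves are not controlled, and exhaust ]0, T[.
  · set S : ℕ → Set ℝ := fun n => Ioc (4 * h n) (T - h n) with hS
    set Fn : ℕ → ℝ → ℝ≥0∞ := fun n => (S n).indicator
      fun s => ENNReal.ofReal ((s - 4 * h n) ^ 2 * ‖U1 (h n) s‖ ^ 2) with hFn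
    have hcont : ∀ n, ContinuousOn (fun s => (s - 4 * h n) ^ 2 * ‖U1 (h n) s‖ ^ 2)
        (Icc (4 * h n) (T - h n)) := by
      intro n s hs
      have hp := hpos n
      have := (hU (h n) hp s ⟨by linarith [hs.1], by linarith [hs.2]⟩).2.1.continuousAt
      exact (((continuousAt_id.sub continuousAt_const).pow 2).mul
        (this.norm.pow 2)).continuousWithinAt
    have hFm : ∀ n, AEMeasurable (Fn n) (volume.restrict (Ioo 0 T)) := by
      intro n
      refine AEMeasurable.restrict ((aemeasurable_indicator_iff measurableSet_Ioc).2 ?_)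
      exact (((hcont n).mono Ioc_subset_Icc_self).aemeasurable measurableSet_Ioc).ennreal_ofReal
    have hFint : ∀ n, ∫⁻ t in Ioo 0 T, Fn n t ≤ ENNReal.ofReal Λ := by
      intro n
      have hp := hpos n
      have h4n := h4 n
      have hle : 4 * h n ≤ T - h n := by linarith
      calc ∫⁻ t in Ioo 0 T, Fn n t ≤ ∫⁻ t, Fn n t := setLIntegral_le_lintegral _ _
        _ = ∫⁻ s in S n, ENNReal.ofReal ((s - 4 * h n) ^ 2 * ‖U1 (h n) s‖ ^ 2) :=
          lintegral_indicator measurableSet_Ioc _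
        _ = ENNReal.ofReal (∫ s in S n, (s - 4 * h n) ^ 2 * ‖U1 (h n) s‖ ^ 2) := by
          rw [ofReal_integral_eq_lintegral_ofReal]
          · exact ((hcont n).integrableOn_Icc).mono_set Ioc_subset_Icc_self
          · exact Eventually.of_forall fun s => by positivity
        _ ≤ ENNReal.ofReal Λ := by
          apply ENNReal.ofReal_le_ofReal
          have ht' : T - h n ∈ Ico (4 * h n) T := ⟨hle, by linarith⟩
          have := hen n _ ht'
          rw [intervalIntegral.integral_of_le hle] at this
          have h7 : 0 ≤ (T - h n - 4 * h n) ^ 4 * ‖ι (U2 (h n) (T - h n))‖ ^ 2 := by positivity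
          have h8 : 0 ≤ (T - h n - 4 * h n) ^ 2 * ‖ι (U1 (h n) (T - h n))‖ ^ 2 := by positivity
          linarith
    have hlimF : ∀ t ∈ Ioo 0 T, Tendsto (fun n => Fn n t) atTop
        (𝓝 (ENNReal.ofReal (t ^ 2 * ‖F t‖ ^ 2))) := by
      intro t ht
      have h1 : Tendsto (fun n => (t - 4 * h n) ^ 2 * ‖U1 (h n) t‖ ^ 2) atTop
          (𝓝 ((t - 4 * 0) ^ 2 * ‖F t‖ ^ 2)) :=
        ((tendsto_const_nhds.sub (hlim.const_mul 4)).pow 2).mul ((hF t ht).norm.pow 2)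
      rw [mul_zero, sub_zero] at h1
      refine ((ENNReal.continuous_ofReal.tendsto _).comp h1).congr' ?_
      filter_upwards [hsmall (t / 4) (by linarith [ht.1]), hsmall (T - t) (by linarith [ht.2])]
        with n h1 h2
      rw [hFn]
      simp only
      rw [indicator_of_mem (show t ∈ S n from ⟨by linarith, by linarith⟩)]
      rfl
    calc ∫⁻ t in Ioo 0 T, ENNReal.ofReal (t ^ 2 * ‖F t‖ ^ 2)
        = ∫⁻ t in Ioo 0 T, liminf (fun n => Fn n t) atTop := by
          apply setLIntegral_congr_fun measurableSet_Ioo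
          intro t ht
          exact (hlimF t ht).liminf_eq.symm
      _ ≤ liminf (fun n => ∫⁻ t in Ioo 0 T, Fn n t) atTop := lintegral_liminf_le' hFm
      _ ≤ ENNReal.ofReal Λ := by
        refine (liminf_le_liminf (Eventually.of_forall hFint)).trans ?_
        simp
  -- At the end point: f' inherits the Lipschitz bound L on ]T/2, T[, hence has a limit at T, and
  -- this limit is the left derivative of f. The bound t²‖f'(t)‖² ≤ Λ passes to the limit.
  · have hδ : 0 < T / 2 := by positivity
    obtain ⟨L, hL0, hL⟩ := hL (T / 2) hδ
    have hlip : ∀ s ∈ Ioo (T / 2) T, ∀ t ∈ Ioo (T / 2) T,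
        ‖ι (F t) - ι (F s)‖ ≤ L * ‖t - s‖ := by
      intro s hs t ht
      have h1 := ((hιF t ⟨hδ.trans ht.1, ht.2⟩).sub (hιF s ⟨hδ.trans hs.1, hs.2⟩)).norm
      refine le_of_tendsto h1 ?_
      filter_upwards [hL, hsmall (T / 6) (by positivity)] with n hn hn'
      exact (convex_Ioo (T / 2) T).norm_image_sub_le_of_norm_hasDerivWithin_le
        (fun r hr => (ι.hasFDerivAt.comp_hasDerivAt r (hU (h n) (hpos n) r
          ⟨by linarith [hr.1], hr.2⟩).2.1).hasDerivWithinAt) hn hs ht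
    have hne : (𝓝[Ioo (T / 2) T] T).NeBot := by
      rw [← mem_closure_iff_nhdsWithin_neBot, closure_Ioo (by linarith)]
      exact ⟨by linarith, le_rfl⟩
    have huc : UniformContinuousOn (fun t => ι (F t)) (Ioo (T / 2) T) := by
      have : LipschitzOnWith ⟨L, hL0⟩ (fun t => ι (F t)) (Ioo (T / 2) T) :=
        LipschitzOnWith.of_dist_le_mul fun s hs t ht => by
          rw [dist_eq_norm, dist_eq_norm]; exact hlip t ht s hs
      exact this.uniformContinuousOn
    have hcauchy : Cauchy (map (fun t => ι (F t)) (𝓝[Ioo (T / 2) T] T)) :=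
      (cauchy_nhds.mono nhdsWithin_le_nhds).map_of_le huc (le_principal_iff.2 self_mem_nhdsWithin)
    obtain ⟨e, he⟩ := CompleteSpace.complete hcauchy
    have he' : Tendsto (fun t => ι (F t)) (𝓝[Ioo (T / 2) T] T) (𝓝 e) := he
    have hIio : 𝓝[Ioo (T / 2) T] T = 𝓝[<] T := by
      apply nhdsWithin_Ioo_eq_nhdsLT; linarith
    refine ⟨e, ?_, ?_⟩
    · apply hasDerivWithinAt_Iic_of_tendsto_deriv (s := Ioo (T / 2) T)
      · intro t ht
        exact (hderiv t ⟨hδ.trans ht.1, ht.2⟩).differentiableAt.differentiableWithinAt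
      · exact (hf T ⟨hT.le, le_rfl⟩).mono fun t ht => ⟨(hδ.trans ht.1).le, ht.2.le⟩
      · exact Ioo_mem_nhdsLT (by linarith)
      · rw [← hIio]
        refine he'.congr' ?_
        filter_upwards [self_mem_nhdsWithin] with t ht
        exact (hderiv t ⟨hδ.trans ht.1, ht.2⟩).deriv.symm
    · have h1 : Tendsto (fun t : ℝ => t ^ 2 * ‖ι (F t)‖ ^ 2) (𝓝[Ioo (T / 2) T] T)
          (𝓝 (T ^ 2 * ‖e‖ ^ 2)) :=
        ((tendsto_id.mono_right nhdsWithin_le_nhds).pow 2).mul (he'.norm.pow 2)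
      refine le_of_tendsto h1 ?_
      filter_upwards [self_mem_nhdsWithin] with t ht
      exact hbound t ⟨hδ.trans ht.1, ht.2⟩

end Smoothing
end Landau

/-! ### Gaussian weights and singular convolution kernels -/

namespace Landau

/-- A Gaussian weight, wider than `√μ`. -/
noncomputable def gau (v : V3) : ℝ := Real.exp (-(‖v‖ ^ 2 / 8))

lemma gau_pos (v : V3) : 0 < gau v := Real.exp_pos _

lemma gau_le_one (v : V3) : gau v ≤ 1 := by
  rw [gau, Real.exp_le_one_iff]; have := sq_nonneg ‖v‖; linarith

lemma continuous_gau : Continuous gau := by unfold gau; fun_prop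

lemma integrable_gau : Integrable gau := by
  have := GaussianFourier.integrable_cexp_neg_mul_sq_norm_add (b := (1 / 8 : ℂ)) (by norm_num) 0
    (0 : V3)
  refine this.norm.congr (Filter.Eventually.of_forall fun v => ?_)
  beta_reduce
  rw [Complex.norm_exp, gau, zero_mul, add_zero, ← Complex.ofReal_pow,
    show (-(1 / 8 : ℂ)) * ((‖v‖ ^ 2 : ℝ) : ℂ) = ((-(‖v‖ ^ 2 / 8) : ℝ) : ℂ) by push_cast; ring,
    Complex.ofReal_re]

lemma mu_pos (v : V3) : 0 < mu v := by unfold mu; positivity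

lemma sqrtMu_pos (v : V3) : 0 < sqrtMu v := Real.sqrt_pos.2 (mu_pos v)

lemma sqrtMu_mul_self (v : V3) : sqrtMu v * sqrtMu v = mu v := Real.mul_self_sqrt (mu_pos v).le

lemma sqrtMu_eq (v : V3) : sqrtMu v = sqrtMu 0 * Real.exp (-(‖v‖ ^ 2 / 4)) := by
  have h : mu v = mu 0 * Real.exp (-(‖v‖ ^ 2 / 2)) := by simp [mu]
  rw [sqrtMu, h, Real.sqrt_mul (mu_pos 0).le, sqrtMu]
  congr 1
  rw [Real.sqrt_eq_iff_mul_self_eq (Real.exp_pos _).le (Real.exp_pos _).le, ← Real.exp_add]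
  congr 1; ring

lemma mu_zero_le_one : mu 0 ≤ 1 := by
  simp only [mu, norm_zero]
  have : (2 * Real.pi) ^ (-(3 / 2) : ℝ) ≤ 1 := by
    apply Real.rpow_le_one_of_one_le_of_nonpos
    · linarith [Real.pi_gt_three]
    · norm_num
  simpa using this

lemma sqrtMu_zero_le_one : sqrtMu 0 ≤ 1 := by
  exact Real.sqrt_le_one.2 mu_zero_le_one

lemma sqrtMu_le_one (v : V3) : sqrtMu v ≤ 1 := by
  rw [sqrtMu_eq]
  have : Real.exp (-(‖v‖ ^ 2 / 4)) ≤ 1 := by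
    rw [Real.exp_le_one_iff]; have := sq_nonneg ‖v‖; linarith
  exact mul_le_one₀ sqrtMu_zero_le_one (Real.exp_pos _).le this

lemma contDiff_mu : ContDiff ℝ ∞ mu := by
  unfold mu
  exact contDiff_const.mul (((contDiff_norm_sq ℝ).div_const 2).neg.exp)

lemma contDiff_sqrtMu : ContDiff ℝ ∞ sqrtMu := by
  rw [show sqrtMu = fun v => sqrtMu 0 * Real.exp (-(‖v‖ ^ 2 / 4)) from funext sqrtMu_eq]
  exact contDiff_const.mul (((contDiff_norm_sq ℝ).div_const 4).neg.exp)

lemma inner_basisVec (v : V3) (j : Fin 3) : inner ℝ v (basisVec j) = v j := by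
  simp [basisVec, EuclideanSpace.inner_single_right]

lemma hasFDerivAt_gaussian (c b : ℝ) (v : V3) :
    HasFDerivAt (fun v : V3 => c * Real.exp (-(‖v‖ ^ 2 / b)))
      ((-(2 / b) * (c * Real.exp (-(‖v‖ ^ 2 / b)))) • innerSL ℝ v) v := by
  have h1 : HasFDerivAt (fun v : V3 => ‖v‖ ^ 2) (2 • innerSL ℝ v) v :=
    (hasStrictFDerivAt_norm_sq v).hasFDerivAt
  have h2 := (((h1.mul_const b⁻¹).fun_neg).exp).const_mul c
  simp only [← div_eq_mul_inv] at h2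
  refine h2.congr_fderiv ?_
  ext w
  simp
  ring

lemma fderiv_mu (v : V3) (j : Fin 3) : fderiv ℝ mu v (basisVec j) = -(v j * mu v) := by
  have h := (hasFDerivAt_gaussian ((2 * Real.pi) ^ (-(3 / 2) : ℝ)) 2 v).fderiv
  have : mu = fun v : V3 => (2 * Real.pi) ^ (-(3 / 2) : ℝ) * Real.exp (-(‖v‖ ^ 2 / 2)) := rfl
  rw [this, h]
  simp [inner_basisVec]
  ring

lemma fderiv_sqrtMu (v : V3) (j : Fin 3) :
    fderiv ℝ sqrtMu v (basisVec j) = -(v j / 2 * sqrtMu v) := by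
  have h := (hasFDerivAt_gaussian (sqrtMu 0) 4 v).fderiv
  rw [← show sqrtMu = fun v => sqrtMu 0 * Real.exp (-(‖v‖ ^ 2 / 4)) from funext sqrtMu_eq] at h
  rw [h, ← sqrtMu_eq]
  simp [inner_basisVec]
  ring

/-- √μ decays like exp(-|v|²/4) while `gau` is exp(-|v|²/8). The spare factor exp(-|v|²/8) absorbs
the cube of 1 + |v|², because 1 + x ≤ 24 exp(x/24). -/
lemma sqrtMu_mul_pow_le (v : V3) : sqrtMu v * (1 + ‖v‖ ^ 2) ^ 3 ≤ 24 ^ 3 * gau v := by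
  have h1 : (1 + ‖v‖ ^ 2) ^ 3 ≤ 24 ^ 3 * Real.exp (‖v‖ ^ 2 / 8) := by
    have h2 : 1 + ‖v‖ ^ 2 ≤ 24 * Real.exp (‖v‖ ^ 2 / 24) := by
      have := Real.add_one_le_exp (‖v‖ ^ 2 / 24)
      linarith
    calc (1 + ‖v‖ ^ 2) ^ 3 ≤ (24 * Real.exp (‖v‖ ^ 2 / 24)) ^ 3 := by gcongr
      _ = _ := by rw [mul_pow, ← Real.exp_nat_mul]; congr 2; push_cast; ring
  have h3 : sqrtMu v ≤ Real.exp (-(‖v‖ ^ 2 / 4)) := by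
    rw [sqrtMu_eq]; exact mul_le_of_le_one_left (Real.exp_pos _).le sqrtMu_zero_le_one
  calc sqrtMu v * (1 + ‖v‖ ^ 2) ^ 3
      ≤ Real.exp (-(‖v‖ ^ 2 / 4)) * (24 ^ 3 * Real.exp (‖v‖ ^ 2 / 8)) := by gcongr
    _ = 24 ^ 3 * gau v := by
      rw [mul_left_comm, ← Real.exp_add, gau]; congr 2; ring

lemma mu_le_sqrtMu (v : V3) : mu v ≤ sqrtMu v := by
  rw [← sqrtMu_mul_self]; exact mul_le_of_le_one_left (sqrtMu_pos v).le (sqrtMu_le_one v)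

/-- Polar coordinates: the radial integrand is y^(s+2) on ]0, 1[, integrable exactly when s > -3.
This is where the lower bound on γ is used. -/
lemma integrable_norm_rpow_ball {s : ℝ} (hs : -3 < s) :
    Integrable (fun z : V3 => (Metric.ball (0 : V3) 1).indicator (fun z => ‖z‖ ^ s) z) := by
  have h := (integrable_fun_norm_addHaar (volume : Measure V3)
    (f := (Iio (1 : ℝ)).indicator fun y => y ^ s)).2 ?_
  · refine h.congr (Filter.Eventually.of_forall fun z => ?_)
    simp [indicator]
  · have h2 : IntegrableOn (fun y : ℝ => y ^ (s + 2)) (Ioo 0 1) :=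
      (intervalIntegral.integrableOn_Ioo_rpow_iff one_pos).2 (by linarith)
    have h3 : IntegrableOn ((Ioo (0 : ℝ) 1).indicator fun y : ℝ => y ^ (s + 2)) (Ioi 0) :=
      (h2.integrable_indicator measurableSet_Ioo).integrableOn
    refine h3.congr_fun (fun y hy => ?_) measurableSet_Ioi
    have hy' : (0 : ℝ) < y := hy
    by_cases h1 : y < 1
    · rw [indicator_of_mem (show y ∈ Ioo (0 : ℝ) 1 from ⟨hy', h1⟩)]
      simp only [indicator, mem_Iio, h1, if_true, finrank_euclideanSpace, Fintype.card_fin,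
        smul_eq_mul]
      rw [Real.rpow_add hy', mul_comm]
      norm_num
    · rw [indicator_of_notMem (fun h : y ∈ Ioo (0 : ℝ) 1 => h1 h.2)]
      simp [indicator, h1]

lemma norm_sq_mul_rpow_le {γ : ℝ} (hγ : γ < 0) (z : V3) :
    ‖z‖ ^ 2 * ‖z‖ ^ γ ≤ ‖z‖ ^ γ + ‖z‖ ^ 2 := by
  have h0 : 0 ≤ ‖z‖ ^ γ := Real.rpow_nonneg (norm_nonneg z) γ
  rcases le_total ‖z‖ 1 with h | h
  · have : ‖z‖ ^ 2 ≤ 1 := pow_le_one₀ (norm_nonneg z) h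
    nlinarith [sq_nonneg ‖z‖]
  · have : ‖z‖ ^ γ ≤ 1 := Real.rpow_le_one_of_one_le_of_nonpos h hγ.le
    nlinarith [sq_nonneg ‖z‖]

/-- The majorant of all kernels. -/
noncomputable def kmaj (γ : ℝ) (z : V3) : ℝ := ‖z‖ ^ γ + ‖z‖ ^ 2 + 1

lemma kmaj_nonneg (γ : ℝ) (z : V3) : 0 ≤ kmaj γ z := by unfold kmaj; positivity

lemma measurable_kmaj (γ : ℝ) : Measurable (kmaj γ) := by unfold kmaj; fun_prop

lemma kmaj_neg (γ : ℝ) (z : V3) : kmaj γ (-z) = kmaj γ z := by simp [kmaj]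

/-- Splits the kernel into an integrable singular part, supported in the unit ball, and a part that
grows quadratically in each variable separately. -/
lemma kmaj_le {γ : ℝ} (hγ : γ < 0) (v w : V3) :
    kmaj γ (v - w) ≤ (Metric.ball (0 : V3) 1).indicator (fun z => ‖z‖ ^ γ) (v - w)
      + 4 * (1 + ‖v‖ ^ 2) * (1 + ‖w‖ ^ 2) := by
  have h1 : ‖v - w‖ ^ γ ≤ (Metric.ball (0 : V3) 1).indicator (fun z => ‖z‖ ^ γ) (v - w) + 1 := by
    by_cases h : v - w ∈ Metric.ball (0 : V3) 1
    · rw [indicator_of_mem h]; linarith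
    · rw [indicator_of_notMem h, zero_add]
      apply Real.rpow_le_one_of_one_le_of_nonpos _ hγ.le
      simpa using h
  have h2 : ‖v - w‖ ^ 2 ≤ 2 * ‖v‖ ^ 2 + 2 * ‖w‖ ^ 2 := by
    have := norm_sub_le v w
    calc ‖v - w‖ ^ 2 ≤ (‖v‖ + ‖w‖) ^ 2 := by gcongr
      _ ≤ _ := by nlinarith [sq_nonneg (‖v‖ - ‖w‖)]
  have h3 : 0 ≤ ‖v‖ ^ 2 * ‖w‖ ^ 2 := by positivity
  unfold kmaj
  nlinarith [sq_nonneg ‖v‖, sq_nonneg ‖w‖]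

lemma integrable_pow_mul_gau : Integrable fun v : V3 => (1 + ‖v‖ ^ 2) * gau v := by
  -- The dilated Gaussian is exp(-|v|²/32). It dominates because 1/24 - 1/8 = -1/12 is below -1/32.
  have h0 : Integrable fun v : V3 => 24 * gau ((1 / 2 : ℝ) • v) := by
    exact (integrable_gau.comp_smul (by norm_num : (1 / 2 : ℝ) ≠ 0)).const_mul 24
  refine h0.mono' (by have := continuous_gau; fun_prop) (Filter.Eventually.of_forall fun v => ?_)
  rw [Real.norm_of_nonneg (mul_nonneg (by positivity) (gau_pos v).le)]
  simp only [gau, norm_smul, mul_pow]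
  have h2 : 1 + ‖v‖ ^ 2 ≤ 24 * Real.exp (‖v‖ ^ 2 / 24) := by
    have := Real.add_one_le_exp (‖v‖ ^ 2 / 24)
    linarith
  calc _ ≤ (24 * Real.exp (‖v‖ ^ 2 / 24)) * Real.exp (-(‖v‖ ^ 2 / 8)) := by gcongr
    _ ≤ _ := by
      rw [mul_assoc, ← Real.exp_add]
      gcongr
      norm_num
      nlinarith [sq_nonneg ‖v‖]

/-- The singular part contributes a constant independent of w, by translation invariance; the rest
is a Gaussian moment times 1 + |w|². All integrability statements with the Landau kernel reduce to
this bound. -/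
theorem exists_kmaj_bound {γ : ℝ} (hγ₁ : -3 < γ) (hγ₂ : γ < 0) :
    ∃ C, 0 ≤ C ∧ ∀ w : V3, Integrable (fun v => kmaj γ (v - w) * gau v) ∧
      ∫ v, kmaj γ (v - w) * gau v ≤ C * (1 + ‖w‖ ^ 2) := by
  set σ : V3 → ℝ := (Metric.ball (0 : V3) 1).indicator (fun z => ‖z‖ ^ γ) with hσ
  have hσi : Integrable σ := integrable_norm_rpow_ball hγ₁
  have hσ0 : ∀ z, 0 ≤ σ z := fun z => indicator_nonneg (fun z _ => by positivity) z
  have hp := integrable_pow_mul_gau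
  refine ⟨(∫ z, σ z) + 4 * ∫ v : V3, (1 + ‖v‖ ^ 2) * gau v, ?_, fun w => ?_⟩
  · have h1 : 0 ≤ ∫ z, σ z := integral_nonneg hσ0
    have h2 : 0 ≤ ∫ v : V3, (1 + ‖v‖ ^ 2) * gau v :=
      integral_nonneg fun v => mul_nonneg (by positivity) (gau_pos v).le
    positivity
  have hm : Integrable fun v => σ (v - w) + 4 * (1 + ‖w‖ ^ 2) * ((1 + ‖v‖ ^ 2) * gau v) :=
    (hσi.comp_sub_right w).add (hp.const_mul _)
  have hle : ∀ v, kmaj γ (v - w) * gau v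
      ≤ σ (v - w) + 4 * (1 + ‖w‖ ^ 2) * ((1 + ‖v‖ ^ 2) * gau v) := by
    intro v
    have h1 := mul_le_mul_of_nonneg_right (kmaj_le hγ₂ v w) (gau_pos v).le
    have h2 : σ (v - w) * gau v ≤ σ (v - w) := mul_le_of_le_one_right (hσ0 _) (gau_le_one v)
    rw [add_mul] at h1
    linarith
  have hi : Integrable (fun v => kmaj γ (v - w) * gau v) := by
    refine hm.mono' ?_ (Filter.Eventually.of_forall fun v => ?_)
    · exact (((measurable_kmaj γ).comp (measurable_id.sub_const w)).mul
        continuous_gau.measurable).aestronglyMeasurable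
    · rw [Real.norm_of_nonneg (mul_nonneg (kmaj_nonneg _ _) (gau_pos v).le)]
      exact hle v
  refine ⟨hi, (integral_mono hi hm hle).trans ?_⟩
  rw [integral_add (hσi.comp_sub_right w) (hp.const_mul _), integral_const_mul,
    integral_sub_right_eq_self σ w]
  have h1 : 0 ≤ ∫ z, σ z := integral_nonneg hσ0
  nlinarith [sq_nonneg ‖w‖, mul_nonneg h1 (sq_nonneg ‖w‖)]

end Landau

/-! ### The Landau matrix and its Gaussian average -/

namespace Landau

lemma kmaj_sub_comm (γ : ℝ) (v w : V3) : kmaj γ (v - w) = kmaj γ (w - v) := by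
  rw [← kmaj_neg, neg_sub]

/-- Integrability on `ℝ³ × ℝ³` of a singular convolution kernel against a Gaussian factor and an
integrable factor. -/
theorem integrable_prod_kernel {γ : ℝ} (hγ₁ : -3 < γ) (hγ₂ : γ < 0) {κ : V3 → ℝ} {c : ℝ}
    (hκ : Measurable κ) (hκc : ∀ z, |κ z| ≤ c * kmaj γ z) {p q : V3 → ℝ} {c' : ℝ}
    (hp : AEStronglyMeasurable p) (hpc : ∀ᵐ v, |p v| ≤ c' * gau v)
    (hq : AEStronglyMeasurable q) (hqi : Integrable fun w => (1 + ‖w‖ ^ 2) * q w) :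
    Integrable (fun x : V3 × V3 => κ (x.1 - x.2) * p x.1 * q x.2) (volume.prod volume) := by
  obtain ⟨C, hC, hb⟩ := exists_kmaj_bound hγ₁ hγ₂
  have hmeas : AEStronglyMeasurable (fun x : V3 × V3 => κ (x.1 - x.2) * p x.1 * q x.2)
      (volume.prod volume) :=
    (((hκ.comp (measurable_fst.sub measurable_snd)).aestronglyMeasurable).mul
      hp.comp_fst).mul hq.comp_snd
  have hc : 0 ≤ c := by
    have h1 := (abs_nonneg _).trans (hκc 0)
    have h2 : 0 < kmaj γ 0 := by unfold kmaj; positivity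
    exact nonneg_of_mul_nonneg_left h1 h2
  have hpt : ∀ᵐ v, ∀ w, ‖κ (v - w) * p v‖ ≤ c * c' * (kmaj γ (v - w) * gau v) := by
    filter_upwards [hpc] with v hv w
    rw [norm_mul, Real.norm_eq_abs, Real.norm_eq_abs]
    calc _ ≤ (c * kmaj γ (v - w)) * (c' * gau v) :=
          mul_le_mul (hκc _) hv (abs_nonneg _) (mul_nonneg hc (kmaj_nonneg _ _))
      _ = _ := by ring
  have hi : ∀ w, Integrable (fun v => κ (v - w) * p v) := fun w => by
    refine ((hb w).1.const_mul (c * c')).mono' ?_ (hpt.mono fun v hv => hv w)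
    exact (hκ.comp (measurable_id.sub_const w)).aestronglyMeasurable.mul hp
  -- Tonelli with the Gaussian variable v integrated first: the inner integral is O(1 + |w|²), which
  -- is the moment assumed of q.
  rw [integrable_prod_iff' hmeas]
  refine ⟨Filter.Eventually.of_forall fun w => (hi w).mul_const (q w), ?_⟩
  refine (hqi.norm.const_mul (|c * c'| * C)).mono' ?_ (Filter.Eventually.of_forall fun w => ?_)
  · exact (hmeas.norm.prod_swap).integral_prod_right'
  · rw [Real.norm_of_nonneg (integral_nonneg fun _ => norm_nonneg _)]
    simp only [norm_mul _ (q w)]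
    rw [integral_mul_const]
    have h1 : ∫ v, ‖κ (v - w) * p v‖ ≤ |c * c'| * (C * (1 + ‖w‖ ^ 2)) := by
      calc ∫ v, ‖κ (v - w) * p v‖ ≤ ∫ v, c * c' * (kmaj γ (v - w) * gau v) :=
            integral_mono_ae (hi w).norm ((hb w).1.const_mul _) (hpt.mono fun v hv => hv w)
        _ = c * c' * ∫ v, kmaj γ (v - w) * gau v := integral_const_mul _ _
        _ ≤ |c * c'| * ∫ v, kmaj γ (v - w) * gau v := by
          gcongr
          · exact integral_nonneg fun v => mul_nonneg (kmaj_nonneg _ _) (gau_pos v).le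
          · exact le_abs_self _
        _ ≤ _ := by gcongr; exact (hb w).2
    calc _ ≤ |c * c'| * (C * (1 + ‖w‖ ^ 2)) * ‖q w‖ := by gcongr
      _ = _ := by rw [Real.norm_of_nonneg (by positivity : 0 ≤ 1 + ‖w‖ ^ 2)]; ring

lemma measurable_aCoef (γ : ℝ) (j k : Fin 3) : Measurable (aCoef γ j k) := by
  unfold aCoef
  refine Measurable.mul (Measurable.sub ?_ ?_) (by fun_prop)
  · split_ifs <;> fun_prop
  · fun_prop

lemma aCoef_symm (γ : ℝ) (j k : Fin 3) (z : V3) : aCoef γ j k z = aCoef γ k j z := by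
  simp only [aCoef, eq_comm (a := j), mul_comm (z j)]

lemma aCoef_neg (γ : ℝ) (j k : Fin 3) (z : V3) : aCoef γ j k (-z) = aCoef γ j k z := by
  simp [aCoef]

lemma norm_sq_eq_sum (z : V3) : ‖z‖ ^ 2 = z 0 ^ 2 + z 1 ^ 2 + z 2 ^ 2 := by
  rw [EuclideanSpace.norm_sq_eq]; simp [Fin.sum_univ_three]

lemma abs_apply_le (z : V3) (j : Fin 3) : |z j| ≤ ‖z‖ := PiLp.norm_apply_le z j

lemma abs_aCoef_le (γ : ℝ) (j k : Fin 3) (z : V3) : |aCoef γ j k z| ≤ ‖z‖ ^ 2 * ‖z‖ ^ γ := by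
  have h0 : 0 ≤ ‖z‖ ^ γ := Real.rpow_nonneg (norm_nonneg z) γ
  rw [aCoef, abs_mul, abs_of_nonneg h0]
  gcongr
  have hn := norm_sq_eq_sum z
  rw [abs_le]
  split_ifs with h
  · subst h
    fin_cases j <;> constructor <;> simp <;>
      nlinarith [sq_nonneg (z 0), sq_nonneg (z 1), sq_nonneg (z 2)]
  · have h1 := abs_apply_le z j
    have h2 := abs_apply_le z k
    have : |z j * z k| ≤ ‖z‖ ^ 2 := by
      rw [abs_mul, sq]; gcongr
    constructor <;> linarith [abs_le.1 this]

lemma abs_aCoef_le_kmaj {γ : ℝ} (hγ : γ < 0) (j k : Fin 3) (z : V3) :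
    |aCoef γ j k z| ≤ 1 * kmaj γ z := by
  have := (abs_aCoef_le γ j k z).trans (norm_sq_mul_rpow_le hγ z)
  unfold kmaj; linarith

lemma sum_aCoef_mul (γ : ℝ) (j : Fin 3) (z : V3) : ∑ k, aCoef γ j k z * z k = 0 := by
  have h : ∑ k, aCoef γ j k z * z k
      = (∑ k, ((if j = k then ‖z‖ ^ 2 else 0) - z j * z k) * z k) * ‖z‖ ^ γ := by
    rw [Finset.sum_mul]; exact Finset.sum_congr rfl fun k _ => by rw [aCoef]; ring
  rw [h, norm_sq_eq_sum]
  fin_cases j <;> simp [Fin.sum_univ_three] <;> left <;> ring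

/-- The degeneracy a(z)z = 0 with z = v - w. It lets w be exchanged for v after the kernel, and it
is the source of all cancellations of drift terms. -/
lemma sum_aCoef_sub_mul (γ : ℝ) (j : Fin 3) (v w : V3) :
    ∑ k, aCoef γ j k (v - w) * w k = ∑ k, aCoef γ j k (v - w) * v k := by
  have := sum_aCoef_mul γ j (v - w)
  simp only [PiLp.sub_apply, mul_sub, Finset.sum_sub_distrib] at this
  linarith

/-- The quadratic form `|z|² |ξ|² - (z · ξ)²`. -/
noncomputable def crossSq (ξ z : V3) : ℝ :=
  (z 1 * ξ 2 - z 2 * ξ 1) ^ 2 + (z 2 * ξ 0 - z 0 * ξ 2) ^ 2 + (z 0 * ξ 1 - z 1 * ξ 0) ^ 2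

lemma crossSq_nonneg (ξ z : V3) : 0 ≤ crossSq ξ z := by unfold crossSq; positivity

lemma sum_aCoef_quadratic (γ : ℝ) (ξ z : V3) :
    ∑ j, ∑ k, aCoef γ j k z * ξ j * ξ k = crossSq ξ z * ‖z‖ ^ γ := by
  have h : ∑ j, ∑ k, aCoef γ j k z * ξ j * ξ k
      = (∑ j, ∑ k, ((if j = k then ‖z‖ ^ 2 else 0) - z j * z k) * ξ j * ξ k) * ‖z‖ ^ γ := by
    simp only [Finset.sum_mul]
    exact Finset.sum_congr rfl fun j _ => Finset.sum_congr rfl fun k _ => by rw [aCoef]; ring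
  rw [h, norm_sq_eq_sum, crossSq]
  congr 1
  simp [Fin.sum_univ_three]
  ring

lemma mu_le_gau (v : V3) : mu v ≤ 24 ^ 3 * gau v := by
  refine (mu_le_sqrtMu v).trans (le_trans ?_ (sqrtMu_mul_pow_le v))
  exact le_mul_of_one_le_right (sqrtMu_pos v).le (one_le_pow₀ (by nlinarith [sq_nonneg ‖v‖]))

lemma continuous_mu : Continuous mu := contDiff_mu.continuous

lemma continuous_sqrtMu : Continuous sqrtMu := contDiff_sqrtMu.continuous

lemma integrable_aCoef_mul_mu {γ : ℝ} (hγ₁ : -3 < γ) (hγ₂ : γ < 0) (j k : Fin 3) (v : V3) :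
    Integrable fun w => aCoef γ j k (v - w) * mu w := by
  obtain ⟨C, hC, hb⟩ := exists_kmaj_bound hγ₁ hγ₂
  refine ((hb v).1.const_mul (24 ^ 3)).mono' ?_ (Filter.Eventually.of_forall fun w => ?_)
  · exact (((measurable_aCoef γ j k).comp (measurable_const.sub measurable_id)).mul
      continuous_mu.measurable).aestronglyMeasurable
  · rw [norm_mul, Real.norm_eq_abs, Real.norm_of_nonneg (mu_pos w).le, kmaj_sub_comm]
    calc _ ≤ (1 * kmaj γ (v - w)) * (24 ^ 3 * gau w) :=
          mul_le_mul (abs_aCoef_le_kmaj hγ₂ _ _ _) (mu_le_gau w) (mu_pos w).le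
            (mul_nonneg zero_le_one (kmaj_nonneg _ _))
      _ = _ := by ring

lemma measurable_aBar (γ : ℝ) (j k : Fin 3) : Measurable (aBar γ j k) := by
  have : StronglyMeasurable fun x : V3 × V3 => aCoef γ j k (x.1 - x.2) * mu x.2 :=
    (((measurable_aCoef γ j k).comp (measurable_fst.sub measurable_snd)).mul
      (continuous_mu.measurable.comp measurable_snd)).stronglyMeasurable
  exact this.integral_prod_right'.measurable

lemma aBar_symm (γ : ℝ) (j k : Fin 3) (v : V3) : aBar γ j k v = aBar γ k j v := by
  simp only [aBar, aCoef_symm γ j k]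

theorem exists_abs_aBar_le {γ : ℝ} (hγ₁ : -3 < γ) (hγ₂ : γ < 0) :
    ∃ C, 0 ≤ C ∧ ∀ j k v, |aBar γ j k v| ≤ C * (1 + ‖v‖ ^ 2) := by
  obtain ⟨C, hC, hb⟩ := exists_kmaj_bound hγ₁ hγ₂
  refine ⟨24 ^ 3 * C, by positivity, fun j k v => ?_⟩
  have h1 : ∀ w, ‖aCoef γ j k (v - w) * mu w‖ ≤ 24 ^ 3 * (kmaj γ (w - v) * gau w) := by
    intro w
    rw [norm_mul, Real.norm_eq_abs, Real.norm_of_nonneg (mu_pos w).le, kmaj_sub_comm]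
    calc _ ≤ (1 * kmaj γ (v - w)) * (24 ^ 3 * gau w) :=
          mul_le_mul (abs_aCoef_le_kmaj hγ₂ _ _ _) (mu_le_gau w) (mu_pos w).le
            (mul_nonneg zero_le_one (kmaj_nonneg _ _))
      _ = _ := by rw [kmaj_sub_comm]; ring
  calc |aBar γ j k v| ≤ ∫ w, 24 ^ 3 * (kmaj γ (w - v) * gau w) :=
        norm_integral_le_of_norm_le ((hb v).1.const_mul _) (Filter.Eventually.of_forall h1)
    _ = 24 ^ 3 * ∫ w, kmaj γ (w - v) * gau w := integral_const_mul _ _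
    _ ≤ 24 ^ 3 * (C * (1 + ‖v‖ ^ 2)) := by gcongr; exact (hb v).2
    _ = _ := by ring

lemma sum_aBar_quadratic {γ : ℝ} (hγ₁ : -3 < γ) (hγ₂ : γ < 0) (ξ v : V3) :
    Integrable (fun w => crossSq ξ (v - w) * ‖v - w‖ ^ γ * mu w) ∧
    ∑ j, ∑ k, aBar γ j k v * ξ j * ξ k = ∫ w, crossSq ξ (v - w) * ‖v - w‖ ^ γ * mu w := by
  have hi := fun j k => ((integrable_aCoef_mul_mu hγ₁ hγ₂ j k v).mul_const (ξ j)).mul_const (ξ k)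
  have he : (fun w => crossSq ξ (v - w) * ‖v - w‖ ^ γ * mu w)
      = fun w => ∑ j, ∑ k, aCoef γ j k (v - w) * mu w * ξ j * ξ k := by
    funext w
    rw [← sum_aCoef_quadratic, Finset.sum_mul]
    refine Finset.sum_congr rfl fun j _ => ?_
    rw [Finset.sum_mul]
    exact Finset.sum_congr rfl fun k _ => by ring
  rw [he]
  refine ⟨integrable_finsetSum _ fun j _ => integrable_finsetSum _ fun k _ => hi j k, ?_⟩
  rw [integral_finsetSum _ fun j _ => integrable_finsetSum _ fun k _ => hi j k]
  refine Finset.sum_congr rfl fun j _ => ?_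
  rw [integral_finsetSum _ fun k _ => hi j k]
  refine Finset.sum_congr rfl fun k _ => ?_
  rw [integral_mul_const, integral_mul_const, aBar]

/-- Lower bound of the averaged Landau matrix. -/
theorem exists_aBar_lower {γ : ℝ} (hγ₁ : -3 < γ) (hγ₂ : γ < 0) :
    ∃ c, 0 < c ∧ ∀ ξ v : V3,
      c * (2 + ‖v‖) ^ γ * ‖ξ‖ ^ 2 ≤ ∑ j, ∑ k, aBar γ j k v * ξ j * ξ k := by
  -- For a unit vector e, the points ±e ± w with w ∈ B have norm at most 2. There μ ≥ m₀, and |v -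
  -- ·|^γ ≥ (2 + |v|)^γ because γ < 0.
  set B : Set V3 := Metric.ball 0 (1 / 2) with hB
  set m₀ : ℝ := (2 * Real.pi) ^ (-(3 / 2) : ℝ) * Real.exp (-(2 ^ 2 / 2)) with hm₀
  have hm₀pos : 0 < m₀ := by positivity
  have hBpos : 0 < volume.real B := by
    rw [measureReal_def]
    exact ENNReal.toReal_pos (Metric.measure_ball_pos _ _ (by norm_num)).ne' measure_ball_lt_top.ne
  refine ⟨m₀ * volume.real B * (1 / 3 * 2), by positivity, fun ξ v => ?_⟩
  obtain ⟨hint, heq⟩ := sum_aBar_quadratic hγ₁ hγ₂ ξ v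
  rw [heq]
  set F : V3 → ℝ := fun w => crossSq ξ (v - w) * ‖v - w‖ ^ γ * mu w with hF
  have hF0 : ∀ w, 0 ≤ F w := fun w => mul_nonneg (mul_nonneg (crossSq_nonneg _ _)
    (Real.rpow_nonneg (norm_nonneg _) _)) (mu_pos w).le
  have hFlow : ∀ w, ‖w‖ ≤ 2 → m₀ * (2 + ‖v‖) ^ γ * crossSq ξ (v - w) ≤ F w := by
    intro w hw
    -- At v = w the power |v - w|^γ takes the value 0, so monotonicity fails; but the quadratic form
    -- vanishes there as well.
    rcases eq_or_ne (v - w) 0 with h | h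
    · have h0 : crossSq ξ (v - w) = 0 := by rw [h]; simp [crossSq]
      simp [hF, h0]
    have h1 : m₀ ≤ mu w := by
      rw [hm₀, mu]; gcongr
    have h2 : (2 + ‖v‖) ^ γ ≤ ‖v - w‖ ^ γ := by
      apply Real.rpow_le_rpow_of_nonpos (norm_pos_iff.2 h) _ hγ₂.le
      linarith [norm_sub_le v w]
    have h3 := crossSq_nonneg ξ (v - w)
    calc _ = crossSq ξ (v - w) * (2 + ‖v‖) ^ γ * m₀ := by ring
      _ ≤ _ := by
        simp only [hF]
        gcongr
  have hC : Continuous fun z => crossSq ξ z := by unfold crossSq; fun_prop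
  have hiB : ∀ (e : V3) , IntegrableOn (fun w => crossSq ξ (v - (e + w))) B ∧
      IntegrableOn (fun w => crossSq ξ (v - (e - w))) B := by
    intro e
    constructor
    · exact ((by fun_prop : Continuous fun w => crossSq ξ (v - (e + w))).locallyIntegrable
        |>.integrableOn_isCompact (isCompact_closedBall 0 (1 / 2))).mono_set
        Metric.ball_subset_closedBall
    · exact ((by fun_prop : Continuous fun w => crossSq ξ (v - (e - w))).locallyIntegrable
        |>.integrableOn_isCompact (isCompact_closedBall 0 (1 / 2))).mono_set
        Metric.ball_subset_closedBall
  have hlow : ∀ e : V3, ‖e‖ = 1 →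
      m₀ * (2 + ‖v‖) ^ γ * ∫ w in B, crossSq ξ (v - (e + w)) ≤ ∫ w, F w ∧
      m₀ * (2 + ‖v‖) ^ γ * ∫ w in B, crossSq ξ (v - (e - w)) ≤ ∫ w, F w := by
    intro e he
    have hn : ∀ w ∈ B, ‖w‖ ≤ 1 := fun w hw => by
      have := mem_ball_zero_iff.1 hw; linarith
    constructor
    · rw [← integral_add_left_eq_self F e, ← integral_const_mul]
      refine le_trans ?_ (setIntegral_le_integral (s := B) (hint.comp_add_left e)
        (Filter.Eventually.of_forall fun w => hF0 _))
      refine setIntegral_mono_on ((hiB e).1.const_mul _) (hint.comp_add_left e).integrableOn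
        measurableSet_ball fun w hw => hFlow _ ?_
      linarith [norm_add_le e w, hn w hw]
    · rw [← integral_sub_left_eq_self F volume e, ← integral_const_mul]
      refine le_trans ?_ (setIntegral_le_integral (s := B) (hint.comp_sub_left e)
        (Filter.Eventually.of_forall fun w => hF0 _))
      refine setIntegral_mono_on ((hiB e).2.const_mul _) (hint.comp_sub_left e).integrableOn
        measurableSet_ball fun w hw => hFlow _ ?_
      linarith [norm_sub_le e w, hn w hw]
  have hkey : ∀ e : V3, ‖e‖ = 1 →
      m₀ * (2 + ‖v‖) ^ γ * (volume.real B * crossSq ξ e) ≤ ∫ w, F w := by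
    intro e he
    obtain ⟨a1, a2⟩ := hlow e he
    obtain ⟨a3, a4⟩ := hlow (-e) (by rwa [norm_neg])
    -- Parallelogram identity for the quadratic form q = |z × ξ|²: the sum of q over the four points
    -- v ± e ± w is 4q(v) + 4q(e) + 4q(w) ≥ 4q(e). The dependence on v disappears.
    have h1 : 4 * (volume.real B * crossSq ξ e) ≤ ((∫ w in B, crossSq ξ (v - (e + w)))
        + ∫ w in B, crossSq ξ (v - (e - w))) + ((∫ w in B, crossSq ξ (v - (-e + w)))
        + ∫ w in B, crossSq ξ (v - (-e - w))) := by
      have hs := integral_add ((hiB e).1.add (hiB e).2) ((hiB (-e)).1.add (hiB (-e)).2)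
      simp only [Pi.add_apply] at hs
      rw [← integral_add (hiB e).1 (hiB e).2, ← integral_add (hiB (-e)).1 (hiB (-e)).2, ← hs]
      have : 4 * (volume.real B * crossSq ξ e) = ∫ w in B, 4 * crossSq ξ e := by
        simp; ring
      rw [this]
      refine setIntegral_mono_on (integrableOn_const (by exact measure_ball_lt_top.ne))
        (((hiB e).1.add (hiB e).2).add ((hiB (-e)).1.add (hiB (-e)).2)) measurableSet_ball
        fun w _ => ?_
      have h2 := crossSq_nonneg ξ v
      have h3 := crossSq_nonneg ξ w
      simp only [crossSq, PiLp.sub_apply, PiLp.add_apply, PiLp.neg_apply] at h2 h3 ⊢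
      linarith
    have h2 : 0 ≤ m₀ * (2 + ‖v‖) ^ γ := by positivity
    have h3 := mul_le_mul_of_nonneg_left h1 h2
    linarith
  have hb : ∀ j, ‖basisVec j‖ = 1 := fun j => by simp [basisVec]
  -- One direction e may be parallel to ξ, but over an orthonormal basis Σ|eᵢ × ξ|² = 2|ξ|².
  -- Averaging the three bounds explains the factor 1/3 · 2.
  have hsum : ‖ξ‖ ^ 2 * 2 = crossSq ξ (basisVec 0) + crossSq ξ (basisVec 1)
      + crossSq ξ (basisVec 2) := by
    rw [norm_sq_eq_sum]
    simp [crossSq, basisVec]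
    ring
  have k0 := hkey _ (hb 0)
  have k1 := hkey _ (hb 1)
  have k2 := hkey _ (hb 2)
  have : m₀ * volume.real B * (1 / 3 * 2) * (2 + ‖v‖) ^ γ * ‖ξ‖ ^ 2
      = 1 / 3 * (m₀ * (2 + ‖v‖) ^ γ * (volume.real B * (‖ξ‖ ^ 2 * 2))) := by ring
  rw [this, hsum]
  linarith

end Landau

/-! ### Integration by parts against singular kernels -/

namespace Landau

open Filter Topology

lemma one_add_mul_rpow_le {γ : ℝ} (hγ : γ < 0) (z : V3) :
    (1 + ‖z‖) * ‖z‖ ^ γ ≤ 3 * kmaj γ z ∧ ‖z‖ * (1 + ‖z‖) * ‖z‖ ^ γ ≤ 3 * kmaj γ z := by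
  have h0 : 0 ≤ ‖z‖ ^ γ := Real.rpow_nonneg (norm_nonneg z) γ
  have h1 := norm_sq_mul_rpow_le hγ z
  have h2 : ‖z‖ * ‖z‖ ^ γ ≤ ‖z‖ ^ γ + ‖z‖ ^ 2 * ‖z‖ ^ γ := by
    have : ‖z‖ ≤ 1 + ‖z‖ ^ 2 := by nlinarith [sq_nonneg (‖z‖ - 1)]
    nlinarith
  unfold kmaj
  constructor <;> nlinarith [sq_nonneg ‖z‖]

lemma rpow_norm_regularized {γ : ℝ} (hγ : γ < 0) {z : V3} (hz : z ≠ 0) {ε : ℝ} (hε : 0 < ε) :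
    (‖z‖ ^ 2 + ε) ^ (γ / 2) ≤ ‖z‖ ^ γ := by
  have h1 : ‖z‖ ^ γ = (‖z‖ ^ 2) ^ (γ / 2) := by
    rw [← Real.rpow_natCast, ← Real.rpow_mul (norm_nonneg z)]; congr 1; push_cast; ring
  rw [h1]
  have := norm_pos_iff.2 hz
  exact Real.rpow_le_rpow_of_nonpos (by positivity) (by linarith) (by linarith)

lemma hasFDerivAt_regularized {γ : ℝ} {ε : ℝ} (hε : 0 < ε) (z : V3) :
    HasFDerivAt (fun z : V3 => (‖z‖ ^ 2 + ε) ^ (γ / 2))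
      ((γ * ((‖z‖ ^ 2 + ε) ^ (γ / 2) / (‖z‖ ^ 2 + ε))) • innerSL ℝ z) z := by
  have hq : 0 < ‖z‖ ^ 2 + ε := by positivity
  have h1 : HasFDerivAt (fun v : V3 => ‖v‖ ^ 2 + ε) (2 • innerSL ℝ z) z :=
    (hasStrictFDerivAt_norm_sq z).hasFDerivAt.add_const ε
  refine (h1.rpow_const (Or.inl hq.ne')).congr_fderiv ?_
  rw [Real.rpow_sub_one hq.ne']
  ext w
  simp
  ring

/-- Integration by parts against `p |z|^γ` with `p` of size `|z|` at the origin. -/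
theorem integral_mul_rpow_mul_fderiv {γ : ℝ} (hγ₂ : γ < 0) {p : V3 → ℝ}
    (hp : ContDiff ℝ 1 p) {C : ℝ} (hpC : ∀ z, |p z| ≤ C * (‖z‖ * (1 + ‖z‖))) (k : Fin 3)
    (hpC' : ∀ z, |fderiv ℝ p z (basisVec k)| ≤ C * (1 + ‖z‖)) {F : V3 → ℝ}
    (hF : ContDiff ℝ 1 F) (hFi : Integrable fun z => kmaj γ z * F z)
    (hFi' : Integrable fun z => kmaj γ z * fderiv ℝ F z (basisVec k)) :
    Integrable (fun z => (fderiv ℝ p z (basisVec k) * ‖z‖ ^ γ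
        + γ * (p z * z k * (‖z‖ ^ γ / ‖z‖ ^ 2))) * F z) ∧
    ∫ z, p z * ‖z‖ ^ γ * fderiv ℝ F z (basisVec k)
      = - ∫ z, (fderiv ℝ p z (basisVec k) * ‖z‖ ^ γ
        + γ * (p z * z k * (‖z‖ ^ γ / ‖z‖ ^ 2))) * F z := by
  -- The singular weight is replaced by the smooth (|z|² + ε)^(γ/2), which increases to |z|^γ off
  -- the origin. As p is O(|z|) near 0, the derivative of the product is still O(|z|^γ), and
  -- dominated convergence removes ε from both sides.
  set ε : ℕ → ℝ := fun n => 1 / ((n : ℝ) + 1) with hε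
  have hε0 : ∀ n, 0 < ε n := fun n => by positivity
  have hεl : Tendsto ε atTop (𝓝 0) := tendsto_one_div_add_atTop_nhds_zero_nat
  have hz0 : ∀ᵐ z : V3, z ≠ 0 := by
    have : (volume : Measure V3) {0} = 0 := measure_singleton 0
    rwa [ae_iff, show {a : V3 | ¬ a ≠ 0} = {0} by ext; simp]
  set r : ℕ → V3 → ℝ := fun n z => (‖z‖ ^ 2 + ε n) ^ (γ / 2) with hr
  have hq : ∀ n (z : V3), 0 < ‖z‖ ^ 2 + ε n := fun n z => by
    have := hε0 n; positivity
  have hr0 : ∀ n z, 0 ≤ r n z := fun n z => Real.rpow_nonneg (hq n z).le _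
  have hrc : ∀ n, Continuous (r n) := fun n =>
    Continuous.rpow_const (by fun_prop) fun z => Or.inl (hq n z).ne'
  have hC : 0 ≤ C := by
    have := (abs_nonneg _).trans (hpC' 0)
    simpa using this
  have hpcont : Continuous p := hp.continuous
  have hp'cont : Continuous fun z => fderiv ℝ p z (basisVec k) :=
    (hp.continuous_fderiv one_ne_zero).clm_apply continuous_const
  have hFcont : Continuous F := hF.continuous
  have hF'cont : Continuous fun z => fderiv ℝ F z (basisVec k) :=
    (hF.continuous_fderiv one_ne_zero).clm_apply continuous_const
  have hbd : ∀ n z, HasFDerivAt (fun z => p z * r n z)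
      (p z • ((γ * (r n z / (‖z‖ ^ 2 + ε n))) • innerSL ℝ z) + r n z • fderiv ℝ p z) z :=
    fun n z => ((hp.differentiable one_ne_zero) z).hasFDerivAt.mul
      (hasFDerivAt_regularized (hε0 n) z)
  have hbd' : ∀ n z, fderiv ℝ (fun z => p z * r n z) z (basisVec k)
      = fderiv ℝ p z (basisVec k) * r n z + γ * (p z * z k * (r n z / (‖z‖ ^ 2 + ε n))) := by
    intro n z
    rw [(hbd n z).fderiv]
    simp [inner_basisVec]
    ring
  -- pointwise bounds
  have B1 : ∀ n z, z ≠ 0 → ‖p z * r n z‖ ≤ 3 * C * kmaj γ z := by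
    intro n z hz
    rw [norm_mul, Real.norm_eq_abs, Real.norm_of_nonneg (hr0 n z)]
    calc _ ≤ C * (‖z‖ * (1 + ‖z‖)) * ‖z‖ ^ γ :=
          mul_le_mul (hpC z) (rpow_norm_regularized hγ₂ hz (hε0 n)) (hr0 n z) (by positivity)
      _ = C * (‖z‖ * (1 + ‖z‖) * ‖z‖ ^ γ) := by ring
      _ ≤ C * (3 * kmaj γ z) := mul_le_mul_of_nonneg_left (one_add_mul_rpow_le hγ₂ z).2 hC
      _ = _ := by ring
  have B2 : ∀ n z, z ≠ 0 → ‖fderiv ℝ p z (basisVec k) * r n z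
      + γ * (p z * z k * (r n z / (‖z‖ ^ 2 + ε n)))‖ ≤ (3 * C + |γ| * (3 * C)) * kmaj γ z := by
    intro n z hz
    have hrz := rpow_norm_regularized hγ₂ hz (hε0 n)
    have hzp := norm_pos_iff.2 hz
    have h1 : ‖fderiv ℝ p z (basisVec k) * r n z‖ ≤ 3 * C * kmaj γ z := by
      rw [norm_mul, Real.norm_eq_abs, Real.norm_of_nonneg (hr0 n z)]
      calc _ ≤ C * (1 + ‖z‖) * ‖z‖ ^ γ :=
            mul_le_mul (hpC' z) hrz (hr0 n z) (by positivity)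
        _ = C * ((1 + ‖z‖) * ‖z‖ ^ γ) := by ring
        _ ≤ C * (3 * kmaj γ z) := mul_le_mul_of_nonneg_left (one_add_mul_rpow_le hγ₂ z).1 hC
        _ = _ := by ring
    have h2 : ‖p z * z k * (r n z / (‖z‖ ^ 2 + ε n))‖ ≤ 3 * C * kmaj γ z := by
      rw [norm_mul, norm_mul, Real.norm_eq_abs, Real.norm_eq_abs,
        Real.norm_of_nonneg (div_nonneg (hr0 n z) (hq n z).le)]
      have h3 : r n z / (‖z‖ ^ 2 + ε n) ≤ ‖z‖ ^ γ / ‖z‖ ^ 2 :=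
        div_le_div₀ (by positivity) hrz (by positivity) (by linarith [hε0 n])
      calc _ ≤ C * (‖z‖ * (1 + ‖z‖)) * ‖z‖ * (‖z‖ ^ γ / ‖z‖ ^ 2) := by
            apply mul_le_mul (mul_le_mul (hpC z) (abs_apply_le z k) (abs_nonneg _)
              (by positivity)) h3 (div_nonneg (hr0 n z) (hq n z).le) (by positivity)
        _ = C * ((1 + ‖z‖) * ‖z‖ ^ γ) := by field_simp
        _ ≤ C * (3 * kmaj γ z) := mul_le_mul_of_nonneg_left (one_add_mul_rpow_le hγ₂ z).1 hC
        _ = _ := by ring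
    calc _ ≤ 3 * C * kmaj γ z + |γ| * (3 * C * kmaj γ z) := by
          refine (norm_add_le _ _).trans (add_le_add h1 ?_)
          rw [norm_mul, Real.norm_eq_abs γ]; gcongr
      _ = _ := by ring
  have hk : ∀ z, ‖kmaj γ z‖ = kmaj γ z := fun z => Real.norm_of_nonneg (kmaj_nonneg γ z)
  have hdom1 : ∀ n, ∀ᵐ z, ‖p z * r n z * fderiv ℝ F z (basisVec k)‖
      ≤ 3 * C * ‖kmaj γ z * fderiv ℝ F z (basisVec k)‖ := fun n => by
    filter_upwards [hz0] with z hz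
    rw [norm_mul, norm_mul (kmaj γ z), hk, ← mul_assoc]
    exact mul_le_mul_of_nonneg_right (B1 n z hz) (norm_nonneg _)
  have hdom2 : ∀ n, ∀ᵐ z, ‖(fderiv ℝ p z (basisVec k) * r n z
      + γ * (p z * z k * (r n z / (‖z‖ ^ 2 + ε n)))) * F z‖
      ≤ (3 * C + |γ| * (3 * C)) * ‖kmaj γ z * F z‖ := fun n => by
    filter_upwards [hz0] with z hz
    rw [norm_mul, norm_mul (kmaj γ z), hk]
    exact (mul_le_mul_of_nonneg_right (B2 n z hz) (norm_nonneg _)).trans_eq (mul_assoc _ _ _)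
  have hdom3 : ∀ n, ∀ᵐ z, ‖p z * r n z * F z‖ ≤ 3 * C * ‖kmaj γ z * F z‖ := fun n => by
    filter_upwards [hz0] with z hz
    rw [norm_mul, norm_mul (kmaj γ z), hk, ← mul_assoc]
    exact mul_le_mul_of_nonneg_right (B1 n z hz) (norm_nonneg _)
  have hqc : ∀ n, Continuous fun z : V3 => r n z / (‖z‖ ^ 2 + ε n) := fun n =>
    (hrc n).div (by fun_prop) fun z => (hq n z).ne'
  have hm1 : ∀ n, AEStronglyMeasurable
      (fun z => p z * r n z * fderiv ℝ F z (basisVec k)) volume := fun n =>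
    ((hpcont.mul (hrc n)).mul hF'cont).aestronglyMeasurable
  have hm2 : ∀ n, AEStronglyMeasurable (fun z => (fderiv ℝ p z (basisVec k) * r n z
      + γ * (p z * z k * (r n z / (‖z‖ ^ 2 + ε n)))) * F z) volume := fun n => by
    have h1 := hqc n
    have h2 := hrc n
    exact Continuous.aestronglyMeasurable (by fun_prop)
  have hn : ∀ n, ∫ z, p z * r n z * fderiv ℝ F z (basisVec k)
      = - ∫ z, (fderiv ℝ p z (basisVec k) * r n z
        + γ * (p z * z k * (r n z / (‖z‖ ^ 2 + ε n)))) * F z := by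
    intro n
    have := integral_mul_fderiv_eq_neg_fderiv_mul_of_integrable (μ := (volume : Measure V3))
      (f := fun z => p z * r n z) (g := F) (v := basisVec k) ?_ ?_ ?_
      (fun z _ => (hbd n z).differentiableAt) (fun z _ => hF.differentiable one_ne_zero z)
    · simpa only [hbd'] using this
    · simp only [hbd']
      exact (hFi.norm.const_mul _).mono' (hm2 n) (hdom2 n)
    · exact (hFi'.norm.const_mul _).mono' (hm1 n) (hdom1 n)
    · exact (hFi.norm.const_mul _).mono' ((hpcont.mul (hrc n)).mul hFcont).aestronglyMeasurable
        (hdom3 n)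
  have hrl : ∀ z : V3, z ≠ 0 → Tendsto (fun n => r n z) atTop (𝓝 (‖z‖ ^ γ)) := by
    intro z hz
    have h1 : ‖z‖ ^ γ = (‖z‖ ^ 2 + 0) ^ (γ / 2) := by
      rw [add_zero, ← Real.rpow_natCast, ← Real.rpow_mul (norm_nonneg z)]
      congr 1; push_cast; ring
    rw [h1]
    have := norm_pos_iff.2 hz
    exact (tendsto_const_nhds.add hεl).rpow_const (Or.inl (by positivity))
  have L1 := tendsto_integral_of_dominated_convergence _ hm1 (hFi'.norm.const_mul (3 * C)) hdom1
    (f := fun z => p z * ‖z‖ ^ γ * fderiv ℝ F z (basisVec k)) (by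
      filter_upwards [hz0] with z hz
      exact ((hrl z hz).const_mul _).mul_const _)
  have hlim2 : ∀ᵐ z, Tendsto (fun n => (fderiv ℝ p z (basisVec k) * r n z
      + γ * (p z * z k * (r n z / (‖z‖ ^ 2 + ε n)))) * F z) atTop
      (𝓝 ((fderiv ℝ p z (basisVec k) * ‖z‖ ^ γ
        + γ * (p z * z k * (‖z‖ ^ γ / ‖z‖ ^ 2))) * F z)) := by
    filter_upwards [hz0] with z hz
    have h2 : Tendsto (fun n => ‖z‖ ^ 2 + ε n) atTop (𝓝 (‖z‖ ^ 2)) := by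
      simpa using hεl.const_add (‖z‖ ^ 2)
    have := norm_pos_iff.2 hz
    exact (((hrl z hz).const_mul _).add
      ((((hrl z hz).div h2 (by positivity)).const_mul _).const_mul _)).mul_const _
  have L2 := tendsto_integral_of_dominated_convergence _ hm2
    (hFi.norm.const_mul (3 * C + |γ| * (3 * C))) hdom2 hlim2
  simp only [hn] at L1
  refine ⟨?_, tendsto_nhds_unique L1 L2.neg⟩
  refine (hFi.norm.const_mul (3 * C + |γ| * (3 * C))).mono'
    (aestronglyMeasurable_of_tendsto_ae atTop hm2 hlim2) ?_
  filter_upwards [hlim2, ae_all_iff.2 hdom2] with z h1 h2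
  exact le_of_tendsto h1.norm (Eventually.of_forall h2)

/-- Functions of class `C¹` that decay like a Gaussian, with their gradients. -/
def GaussDecay (F : V3 → ℝ) : Prop :=
  ContDiff ℝ 1 F ∧ ∃ C, ∀ v, |F v| ≤ C * gau v ∧ ∀ k, |fderiv ℝ F v (basisVec k)| ≤ C * gau v

lemma integrable_kmaj_mul {γ : ℝ} (hγ₁ : -3 < γ) (hγ₂ : γ < 0) {q : V3 → ℝ} (hq : Measurable q)
    {C : ℝ} (hqC : ∀ v, |q v| ≤ C * gau v) (x : V3) :
    Integrable fun y => kmaj γ (x - y) * q y := by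
  obtain ⟨_, -, hb⟩ := exists_kmaj_bound hγ₁ hγ₂
  refine ((hb x).1.const_mul C).mono' ?_ (Eventually.of_forall fun y => ?_)
  · exact (((measurable_kmaj γ).comp (measurable_const.sub measurable_id)).mul
      hq).aestronglyMeasurable
  · rw [norm_mul, Real.norm_eq_abs, Real.norm_eq_abs, abs_of_nonneg (kmaj_nonneg _ _),
      kmaj_sub_comm γ y]
    calc _ ≤ kmaj γ (x - y) * (C * gau y) := by
          gcongr
          · exact kmaj_nonneg _ _
          · exact hqC y
      _ = _ := by ring

lemma GaussDecay.measurable {F : V3 → ℝ} (hF : GaussDecay F) : Measurable F :=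
  hF.1.continuous.measurable

lemma GaussDecay.measurable_fderiv {F : V3 → ℝ} (hF : GaussDecay F) (k : Fin 3) :
    Measurable fun v => fderiv ℝ F v (basisVec k) :=
  ((hF.1.continuous_fderiv one_ne_zero).clm_apply continuous_const).measurable

lemma integral_sub_mul_fderiv {γ : ℝ} (hγ₁ : -3 < γ) (hγ₂ : γ < 0) {p : V3 → ℝ}
    (hp : ContDiff ℝ 1 p) {C : ℝ} (hpC : ∀ z, |p z| ≤ C * (‖z‖ * (1 + ‖z‖))) (k : Fin 3)
    (hpC' : ∀ z, |fderiv ℝ p z (basisVec k)| ≤ C * (1 + ‖z‖)) {F : V3 → ℝ} (hF : GaussDecay F)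
    (x : V3) :
    Integrable (fun y => (fderiv ℝ p (x - y) (basisVec k) * ‖x - y‖ ^ γ
        + γ * (p (x - y) * (x - y) k * (‖x - y‖ ^ γ / ‖x - y‖ ^ 2))) * F y) ∧
    ∫ y, p (x - y) * ‖x - y‖ ^ γ * fderiv ℝ F y (basisVec k)
      = ∫ y, (fderiv ℝ p (x - y) (basisVec k) * ‖x - y‖ ^ γ
        + γ * (p (x - y) * (x - y) k * (‖x - y‖ ^ γ / ‖x - y‖ ^ 2))) * F y := by
  obtain ⟨C', hC'⟩ := hF.2
  have hd : ∀ z, fderiv ℝ (fun z => F (x - z)) z (basisVec k)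
      = - fderiv ℝ F (x - z) (basisVec k) := by
    intro z
    have h1 : HasFDerivAt (fun z => x - z) (-ContinuousLinearMap.id ℝ V3) z :=
      (hasFDerivAt_id z).const_sub x
    have h2 : HasFDerivAt (fun z => F (x - z)) _ z :=
      ((hF.1.differentiable one_ne_zero) (x - z)).hasFDerivAt.comp z h1
    rw [h2.fderiv]
    simp
  have hi1 := (integrable_kmaj_mul hγ₁ hγ₂ hF.measurable (fun v => (hC' v).1) x).comp_sub_left x
  have hi2 := (integrable_kmaj_mul hγ₁ hγ₂ (hF.measurable_fderiv k)
    (fun v => (hC' v).2 k) x).comp_sub_left x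
  simp only [sub_sub_cancel] at hi1 hi2
  obtain ⟨hi, this⟩ := integral_mul_rpow_mul_fderiv hγ₂ hp hpC k hpC' (F := fun z => F (x - z))
    (hF.1.comp (contDiff_const.sub contDiff_id)) hi1 (by
      simp only [hd, mul_neg]; exact hi2.neg)
  simp only [hd, mul_neg, integral_neg, neg_inj] at this
  refine ⟨by simpa only [sub_sub_cancel] using hi.comp_sub_left x, ?_⟩
  rw [← integral_sub_left_eq_self (fun y => p (x - y) * ‖x - y‖ ^ γ * fderiv ℝ F y (basisVec k))
    volume x, ← integral_sub_left_eq_self (fun y => (fderiv ℝ p (x - y) (basisVec k) * ‖x - y‖ ^ γ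
        + γ * (p (x - y) * (x - y) k * (‖x - y‖ ^ γ / ‖x - y‖ ^ 2))) * F y) volume x]
  simpa only [sub_sub_cancel] using this

lemma fderiv_coord (j k : Fin 3) (z : V3) :
    fderiv ℝ (fun z : V3 => z j) z (basisVec k) = if j = k then 1 else 0 := by
  have : (fun z : V3 => z j) = EuclideanSpace.proj (𝕜 := ℝ) j := rfl
  rw [this, ContinuousLinearMap.fderiv]
  simp [basisVec]

lemma contDiff_coord (j : Fin 3) : ContDiff ℝ 1 fun z : V3 => z j :=
  (EuclideanSpace.proj (𝕜 := ℝ) j).contDiff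

lemma differentiable_coord (j : Fin 3) : Differentiable ℝ fun z : V3 => z j :=
  (contDiff_coord j).differentiable one_ne_zero

lemma fderiv_aPoly (j k : Fin 3) (z : V3) :
    fderiv ℝ (fun z : V3 => (if j = k then ‖z‖ ^ 2 else 0) - z j * z k) z (basisVec k)
      = (if j = k then z k else 0) - z j := by
  have h1 : HasFDerivAt (fun v : V3 => ‖v‖ ^ 2) (2 • innerSL ℝ z) z :=
    (hasStrictFDerivAt_norm_sq z).hasFDerivAt
  have h2 := ((differentiable_coord j) z).hasFDerivAt.fun_mul ((differentiable_coord k) z).hasFDerivAt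
  split_ifs with h
  · rw [(h1.fun_sub h2).fderiv]
    simp [inner_basisVec, fderiv_coord, h]
    ring
  · rw [((hasFDerivAt_const (0 : ℝ) z).fun_sub h2).fderiv]
    simp [fderiv_coord, h]

lemma sum_aPoly_mul (j : Fin 3) (z : V3) :
    ∑ k, ((if j = k then ‖z‖ ^ 2 else 0) - z j * z k) * z k = 0 := by
  rw [norm_sq_eq_sum]
  fin_cases j <;> simp [Fin.sum_univ_three] <;> ring

/-- The divergence of the rows of the Landau matrix. -/
theorem sum_integral_aCoef_mul_fderiv {γ : ℝ} (hγ₁ : -3 < γ) (hγ₂ : γ < 0) {F : V3 → ℝ}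
    (hF : GaussDecay F) (j : Fin 3) (x : V3) :
    ∑ k, ∫ y, aCoef γ j k (x - y) * fderiv ℝ F y (basisVec k)
      = ∫ y, -2 * ((x - y) j * ‖x - y‖ ^ γ) * F y := by
  have hp : ∀ k, ContDiff ℝ 1 fun z : V3 => (if j = k then ‖z‖ ^ 2 else 0) - z j * z k := by
    intro k
    refine ContDiff.sub ?_ ((contDiff_coord j).mul (contDiff_coord k))
    split_ifs
    · exact contDiff_norm_sq ℝ
    · exact contDiff_const
  have hb : ∀ k (z : V3), |(if j = k then ‖z‖ ^ 2 else 0) - z j * z k|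
      ≤ 2 * (‖z‖ * (1 + ‖z‖)) := by
    intro k z
    have h1 := abs_mul (z j) (z k)
    have h2 : |z j| * |z k| ≤ ‖z‖ * ‖z‖ :=
      mul_le_mul (abs_apply_le z j) (abs_apply_le z k) (abs_nonneg _) (norm_nonneg _)
    have h3 := norm_nonneg z
    have h4 := abs_le.1 (h1.le.trans h2)
    rw [abs_le]
    split_ifs <;> constructor <;> nlinarith
  have hb' : ∀ k (z : V3),
      |fderiv ℝ (fun z : V3 => (if j = k then ‖z‖ ^ 2 else 0) - z j * z k) z (basisVec k)|
      ≤ 2 * (1 + ‖z‖) := by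
    intro k z
    rw [fderiv_aPoly]
    have h1 := abs_le.1 (abs_apply_le z j)
    have h2 := abs_le.1 (abs_apply_le z k)
    rw [abs_le]
    split_ifs <;> constructor <;> linarith
  have key := fun k => integral_sub_mul_fderiv hγ₁ hγ₂ (hp k) (hb k) k (hb' k) hF x
  simp only [aCoef]
  rw [Finset.sum_congr rfl fun k _ => (key k).2, ← integral_finsetSum _ fun k _ => (key k).1]
  congr 1
  funext y
  rw [← Finset.sum_mul]
  congr 1
  -- The terms in which the derivative falls on |z|^γ contain Σ a_{jk} z_k = 0, so only the
  -- divergence -2z_j of the polynomial part survives.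
  simp only [fderiv_aPoly, Finset.sum_add_distrib, ← Finset.mul_sum, ← Finset.sum_mul,
    sum_aPoly_mul]
  fin_cases j <;> simp <;> ring

/-- The divergence of `z |z|^γ`. -/
theorem sum_integral_coord_mul_fderiv {γ : ℝ} (hγ₁ : -3 < γ) (hγ₂ : γ < 0) {F : V3 → ℝ}
    (hF : GaussDecay F) (x : V3) :
    ∑ k, ∫ y, (x - y) k * ‖x - y‖ ^ γ * fderiv ℝ F y (basisVec k)
      = ∫ y, (3 + γ) * ‖x - y‖ ^ γ * F y := by
  have key := fun k => integral_sub_mul_fderiv hγ₁ hγ₂ (contDiff_coord k) (C := 1)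
    (fun z => by nlinarith [abs_apply_le z k, norm_nonneg z]) k
    (fun z => by rw [fderiv_coord]; simp) hF x
  rw [Finset.sum_congr rfl fun k _ => (key k).2, ← integral_finsetSum _ fun k _ => (key k).1]
  congr 1
  funext y
  rw [← Finset.sum_mul]
  congr 1
  simp only [fderiv_coord, Finset.sum_add_distrib, ← Finset.mul_sum, ← Finset.sum_mul]
  -- The identity holds even at x = y, because `0 ^ γ` is 0 for real γ ≠ 0.
  rcases eq_or_ne (x - y) 0 with h | h
  · rw [h]; simp [Real.zero_rpow hγ₂.ne]
  · have h1 : ∑ k, (x - y) k * (x - y) k = ‖x - y‖ ^ 2 := by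
      rw [norm_sq_eq_sum, Fin.sum_univ_three]; ring
    have := norm_pos_iff.2 h
    rw [h1, mul_div_cancel₀ _ (by positivity)]
    simp
    ring

end Landau

/-! ### Integration by parts in both variables -/

namespace Landau

open Filter Topology

/-- Measurable kernels dominated by a multiple of `kmaj`. -/
def IsKernel (γ : ℝ) (κ : V3 → ℝ) : Prop := Measurable κ ∧ ∃ c, ∀ z, |κ z| ≤ c * kmaj γ z

lemma isKernel_aCoef {γ : ℝ} (hγ : γ < 0) (j k : Fin 3) : IsKernel γ (aCoef γ j k) :=
  ⟨measurable_aCoef γ j k, 1, abs_aCoef_le_kmaj hγ j k⟩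

lemma isKernel_rpow (γ : ℝ) : IsKernel γ fun z => ‖z‖ ^ γ :=
  ⟨by fun_prop, 1, fun z => by
    rw [abs_of_nonneg (Real.rpow_nonneg (norm_nonneg _) _)]; unfold kmaj
    linarith [sq_nonneg ‖z‖]⟩

lemma isKernel_coord_mul_rpow {γ : ℝ} (hγ : γ < 0) (j : Fin 3) :
    IsKernel γ fun z => z j * ‖z‖ ^ γ :=
  ⟨by fun_prop, 3, fun z => by
    have h0 := Real.rpow_nonneg (norm_nonneg z) γ
    rw [abs_mul, abs_of_nonneg h0]
    refine le_trans ?_ (one_add_mul_rpow_le hγ z).1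
    gcongr
    linarith [abs_apply_le z j]⟩

lemma isKernel_sq_mul_rpow {γ : ℝ} (hγ : γ < 0) : IsKernel γ fun z => ‖z‖ ^ 2 * ‖z‖ ^ γ :=
  ⟨by fun_prop, 1, fun z => by
    have h0 := Real.rpow_nonneg (norm_nonneg z) γ
    rw [abs_of_nonneg (by positivity)]
    have := norm_sq_mul_rpow_le hγ z
    unfold kmaj; linarith⟩

/-- Measurable functions with Gaussian decay, a polynomial factor to spare. -/
def MuDecay (q : V3 → ℝ) : Prop :=
  Measurable q ∧ ∃ C, ∀ v, |q v| ≤ C * ((1 + ‖v‖ ^ 2) ^ 2 * sqrtMu v)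

lemma MuDecay.add {p q : V3 → ℝ} (hp : MuDecay p) (hq : MuDecay q) :
    MuDecay fun v => p v + q v := by
  obtain ⟨hp, C, hC⟩ := hp
  obtain ⟨hq, C', hC'⟩ := hq
  exact ⟨hp.add hq, C + C', fun v => (abs_add_le _ _).trans (by rw [add_mul]; exact add_le_add (hC v) (hC' v))⟩

lemma MuDecay.const_mul {q : V3 → ℝ} (hq : MuDecay q) (c : ℝ) : MuDecay fun v => c * q v := by
  obtain ⟨hq, C, hC⟩ := hq
  exact ⟨hq.const_mul c, |c| * C, fun v => by
    rw [abs_mul, mul_assoc]; exact mul_le_mul_of_nonneg_left (hC v) (abs_nonneg c)⟩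

lemma MuDecay.abs_le_gau {q : V3 → ℝ} (hq : MuDecay q) : ∃ C, 0 ≤ C ∧
    ∀ v, (1 + ‖v‖ ^ 2) * |q v| ≤ C * gau v := by
  obtain ⟨hq, C, hC⟩ := hq
  refine ⟨|C| * 24 ^ 3, by positivity, fun v => ?_⟩
  calc (1 + ‖v‖ ^ 2) * |q v| ≤ (1 + ‖v‖ ^ 2) * (|C| * ((1 + ‖v‖ ^ 2) ^ 2 * sqrtMu v)) := by
        gcongr
        refine (hC v).trans ?_
        have := (sqrtMu_pos v).le
        gcongr
        exact le_abs_self C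
    _ = |C| * (sqrtMu v * (1 + ‖v‖ ^ 2) ^ 3) := by ring
    _ ≤ |C| * (24 ^ 3 * gau v) :=
      mul_le_mul_of_nonneg_left (sqrtMu_mul_pow_le v) (abs_nonneg C)
    _ = _ := by ring

lemma MuDecay.abs_le_gau' {q : V3 → ℝ} (hq : MuDecay q) : ∃ C, 0 ≤ C ∧ ∀ v, |q v| ≤ C * gau v := by
  obtain ⟨C, h0, hC⟩ := hq.abs_le_gau
  refine ⟨C, h0, fun v => le_trans ?_ (hC v)⟩
  exact le_mul_of_one_le_left (abs_nonneg _) (by linarith [sq_nonneg ‖v‖])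

lemma MuDecay.integrable {q : V3 → ℝ} (hq : MuDecay q) :
    Integrable fun w => (1 + ‖w‖ ^ 2) * q w := by
  obtain ⟨C, h0, hC⟩ := hq.abs_le_gau
  have hm := hq.1
  refine (integrable_gau.const_mul C).mono' (by fun_prop) (Eventually.of_forall fun w => ?_)
  rw [norm_mul, Real.norm_of_nonneg (by positivity)]
  exact hC w

lemma IsKernel.integrable_mul {γ : ℝ} (hγ₁ : -3 < γ) (hγ₂ : γ < 0) {κ : V3 → ℝ}
    (hκ : IsKernel γ κ) {q : V3 → ℝ} (hq : MuDecay q) (x : V3) :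
    Integrable fun y => κ (x - y) * q y := by
  obtain ⟨hκm, c, hc⟩ := hκ
  obtain ⟨C, -, hC⟩ := hq.abs_le_gau'
  refine ((integrable_kmaj_mul hγ₁ hγ₂ hq.1 hC x).norm.const_mul c).mono' ?_
    (Eventually.of_forall fun y => ?_)
  · exact ((hκm.comp (measurable_const.sub measurable_id)).mul hq.1).aestronglyMeasurable
  · rw [norm_mul, norm_mul, ← mul_assoc, Real.norm_of_nonneg (kmaj_nonneg _ _)]
    exact mul_le_mul_of_nonneg_right (hc _) (norm_nonneg _)

lemma IsKernel.integrable_mul' {γ : ℝ} (hγ₁ : -3 < γ) (hγ₂ : γ < 0) {κ : V3 → ℝ}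
    (hκ : IsKernel γ κ) {q : V3 → ℝ} (hq : MuDecay q) (x : V3) :
    Integrable fun y => κ (y - x) * q y := by
  have h : IsKernel γ fun z => κ (-z) := ⟨hκ.1.comp measurable_neg, by
    obtain ⟨c, hc⟩ := hκ.2
    exact ⟨c, fun z => by rw [← kmaj_neg]; exact hc _⟩⟩
  simpa using h.integrable_mul hγ₁ hγ₂ hq x

lemma IsKernel.integrable_prod {γ : ℝ} (hγ₁ : -3 < γ) (hγ₂ : γ < 0) {κ : V3 → ℝ}
    (hκ : IsKernel γ κ) {p q : V3 → ℝ} (hp : MuDecay p) (hq : MuDecay q) :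
    Integrable (fun x : V3 × V3 => κ (x.1 - x.2) * p x.1 * q x.2) (volume.prod volume) := by
  obtain ⟨hκm, c, hc⟩ := hκ
  obtain ⟨C, -, hC⟩ := hp.abs_le_gau'
  exact integrable_prod_kernel hγ₁ hγ₂ hκm hc hp.1.aestronglyMeasurable
    (Eventually.of_forall hC) hq.1.aestronglyMeasurable hq.integrable

/-- Functions of class `C¹` bounded, with their gradients, by a multiple of `√μ`. -/
def MuDecay₁ (F : V3 → ℝ) : Prop :=
  ContDiff ℝ 1 F ∧ ∃ C, ∀ v, |F v| ≤ C * sqrtMu v ∧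
    ∀ k, |fderiv ℝ F v (basisVec k)| ≤ C * sqrtMu v

lemma muDecay_of_le {q : V3 → ℝ} (hq : Measurable q) {C : ℝ}
    (hC : ∀ v, |q v| ≤ C * sqrtMu v) : MuDecay q := by
  refine ⟨hq, C, fun v => (hC v).trans ?_⟩
  have h0 : 0 ≤ C := nonneg_of_mul_nonneg_left ((abs_nonneg _).trans (hC v)) (sqrtMu_pos v)
  have h1 := (sqrtMu_pos v).le
  gcongr
  exact le_mul_of_one_le_left h1 (one_le_pow₀ (by linarith [sq_nonneg ‖v‖]))

lemma muDecay_coord_of_le {q : V3 → ℝ} (hq : Measurable q) {C : ℝ}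
    (hC : ∀ v, |q v| ≤ C * sqrtMu v) (j : Fin 3) : MuDecay fun v => v j * q v := by
  refine ⟨by fun_prop, C, fun v => ?_⟩
  have h0 : 0 ≤ C := nonneg_of_mul_nonneg_left ((abs_nonneg _).trans (hC v)) (sqrtMu_pos v)
  have h1 := (sqrtMu_pos v).le
  have h2 : |v j| ≤ (1 + ‖v‖ ^ 2) ^ 2 := by
    have := abs_apply_le v j
    nlinarith [sq_nonneg (‖v‖ - 1), sq_nonneg ‖v‖, sq_nonneg (‖v‖ ^ 2)]
  rw [abs_mul]
  calc |v j| * |q v| ≤ (1 + ‖v‖ ^ 2) ^ 2 * (C * sqrtMu v) :=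
        mul_le_mul h2 (hC v) (abs_nonneg _) (by positivity)
    _ = _ := by ring

namespace MuDecay₁

variable {F : V3 → ℝ}

lemma gaussDecay (hF : MuDecay₁ F) : GaussDecay F := by
  obtain ⟨h1, C, hC⟩ := hF
  have h2 : ∀ v, C * sqrtMu v ≤ C * 24 ^ 3 * gau v := fun v => by
    have h0 : 0 ≤ C := nonneg_of_mul_nonneg_left ((abs_nonneg _).trans (hC v).1) (sqrtMu_pos v)
    rw [mul_assoc]
    refine mul_le_mul_of_nonneg_left (le_trans ?_ (sqrtMu_mul_pow_le v)) h0
    exact le_mul_of_one_le_right (sqrtMu_pos v).le (one_le_pow₀ (by nlinarith [sq_nonneg ‖v‖]))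
  exact ⟨h1, C * 24 ^ 3, fun v => ⟨(hC v).1.trans (h2 v), fun k => ((hC v).2 k).trans (h2 v)⟩⟩

lemma muDecay (hF : MuDecay₁ F) : MuDecay F :=
  muDecay_of_le hF.1.continuous.measurable fun v => (hF.2.choose_spec v).1

lemma muDecay_coord (hF : MuDecay₁ F) (j : Fin 3) : MuDecay fun v => v j * F v :=
  muDecay_coord_of_le hF.1.continuous.measurable (fun v => (hF.2.choose_spec v).1) j

lemma muDecay_fderiv (hF : MuDecay₁ F) (j : Fin 3) :
    MuDecay fun v => fderiv ℝ F v (basisVec j) :=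
  muDecay_of_le (hF.gaussDecay.measurable_fderiv j) fun v => (hF.2.choose_spec v).2 j

/-- The function `∂_j F + v_j F`. -/
lemma muDecay_twisted (hF : MuDecay₁ F) (j : Fin 3) :
    MuDecay fun v => fderiv ℝ F v (basisVec j) + v j * F v :=
  (hF.muDecay_fderiv j).add (hF.muDecay_coord j)

end MuDecay₁

variable {γ : ℝ}

/-- First integration by parts, in the variable of F: the derivative on F becomes the divergence
-2z_j|z|^γ, with z = x - y, of a row of the Landau matrix. -/
lemma sum_integral_aCoef_mul_twisted (hγ₁ : -3 < γ) (hγ₂ : γ < 0) {F : V3 → ℝ}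
    (hF : MuDecay₁ F) (j : Fin 3) (x : V3) :
    ∑ k, ∫ y, aCoef γ j k (x - y) * (fderiv ℝ F y (basisVec k) + y k * F y)
      = ∫ y, (-2 * ((x - y) j * ‖x - y‖ ^ γ) + ∑ k, aCoef γ j k (x - y) * y k) * F y := by
  have i1 : ∀ k, Integrable fun y => aCoef γ j k (x - y) * fderiv ℝ F y (basisVec k) := fun k =>
    (isKernel_aCoef hγ₂ j k).integrable_mul hγ₁ hγ₂ (hF.muDecay_fderiv k) x
  have i2 : ∀ k, Integrable fun y => aCoef γ j k (x - y) * (y k * F y) := fun k =>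
    (isKernel_aCoef hγ₂ j k).integrable_mul hγ₁ hγ₂ (hF.muDecay_coord k) x
  have i3 : Integrable fun y => -2 * ((x - y) j * ‖x - y‖ ^ γ) * F y := by
    simp only [mul_assoc (-2 : ℝ)]
    exact ((isKernel_coord_mul_rpow hγ₂ j).integrable_mul hγ₁ hγ₂ hF.muDecay x).const_mul _
  have e1 : ∀ k, ∫ y, aCoef γ j k (x - y) * (fderiv ℝ F y (basisVec k) + y k * F y)
      = (∫ y, aCoef γ j k (x - y) * fderiv ℝ F y (basisVec k))
        + ∫ y, aCoef γ j k (x - y) * (y k * F y) := fun k => by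
    rw [← integral_add (i1 k) (i2 k)]; simp only [mul_add]
  simp only [e1]
  rw [Finset.sum_add_distrib, sum_integral_aCoef_mul_fderiv hγ₁ hγ₂ hF.gaussDecay,
    ← integral_finsetSum _ fun k _ => i2 k,
    ← integral_add i3 (integrable_finsetSum _ fun k _ => i2 k)]
  congr 1
  funext y
  rw [add_mul, Finset.sum_mul]
  simp only [mul_assoc]

lemma sum_integral_aCoef_mul_fderiv' (hγ₁ : -3 < γ) (hγ₂ : γ < 0) {Φ : V3 → ℝ}
    (hΦ : GaussDecay Φ) (k : Fin 3) (w : V3) :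
    ∑ j, ∫ v, aCoef γ j k (v - w) * fderiv ℝ Φ v (basisVec j)
      = ∫ v, 2 * ((v - w) k * ‖v - w‖ ^ γ * Φ v) := by
  have := sum_integral_aCoef_mul_fderiv hγ₁ hγ₂ hΦ k w
  have h2 : ∀ j v, aCoef γ k j (w - v) = aCoef γ j k (v - w) := fun j v => by
    rw [aCoef_symm, ← neg_sub v w, aCoef_neg]
  simp only [h2] at this
  rw [this]
  congr 1; funext v
  rw [norm_sub_rev, ← neg_sub v w, PiLp.neg_apply]; ring

/-- The kernel obtained by integrating by parts in both variables. -/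
noncomputable def ibpKernel (γ : ℝ) (v w : V3) : ℝ :=
  2 * (3 + γ) * ‖v - w‖ ^ γ - 2 * (‖v - w‖ ^ 2 * ‖v - w‖ ^ γ)
    + ∑ j, ∑ k, aCoef γ j k (v - w) * v j * w k

/-- Second integration by parts, in the variable of Φ: it uses div(z|z|^γ) = (3+γ)|z|^γ for the
vector kernel left by the first one, and once more the divergence of the matrix. -/
lemma sum_integral_twisted_mul (hγ₁ : -3 < γ) (hγ₂ : γ < 0) {Φ : V3 → ℝ} (hΦ : MuDecay₁ Φ)
    (w : V3) :
    ∑ j, ∫ v, (-2 * ((v - w) j * ‖v - w‖ ^ γ) + ∑ k, aCoef γ j k (v - w) * w k)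
        * (fderiv ℝ Φ v (basisVec j) + v j * Φ v)
      = ∫ v, ibpKernel γ v w * Φ v := by
  have n1 : ∀ j, Integrable fun v => (v - w) j * ‖v - w‖ ^ γ * fderiv ℝ Φ v (basisVec j) :=
    fun j => (isKernel_coord_mul_rpow hγ₂ j).integrable_mul' hγ₁ hγ₂ (hΦ.muDecay_fderiv j) w
  have n2 : ∀ j, Integrable fun v => (v - w) j * ‖v - w‖ ^ γ * (v j * Φ v) :=
    fun j => (isKernel_coord_mul_rpow hγ₂ j).integrable_mul' hγ₁ hγ₂ (hΦ.muDecay_coord j) w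
  have a1 : ∀ j k, Integrable fun v => aCoef γ j k (v - w) * fderiv ℝ Φ v (basisVec j) :=
    fun j k => (isKernel_aCoef hγ₂ j k).integrable_mul' hγ₁ hγ₂ (hΦ.muDecay_fderiv j) w
  have a2 : ∀ j k, Integrable fun v => aCoef γ j k (v - w) * (v j * Φ v) :=
    fun j k => (isKernel_aCoef hγ₂ j k).integrable_mul' hγ₁ hγ₂ (hΦ.muDecay_coord j) w
  have c1 : ∀ k, Integrable fun v => (v - w) k * ‖v - w‖ ^ γ * Φ v :=
    fun k => (isKernel_coord_mul_rpow hγ₂ k).integrable_mul' hγ₁ hγ₂ hΦ.muDecay w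
  have c0 : Integrable fun v => ‖v - w‖ ^ γ * Φ v :=
    (isKernel_rpow γ).integrable_mul' hγ₁ hγ₂ hΦ.muDecay w
  have j1 : ∀ j, Integrable fun v => -2 * ((v - w) j * ‖v - w‖ ^ γ * fderiv ℝ Φ v (basisVec j))
      + ∑ k, w k * (aCoef γ j k (v - w) * fderiv ℝ Φ v (basisVec j)) := fun j =>
    ((n1 j).const_mul _).add (integrable_finsetSum _ fun k _ => (a1 j k).const_mul _)
  have j2 : ∀ j, Integrable fun v => -2 * ((v - w) j * ‖v - w‖ ^ γ * (v j * Φ v))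
      + ∑ k, w k * (aCoef γ j k (v - w) * (v j * Φ v)) := fun j =>
    ((n2 j).const_mul _).add (integrable_finsetSum _ fun k _ => (a2 j k).const_mul _)
  have e1 : ∀ j, ∫ v, (-2 * ((v - w) j * ‖v - w‖ ^ γ) + ∑ k, aCoef γ j k (v - w) * w k)
        * (fderiv ℝ Φ v (basisVec j) + v j * Φ v)
      = (-2 * (∫ v, (v - w) j * ‖v - w‖ ^ γ * fderiv ℝ Φ v (basisVec j))
        + ∑ k, w k * ∫ v, aCoef γ j k (v - w) * fderiv ℝ Φ v (basisVec j))
        + ∫ v, (-2 * ((v - w) j * ‖v - w‖ ^ γ * (v j * Φ v))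
          + ∑ k, w k * (aCoef γ j k (v - w) * (v j * Φ v))) := by
    intro j
    simp only [← integral_const_mul]
    rw [← integral_finsetSum _ fun k _ => (a1 j k).const_mul (w k),
      ← integral_add ((n1 j).const_mul _) (integrable_finsetSum _ fun k _ => (a1 j k).const_mul _),
      ← integral_add (j1 j) (j2 j)]
    congr 1
    funext v
    simp only [Fin.sum_univ_three]
    ring
  simp only [e1]
  rw [Finset.sum_add_distrib, Finset.sum_add_distrib, Finset.sum_comm]
  have s1 : ∑ j, -2 * (∫ v, (v - w) j * ‖v - w‖ ^ γ * fderiv ℝ Φ v (basisVec j))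
      = ∫ v, 2 * ((3 + γ) * ‖v - w‖ ^ γ * Φ v) := by
    have := sum_integral_coord_mul_fderiv hγ₁ hγ₂ hΦ.gaussDecay w
    have h2 : ∀ j, (∫ v, (w - v) j * ‖w - v‖ ^ γ * fderiv ℝ Φ v (basisVec j))
        = - ∫ v, (v - w) j * ‖v - w‖ ^ γ * fderiv ℝ Φ v (basisVec j) := fun j => by
      rw [← integral_neg]; congr 1; funext v
      rw [norm_sub_rev, ← neg_sub v w, PiLp.neg_apply]; ring
    simp only [h2] at this
    simp only [norm_sub_rev w] at this
    rw [integral_const_mul, ← this, Finset.mul_sum]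
    exact Finset.sum_congr rfl fun j _ => by ring
  have s2 : ∑ k, ∑ j, w k * (∫ v, aCoef γ j k (v - w) * fderiv ℝ Φ v (basisVec j))
      = ∫ v, ∑ k, w k * (2 * ((v - w) k * ‖v - w‖ ^ γ * Φ v)) := by
    rw [integral_finsetSum _ fun k _ => ((c1 k).const_mul 2).const_mul (w k)]
    refine Finset.sum_congr rfl fun k _ => ?_
    rw [← Finset.mul_sum, integral_const_mul, sum_integral_aCoef_mul_fderiv' hγ₁ hγ₂ hΦ.gaussDecay]
  rw [s1, s2, ← integral_finsetSum _ fun j _ => j2 j]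
  have i1 : Integrable fun v => 2 * ((3 + γ) * ‖v - w‖ ^ γ * Φ v) := by
    simp only [mul_assoc]; exact (c0.const_mul _).const_mul _
  have i2 : Integrable fun v => ∑ k, w k * (2 * ((v - w) k * ‖v - w‖ ^ γ * Φ v)) :=
    integrable_finsetSum _ fun k _ => ((c1 k).const_mul 2).const_mul (w k)
  have i12 : Integrable fun v => 2 * ((3 + γ) * ‖v - w‖ ^ γ * Φ v)
      + ∑ k, w k * (2 * ((v - w) k * ‖v - w‖ ^ γ * Φ v)) := i1.add i2
  rw [← integral_add i1 i2, ← integral_add i12 (integrable_finsetSum _ fun j _ => j2 j)]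
  congr 1
  funext v
  -- The terms -2(z·v)|z|^γ and 2(z·w)|z|^γ, with z = v - w, combine into -2|z|²|z|^γ.
  rw [ibpKernel, norm_sq_eq_sum]
  simp only [Fin.sum_univ_three, PiLp.sub_apply]
  ring

/-- Integration by parts in both variables in the nonlocal part of the linearized operator. -/
theorem double_integration_by_parts (hγ₁ : -3 < γ) (hγ₂ : γ < 0) {F Φ : V3 → ℝ}
    (hF : MuDecay₁ F) (hΦ : MuDecay₁ Φ) :
    ∫ x : V3 × V3, (∑ j, ∑ k, aCoef γ j k (x.1 - x.2)
        * (fderiv ℝ Φ x.1 (basisVec j) + x.1 j * Φ x.1)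
        * (fderiv ℝ F x.2 (basisVec k) + x.2 k * F x.2)) ∂(volume.prod volume)
      = ∫ x : V3 × V3, ibpKernel γ x.1 x.2 * Φ x.1 * F x.2 ∂(volume.prod volume) := by
  have iA : ∀ j k, Integrable (fun x : V3 × V3 => aCoef γ j k (x.1 - x.2)
      * (fderiv ℝ Φ x.1 (basisVec j) + x.1 j * Φ x.1)
      * (fderiv ℝ F x.2 (basisVec k) + x.2 k * F x.2)) (volume.prod volume) := fun j k =>
    (isKernel_aCoef hγ₂ j k).integrable_prod hγ₁ hγ₂ (hΦ.muDecay_twisted j) (hF.muDecay_twisted k)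
  have iB : ∀ j, Integrable (fun x : V3 × V3 =>
      (-2 * ((x.1 - x.2) j * ‖x.1 - x.2‖ ^ γ) + ∑ k, aCoef γ j k (x.1 - x.2) * x.2 k)
      * (fderiv ℝ Φ x.1 (basisVec j) + x.1 j * Φ x.1) * F x.2) (volume.prod volume) := by
    intro j
    have h1 := ((isKernel_coord_mul_rpow hγ₂ j).integrable_prod hγ₁ hγ₂
      (hΦ.muDecay_twisted j) hF.muDecay).const_mul (-2)
    have h2 := fun k => (isKernel_aCoef hγ₂ j k).integrable_prod hγ₁ hγ₂
      (hΦ.muDecay_twisted j) (hF.muDecay_coord k)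
    refine (h1.add (integrable_finsetSum Finset.univ fun k _ => h2 k)).congr
      (Eventually.of_forall fun x => ?_)
    simp only [Fin.sum_univ_three, Pi.add_apply]
    ring
  rw [integral_finsetSum _ fun j _ => integrable_finsetSum _ fun k _ => iA j k]
  have e1 : ∀ j, ∫ x : V3 × V3, (∑ k, aCoef γ j k (x.1 - x.2)
        * (fderiv ℝ Φ x.1 (basisVec j) + x.1 j * Φ x.1)
        * (fderiv ℝ F x.2 (basisVec k) + x.2 k * F x.2)) ∂(volume.prod volume)
      = ∫ x : V3 × V3,
      (-2 * ((x.1 - x.2) j * ‖x.1 - x.2‖ ^ γ) + ∑ k, aCoef γ j k (x.1 - x.2) * x.2 k)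
      * (fderiv ℝ Φ x.1 (basisVec j) + x.1 j * Φ x.1) * F x.2 ∂(volume.prod volume) := by
    intro j
    rw [integral_prod _ (integrable_finsetSum _ fun k _ => iA j k), integral_prod _ (iB j)]
    congr 1
    funext v
    have i3 : ∀ k, Integrable fun y => aCoef γ j k (v - y)
        * (fderiv ℝ F y (basisVec k) + y k * F y) := fun k =>
      (isKernel_aCoef hγ₂ j k).integrable_mul hγ₁ hγ₂ (hF.muDecay_twisted k) v
    have := sum_integral_aCoef_mul_twisted hγ₁ hγ₂ hF j v
    rw [← integral_finsetSum _ fun k _ => i3 k] at this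
    set Y := fderiv ℝ Φ v (basisVec j) + v j * Φ v with hY
    calc _ = Y * ∫ w, ∑ k, aCoef γ j k (v - w)
        * (fderiv ℝ F w (basisVec k) + w k * F w) := by
          rw [← integral_const_mul]; congr 1; funext w
          rw [Finset.mul_sum]
          exact Finset.sum_congr rfl fun k _ => by ring
      _ = _ := by
          rw [this, ← integral_const_mul]; congr 1; funext w; ring
  rw [Finset.sum_congr rfl fun j _ => e1 j, ← integral_finsetSum _ fun j _ => iB j]
  have iC : Integrable (fun x : V3 × V3 => ibpKernel γ x.1 x.2 * Φ x.1 * F x.2)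
      (volume.prod volume) := by
    have h1 := ((isKernel_rpow γ).integrable_prod hγ₁ hγ₂ hΦ.muDecay hF.muDecay).const_mul
      (2 * (3 + γ))
    have h2 := ((isKernel_sq_mul_rpow hγ₂).integrable_prod hγ₁ hγ₂ hΦ.muDecay
      hF.muDecay).const_mul 2
    have h3 := fun j k => (isKernel_aCoef hγ₂ j k).integrable_prod hγ₁ hγ₂ (hΦ.muDecay_coord j)
      (hF.muDecay_coord k)
    refine ((h1.sub h2).add (integrable_finsetSum Finset.univ fun j _ =>
      integrable_finsetSum Finset.univ fun k _ => h3 j k)).congr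
      (Eventually.of_forall fun x => ?_)
    simp only [Fin.sum_univ_three, Pi.add_apply, Pi.sub_apply, ibpKernel]
    ring
  -- The order of integration is reversed: F has been freed of its derivative with v fixed, and Φ is
  -- now treated with w fixed.
  rw [integral_prod_symm _ (integrable_finsetSum _ fun j _ => iB j), integral_prod_symm _ iC]
  congr 1
  funext w
  have n3 : ∀ j, Integrable fun v => (-2 * ((v - w) j * ‖v - w‖ ^ γ)
      + ∑ k, aCoef γ j k (v - w) * w k) * (fderiv ℝ Φ v (basisVec j) + v j * Φ v) := by
    intro j
    have h1 := ((isKernel_coord_mul_rpow hγ₂ j).integrable_mul' hγ₁ hγ₂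
      (hΦ.muDecay_twisted j) w).const_mul (-2)
    have h2 := fun k => ((isKernel_aCoef hγ₂ j k).integrable_mul' hγ₁ hγ₂
      (hΦ.muDecay_twisted j) w).const_mul (w k)
    refine (h1.add (integrable_finsetSum Finset.univ fun k _ => h2 k)).congr
      (Eventually.of_forall fun x => ?_)
    simp only [Fin.sum_univ_three, Pi.add_apply]
    ring
  have := sum_integral_twisted_mul hγ₁ hγ₂ hΦ w
  rw [← integral_finsetSum _ fun j _ => n3 j] at this
  simp only [← Finset.sum_mul]
  rw [integral_mul_const, integral_mul_const, this]

lemma muDecay₁_mu : MuDecay₁ mu := by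
  refine ⟨contDiff_mu.of_le (by simp), 2 * 24 ^ 3, fun v => ?_⟩
  have h1 := sqrtMu_pos v
  have h2 : (1 + ‖v‖) * sqrtMu v ≤ 2 * 24 ^ 3 := by
    have h6 := (sqrtMu_mul_pow_le v).trans (mul_le_of_le_one_right (by norm_num) (gau_le_one v))
    have h7 : 1 + ‖v‖ ≤ 2 * (1 + ‖v‖ ^ 2) ^ 3 := by
      have : (1 + ‖v‖ ^ 2) ^ 1 ≤ (1 + ‖v‖ ^ 2) ^ 3 :=
        pow_le_pow_right₀ (by nlinarith [sq_nonneg ‖v‖]) (by norm_num)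
      nlinarith [sq_nonneg (‖v‖ - 1)]
    nlinarith [mul_le_mul_of_nonneg_right h7 h1.le]
  have h3 : (1 + ‖v‖) * mu v ≤ 2 * 24 ^ 3 * sqrtMu v := by
    rw [← sqrtMu_mul_self, ← mul_assoc]; gcongr
  have h4 := mu_pos v
  have h5 : 0 ≤ ‖v‖ * mu v := by positivity
  constructor
  · rw [abs_of_pos h4]; linarith
  · intro k
    rw [fderiv_mu, abs_neg, abs_mul, abs_of_pos h4]
    have := mul_le_mul_of_nonneg_right (abs_apply_le v k) h4.le
    linarith

lemma muDecay_coord_mu (k : Fin 3) : MuDecay fun w => w k * mu w := by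
  have := (muDecay₁_mu.muDecay_fderiv k).const_mul (-1)
  simpa only [fderiv_mu, neg_mul_neg, one_mul] using this

/-- The divergence of `ā v`, in weak form. -/
theorem sum_integral_aBar_mul_fderiv (hγ₁ : -3 < γ) (hγ₂ : γ < 0) {Ψ : V3 → ℝ}
    (hΨ : MuDecay₁ Ψ) :
    ∑ j, ∫ v, (∑ k, aBar γ j k v * v k) * fderiv ℝ Ψ v (basisVec j)
      = - ∫ v, (2 * (3 + γ) * ∫ w, ‖v - w‖ ^ γ * mu w) * Ψ v := by
  -- The degeneracy a(v - w)(v - w) = 0 moves the factor v under the integral as w, where w μ(w) =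
  -- -∇μ(w). So one divergence can be taken in v and a second one in w, against μ.
  have hA : ∀ j v, ∑ k, aBar γ j k v * v k = ∫ w, ∑ k, aCoef γ j k (v - w) * (w k * mu w) := by
    intro j v
    have i1 := fun k => (integrable_aCoef_mul_mu hγ₁ hγ₂ j k v).mul_const (v k)
    simp only [aBar, ← integral_mul_const]
    rw [← integral_finsetSum _ fun k _ => i1 k]
    congr 1
    funext w
    have := sum_aCoef_sub_mul γ j v w
    calc _ = (∑ k, aCoef γ j k (v - w) * v k) * mu w := by
          rw [Finset.sum_mul]; exact Finset.sum_congr rfl fun k _ => by ring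
      _ = _ := by
          rw [← this, Finset.sum_mul]; exact Finset.sum_congr rfl fun k _ => by ring
  have iA : ∀ j k, Integrable (fun x : V3 × V3 => aCoef γ j k (x.1 - x.2)
      * fderiv ℝ Ψ x.1 (basisVec j) * (x.2 k * mu x.2)) (volume.prod volume) := fun j k =>
    (isKernel_aCoef hγ₂ j k).integrable_prod hγ₁ hγ₂ (hΨ.muDecay_fderiv j) (muDecay_coord_mu k)
  have iC : ∀ k, Integrable (fun x : V3 × V3 => 2 * ((x.1 - x.2) k * ‖x.1 - x.2‖ ^ γ * Ψ x.1
      * (x.2 k * mu x.2))) (volume.prod volume) := fun k =>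
    ((isKernel_coord_mul_rpow hγ₂ k).integrable_prod hγ₁ hγ₂ hΨ.muDecay
      (muDecay_coord_mu k)).const_mul 2
  have e1 : ∀ j, ∫ v, (∑ k, aBar γ j k v * v k) * fderiv ℝ Ψ v (basisVec j)
      = ∫ x : V3 × V3, (∑ k, aCoef γ j k (x.1 - x.2)
      * fderiv ℝ Ψ x.1 (basisVec j) * (x.2 k * mu x.2)) ∂(volume.prod volume) := by
    intro j
    rw [integral_prod _ (integrable_finsetSum _ fun k _ => iA j k)]
    congr 1
    funext v
    rw [hA, ← integral_mul_const]
    congr 1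
    funext w
    rw [Finset.sum_mul]
    exact Finset.sum_congr rfl fun k _ => by ring
  have e2 : ∫ x : V3 × V3, (∑ j, ∑ k, aCoef γ j k (x.1 - x.2)
      * fderiv ℝ Ψ x.1 (basisVec j) * (x.2 k * mu x.2)) ∂(volume.prod volume)
      = ∫ x : V3 × V3, (∑ k, 2 * ((x.1 - x.2) k * ‖x.1 - x.2‖ ^ γ * Ψ x.1
      * (x.2 k * mu x.2))) ∂(volume.prod volume) := by
    rw [integral_prod_symm _ (integrable_finsetSum _ fun j _ => integrable_finsetSum _
      fun k _ => iA j k), integral_prod_symm _ (integrable_finsetSum _ fun k _ => iC k)]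
    congr 1
    funext w
    have a1 : ∀ j k, Integrable fun v => aCoef γ j k (v - w) * fderiv ℝ Ψ v (basisVec j) :=
      fun j k => (isKernel_aCoef hγ₂ j k).integrable_mul' hγ₁ hγ₂ (hΨ.muDecay_fderiv j) w
    have c1 : ∀ k, Integrable fun v => (v - w) k * ‖v - w‖ ^ γ * Ψ v :=
      fun k => (isKernel_coord_mul_rpow hγ₂ k).integrable_mul' hγ₁ hγ₂ hΨ.muDecay w
    dsimp only
    rw [integral_finsetSum _ fun j _ => integrable_finsetSum _ fun k _ =>
        (a1 j k).mul_const (w k * mu w),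
      Finset.sum_congr rfl fun j _ => integral_finsetSum _ fun k _ =>
        (a1 j k).mul_const (w k * mu w),
      Finset.sum_comm,
      integral_finsetSum _ fun k _ => ((c1 k).mul_const (w k * mu w)).const_mul 2]
    refine Finset.sum_congr rfl fun k _ => ?_
    simp only [integral_mul_const]
    rw [← Finset.sum_mul, sum_integral_aCoef_mul_fderiv' hγ₁ hγ₂ hΨ.gaussDecay,
      ← integral_mul_const]
    congr 1
    funext v
    ring
  rw [Finset.sum_congr rfl fun j _ => e1 j,
    ← integral_finsetSum _ fun j _ => integrable_finsetSum _ fun k _ => iA j k, e2,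
    integral_prod _ (integrable_finsetSum _ fun k _ => iC k), ← integral_neg]
  congr 1
  funext v
  have d1 : ∀ k, Integrable fun w => (v - w) k * ‖v - w‖ ^ γ * fderiv ℝ mu w (basisVec k) :=
    fun k => (isKernel_coord_mul_rpow hγ₂ k).integrable_mul hγ₁ hγ₂ (muDecay₁_mu.muDecay_fderiv k) v
  have key := sum_integral_coord_mul_fderiv hγ₁ hγ₂ muDecay₁_mu.gaussDecay v
  rw [← integral_finsetSum _ fun k _ => d1 k] at key
  calc _ = ∫ w, (-2 * Ψ v) * ∑ k, (v - w) k * ‖v - w‖ ^ γ * fderiv ℝ mu w (basisVec k) := by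
        congr 1; funext w
        simp only [fderiv_mu, Finset.mul_sum]
        exact Finset.sum_congr rfl fun k _ => by ring
    _ = _ := by
        rw [integral_const_mul, key]
        simp only [mul_assoc, integral_const_mul]
        ring

end Landau

/-! ### Measurable Cholesky factor of the averaged matrix -/

namespace Landau

section Cholesky

/-- The Cholesky factor of the symmetric matrix with upper triangle `a b c / d e f`. -/
noncomputable def cholesky (a b c d e f : ℝ) : Matrix (Fin 3) (Fin 3) ℝ :=
  let s₁ := √a
  let s₂ := √(d - (b / s₁) ^ 2)
  let t := (e - b / s₁ * (c / s₁)) / s₂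
  !![s₁, b / s₁, c / s₁; 0, s₂, t; 0, 0, √(f - (c / s₁) ^ 2 - t ^ 2)]

/-- The inverse of an upper triangular matrix. -/
noncomputable def triInv (S : Matrix (Fin 3) (Fin 3) ℝ) : Matrix (Fin 3) (Fin 3) ℝ :=
  !![(S 0 0)⁻¹, -(S 0 1) / (S 0 0 * S 1 1),
      (S 0 1 * S 1 2 - S 0 2 * S 1 1) / (S 0 0 * S 1 1 * S 2 2);
    0, (S 1 1)⁻¹, -(S 1 2) / (S 1 1 * S 2 2); 0, 0, (S 2 2)⁻¹]

/-- The pivots are values of the quadratic form at suitable vectors, hence positive. The factor is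
written out explicitly so that its measurable dependence on the entries is evident. -/
lemma cholesky_spec {a b c d e f : ℝ} (h : ∀ x y z : ℝ, (x ≠ 0 ∨ y ≠ 0 ∨ z ≠ 0) →
    0 < a * x ^ 2 + 2 * b * x * y + 2 * c * x * z + d * y ^ 2 + 2 * e * y * z + f * z ^ 2) :
    (cholesky a b c d e f).transpose * cholesky a b c d e f = !![a, b, c; b, d, e; c, e, f] ∧
      triInv (cholesky a b c d e f) * cholesky a b c d e f = 1 := by
  have ha : 0 < a := by simpa using h 1 0 0 (by simp)
  set s₁ := √a with hs₁
  have h1 : 0 < s₁ := Real.sqrt_pos.2 ha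
  have h1' : s₁ ^ 2 = a := Real.sq_sqrt ha.le
  set u := b / s₁ with hu
  set w := c / s₁ with hw
  have hu' : s₁ * u = b := by rw [hu]; field_simp
  have hw' : s₁ * w = c := by rw [hw]; field_simp
  have hd : 0 < d - u ^ 2 := by
    -- This x minimizes the form for y = 1, z = 0, and the minimum is the second pivot d - u².
    have := h (-u / s₁) 1 0 (by simp)
    rw [← h1', ← hu', ← hw'] at this
    convert this using 1
    field_simp
    ring
  set s₂ := √(d - u ^ 2) with hs₂
  have h2 : 0 < s₂ := Real.sqrt_pos.2 hd
  have h2' : s₂ ^ 2 = d - u ^ 2 := Real.sq_sqrt hd.le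
  set t := (e - u * w) / s₂ with ht
  have ht' : s₂ * t = e - u * w := by rw [ht]; field_simp
  have hf : 0 < f - w ^ 2 - t ^ 2 := by
    -- Minimizing over x and y for z = 1 gives the third pivot.
    have := h (-(u * (-t / s₂) + w) / s₁) (-t / s₂) 1 (by simp)
    have hd' : d = s₂ ^ 2 + u ^ 2 := by linarith
    have he' : e = s₂ * t + u * w := by linarith
    rw [← h1', ← hu', ← hw', hd', he'] at this
    convert this using 1
    field_simp
    ring
  set s₃ := √(f - w ^ 2 - t ^ 2) with hs₃
  have h3 : 0 < s₃ := Real.sqrt_pos.2 hf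
  have h3' : s₃ ^ 2 = f - w ^ 2 - t ^ 2 := Real.sq_sqrt hf.le
  have hS : cholesky a b c d e f = !![s₁, u, w; 0, s₂, t; 0, 0, s₃] := rfl
  rw [hS]
  constructor
  · ext i j
    fin_cases i <;> fin_cases j <;>
      simp [Matrix.mul_apply, Fin.sum_univ_three, Matrix.transpose_apply] <;> nlinarith
  · ext i j
    fin_cases i <;> fin_cases j <;>
      simp [Matrix.mul_apply, Fin.sum_univ_three, triInv, h1.ne', h2.ne',
        h3.ne'] <;> field_simp <;> ring

end Cholesky

/-- The action of a matrix on `ℝ³`. -/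
noncomputable abbrev mv (A : Matrix (Fin 3) (Fin 3) ℝ) : V3 →ₗ[ℝ] V3 := Matrix.toEuclideanLin A

lemma mv_coord (A : Matrix (Fin 3) (Fin 3) ℝ) (ξ : V3) (i : Fin 3) :
    mv A ξ i = ∑ j, A i j * ξ j := rfl

lemma mv_mv (A B : Matrix (Fin 3) (Fin 3) ℝ) (ξ : V3) : mv A (mv B ξ) = mv (A * B) ξ := by
  simp [mv, Matrix.toLpLin_apply, Matrix.mulVec_mulVec]

lemma mv_one (ξ : V3) : mv 1 ξ = ξ := by simp [mv]

/-- A measurable factorization `ā = SᵀS`, with inverse `R` of `S` and polynomial bounds. -/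
structure Root (γ : ℝ) where
  /-- the factor -/
  S : V3 → Matrix (Fin 3) (Fin 3) ℝ
  /-- its inverse -/
  R : V3 → Matrix (Fin 3) (Fin 3) ℝ
  /-- the constant in the bounds -/
  C : ℝ
  measurable_S : ∀ i j, Measurable fun v => S v i j
  measurable_R : ∀ i j, Measurable fun v => R v i j
  gram : ∀ v j k, ∑ i, S v i j * S v i k = aBar γ j k v
  R_mul_S : ∀ v, R v * S v = 1
  C_nonneg : 0 ≤ C
  abs_S_le : ∀ v i j, |S v i j| ≤ C * (1 + ‖v‖)
  abs_R_le : ∀ v i j, |R v i j| ≤ C * (2 + ‖v‖) ^ 2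

lemma norm_sq_mv_of_gram {γ : ℝ} {v : V3} {S : Matrix (Fin 3) (Fin 3) ℝ}
    (h : ∀ j k, ∑ i, S i j * S i k = aBar γ j k v) (ξ η : V3) :
    inner ℝ (mv S ξ) (mv S η) = ∑ j, ∑ k, aBar γ j k v * ξ j * η k := by
  simp only [← h, PiLp.inner_apply, mv_coord, RCLike.inner_apply, conj_trivial,
    Fin.sum_univ_three]
  ring

/-- Upper bounds of ā control S and the lower bound of ā controls S⁻¹. Polynomial growth suffices,
since these matrices are later used on balls or against Gaussians; only for S is the linear rate
essential, in the cutoff argument. -/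
theorem nonempty_root {γ : ℝ} (hγ₁ : -3 < γ) (hγ₂ : γ < 0) : Nonempty (Root γ) := by
  obtain ⟨C, hC, hub⟩ := exists_abs_aBar_le hγ₁ hγ₂
  obtain ⟨c, hc, hlb⟩ := exists_aBar_lower hγ₁ hγ₂
  set S : V3 → Matrix (Fin 3) (Fin 3) ℝ := fun v => cholesky (aBar γ 0 0 v) (aBar γ 0 1 v)
    (aBar γ 0 2 v) (aBar γ 1 1 v) (aBar γ 1 2 v) (aBar γ 2 2 v) with hS
  have hspec : ∀ v, _ := fun v => cholesky_spec (a := aBar γ 0 0 v) (b := aBar γ 0 1 v)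
    (c := aBar γ 0 2 v) (d := aBar γ 1 1 v) (e := aBar γ 1 2 v) (f := aBar γ 2 2 v) (by
      intro x y z hxyz
      have h1 := hlb !₂[x, y, z] v
      have h2 : 0 < ‖(!₂[x, y, z] : V3)‖ := by
        rw [norm_pos_iff]
        intro h0
        have e0 := congrArg (fun w : V3 => w 0) h0
        have e1 := congrArg (fun w : V3 => w 1) h0
        have e2 := congrArg (fun w : V3 => w 2) h0
        simp at e0 e1 e2
        simp [e0, e1, e2] at hxyz
      have h3 : 0 < c * (2 + ‖v‖) ^ γ * ‖(!₂[x, y, z] : V3)‖ ^ 2 := by positivity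
      refine h3.trans_le (h1.trans_eq ?_)
      simp [Fin.sum_univ_three, aBar_symm γ 1 0 v, aBar_symm γ 2 0 v, aBar_symm γ 2 1 v]
      ring)
  have hgram : ∀ v j k, ∑ i, S v i j * S v i k = aBar γ j k v := by
    intro v j k
    have := congrFun (congrFun (hspec v).1 j) k
    rw [Matrix.mul_apply] at this
    simp only [Matrix.transpose_apply] at this
    rw [this]
    fin_cases j <;> fin_cases k <;> simp [aBar_symm γ 1 0 v, aBar_symm γ 2 0 v, aBar_symm γ 2 1 v]
  have hm := measurable_aBar γ
  have hSm : ∀ i j, Measurable fun v => S v i j := by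
    intro i j
    fin_cases i <;> fin_cases j <;> simp [hS, cholesky] <;> fun_prop
  have hRm : ∀ i j, Measurable fun v => triInv (S v) i j := by
    intro i j
    fin_cases i <;> fin_cases j <;> simp [triInv] <;> fun_prop
  have hSR : ∀ v, S v * triInv (S v) = 1 := fun v => mul_eq_one_comm.1 (hspec v).2
  have hSb : ∀ v i j, |S v i j| ≤ √C * (1 + ‖v‖) := by
    intro v i j
    refine abs_le_of_sq_le_sq ?_ (by positivity)
    -- A diagonal entry of SᵀS is the squared length of a column of S.
    have h1 : S v i j ^ 2 ≤ aBar γ j j v := by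
      rw [← hgram v j j]
      simp only [← sq]
      exact Finset.single_le_sum (f := fun i => S v i j ^ 2) (fun i _ => sq_nonneg _)
        (Finset.mem_univ i)
    have h2 := (le_abs_self _).trans (hub j j v)
    rw [mul_pow, Real.sq_sqrt hC]
    nlinarith [mul_nonneg hC (norm_nonneg v)]
  have hRb : ∀ v i j, |triInv (S v) i j| ≤ √(c⁻¹) * (2 + ‖v‖) ^ 2 := by
    intro v i j
    refine abs_le_of_sq_le_sq ?_ (by positivity)
    -- The j-th column ξ of S⁻¹ satisfies |Sξ| = 1, so the lower bound of the form gives c(2 +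
    -- |v|)^γ|ξ|² ≤ 1. As γ ≥ -4, this yields the exponent 4 for |ξ|², that is 2 for |ξ|.
    set ξ : V3 := mv (triInv (S v)) (basisVec j) with hξ
    have e1 : ξ i = triInv (S v) i j := by
      rw [hξ, mv_coord]; simp [basisVec, PiLp.single_apply]
    have e2 : mv (S v) ξ = basisVec j := by rw [hξ, mv_mv, hSR, mv_one]
    have h1 := hlb ξ v
    rw [← norm_sq_mv_of_gram (hgram v), e2, real_inner_self_eq_norm_sq] at h1
    have e3 : ‖basisVec j‖ = 1 := by simp [basisVec]
    rw [e3] at h1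
    have h2 : (ξ i) ^ 2 ≤ ‖ξ‖ ^ 2 := by
      rw [← sq_abs (ξ i)]; gcongr; exact abs_apply_le _ _
    have h3 : (0 : ℝ) < (2 + ‖v‖) := by positivity
    have h4 : (1 : ℝ) ≤ (2 + ‖v‖) ^ γ * (2 + ‖v‖) ^ (4 : ℕ) := by
      rw [← Real.rpow_natCast, ← Real.rpow_add h3]
      exact Real.one_le_rpow (by linarith [norm_nonneg v]) (by push_cast; linarith)
    rw [e1] at h2
    rw [mul_pow, Real.sq_sqrt (by positivity), ← pow_mul, show 2 * 2 = 4 from rfl]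
    have h5 : c * ‖ξ‖ ^ 2 ≤ (2 + ‖v‖) ^ 4 := by
      have hp : 0 < (2 + ‖v‖) ^ 4 := by positivity
      calc c * ‖ξ‖ ^ 2 ≤ c * ‖ξ‖ ^ 2 * ((2 + ‖v‖) ^ γ * (2 + ‖v‖) ^ (4 : ℕ)) :=
            le_mul_of_one_le_right (by positivity) h4
        _ = (c * (2 + ‖v‖) ^ γ * ‖ξ‖ ^ 2) * (2 + ‖v‖) ^ 4 := by ring
        _ ≤ 1 ^ 2 * (2 + ‖v‖) ^ 4 := mul_le_mul_of_nonneg_right h1 hp.le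
        _ = _ := by ring
    rw [inv_mul_eq_div, le_div_iff₀ hc]
    nlinarith
  refine ⟨⟨S, fun v => triInv (S v), max √C √(c⁻¹), hSm, hRm, hgram, fun v => (hspec v).2,
    by positivity, fun v i j => (hSb v i j).trans ?_, fun v i j => (hRb v i j).trans ?_⟩⟩
  · exact mul_le_mul_of_nonneg_right (le_max_left _ _) (by positivity)
  · exact mul_le_mul_of_nonneg_right (le_max_right _ _) (by positivity)

end Landau

/-! ### Test functions and weak gradients -/

namespace Landau

open Filter Topology

lemma IsTest.continuous {φ : V3 → ℝ} (hφ : IsTest φ) : Continuous φ := hφ.1.continuous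

lemma IsTest.fderiv_apply {φ : V3 → ℝ} (hφ : IsTest φ) (e : V3) :
    IsTest fun v => fderiv ℝ φ v e :=
  ⟨(hφ.1.fderiv_right (m := ∞) (by simp)).clm_apply contDiff_const, hφ.2.fderiv_apply ℝ e⟩

lemma IsTest.mul_left {φ ψ : V3 → ℝ} (hφ : IsTest φ) (hψ : ContDiff ℝ ∞ ψ) :
    IsTest fun v => ψ v * φ v :=
  ⟨hψ.mul hφ.1, hφ.2.mul_left⟩

lemma IsTest.add {φ ψ : V3 → ℝ} (hφ : IsTest φ) (hψ : IsTest ψ) :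
    IsTest fun v => φ v + ψ v :=
  ⟨hφ.1.add hψ.1, hφ.2.add hψ.2⟩

lemma contDiff_top_coord (j : Fin 3) : ContDiff ℝ ∞ fun z : V3 => z j :=
  (EuclideanSpace.proj (𝕜 := ℝ) j).contDiff

lemma IsTest.integrable_mul {φ f : V3 → ℝ} (hφ : IsTest φ) (hf : LocallyIntegrable f volume) :
    Integrable fun v => f v * φ v := by
  simpa only [smul_eq_mul] using
    hf.integrable_smul_right_of_hasCompactSupport hφ.continuous hφ.2

lemma locallyIntegrable_coord {G : V3 → V3} (hG : LocallyIntegrable G volume) (j : Fin 3) :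
    LocallyIntegrable (fun v => G v j) volume := by
  rw [locallyIntegrable_iff] at hG ⊢
  exact fun K hK => (EuclideanSpace.proj (𝕜 := ℝ) j).integrable_comp (hG K hK)

/-- Continuous functions are locally integrable against locally integrable ones. -/
lemma LocallyIntegrable.continuous_mul' {f ψ : V3 → ℝ} (hf : LocallyIntegrable f volume)
    (hψ : Continuous ψ) : LocallyIntegrable (fun v => ψ v * f v) volume := by
  rw [locallyIntegrable_iff] at hf ⊢
  exact fun K hK => (hf K hK).continuousOn_mul hψ.continuousOn hK

lemma HasWeakGradient.congr_ae {f f' : V3 → ℝ} {G G' : V3 → V3} (h : HasWeakGradient f G)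
    (hf : f =ᵐ[volume] f') (hG : G =ᵐ[volume] G') : HasWeakGradient f' G' := by
  refine ⟨h.1.congr hf, h.2.1.congr hG, fun φ hφ j => ?_⟩
  have e1 : ∫ v, f' v * fderiv ℝ φ v (basisVec j) = ∫ v, f v * fderiv ℝ φ v (basisVec j) := by
    refine integral_congr_ae ?_
    filter_upwards [hf] with v hv
    rw [hv]
  have e2 : ∫ v, G' v j * φ v = ∫ v, G v j * φ v := by
    refine integral_congr_ae ?_
    filter_upwards [hG] with v hv
    rw [hv]
  rw [e1, e2, h.2.2 φ hφ j]

lemma HasWeakGradient.unique {f : V3 → ℝ} {G G' : V3 → V3} (h : HasWeakGradient f G)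
    (h' : HasWeakGradient f G') : G =ᵐ[volume] G' := by
  have : ∀ j, ∀ᵐ v, G v j = G' v j := by
    intro j
    refine ae_eq_of_integral_contDiff_smul_eq (locallyIntegrable_coord h.2.1 j)
      (locallyIntegrable_coord h'.2.1 j) fun φ h1 h2 => ?_
    have e := h.2.2 φ ⟨h1, h2⟩ j
    rw [h'.2.2 φ ⟨h1, h2⟩ j] at e
    simpa only [smul_eq_mul, mul_comm (φ _), neg_inj, eq_comm] using e
  filter_upwards [ae_all_iff.2 this] with v hv
  exact PiLp.ext hv

lemma HasWeakGradient.weakGrad_ae_eq {f : V3 → ℝ} {G : V3 → V3} (h : HasWeakGradient f G) :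
    weakGrad f =ᵐ[volume] G := by
  have hex : ∃ G, HasWeakGradient f G := ⟨G, h⟩
  rw [weakGrad, dif_pos hex]
  exact hex.choose_spec.unique h

/-- The classical gradient, as a vector field. -/
noncomputable def grad (f : V3 → ℝ) (v : V3) : V3 :=
  WithLp.toLp 2 fun j => fderiv ℝ f v (basisVec j)

lemma grad_coord (f : V3 → ℝ) (v : V3) (j : Fin 3) : grad f v j = fderiv ℝ f v (basisVec j) := rfl

lemma continuous_grad {f : V3 → ℝ} (hf : ContDiff ℝ 1 f) : Continuous (grad f) := by
  refine (PiLp.continuous_toLp 2 _).comp (continuous_pi fun j => ?_)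
  exact (hf.continuous_fderiv one_ne_zero).clm_apply continuous_const

lemma hasWeakGradient_grad {f : V3 → ℝ} (hf : ContDiff ℝ 1 f) : HasWeakGradient f (grad f) := by
  refine ⟨hf.continuous.locallyIntegrable, (continuous_grad hf).locallyIntegrable,
    fun φ hφ j => ?_⟩
  simp only [grad_coord]
  have hc : Continuous fun v => fderiv ℝ f v (basisVec j) :=
    (hf.continuous_fderiv one_ne_zero).clm_apply continuous_const
  exact integral_mul_fderiv_eq_neg_fderiv_mul_of_integrable
    (hφ.integrable_mul hc.locallyIntegrable)
    ((hφ.fderiv_apply _).integrable_mul hf.continuous.locallyIntegrable)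
    (hφ.integrable_mul hf.continuous.locallyIntegrable)
    (fun v _ => hf.differentiable one_ne_zero v)
    (fun v _ => hφ.1.differentiable (by simp) v)

lemma HasWeakGradient.mul_smooth {f ψ : V3 → ℝ} {G : V3 → V3} (h : HasWeakGradient f G)
    (hψ : ContDiff ℝ ∞ ψ) :
    HasWeakGradient (fun v => ψ v * f v) (fun v => ψ v • G v + f v • grad ψ v) := by
  have hg : Continuous (grad ψ) := continuous_grad (hψ.of_le (by simp))
  refine ⟨LocallyIntegrable.continuous_mul' h.1 hψ.continuous, ?_, fun φ hφ j => ?_⟩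
  · refine LocallyIntegrable.add ?_ ?_
    · have := h.2.1
      rw [locallyIntegrable_iff] at this ⊢
      exact fun K hK => (this K hK).continuousOn_smul hψ.continuous.continuousOn hK
    · have := h.1
      rw [locallyIntegrable_iff] at this ⊢
      exact fun K hK => (this K hK).smul_continuousOn hg.continuousOn hK
  · have e := h.2.2 _ (hφ.mul_left hψ) j
    have hd : ∀ v, fderiv ℝ (fun v => ψ v * φ v) v (basisVec j)
        = ψ v * fderiv ℝ φ v (basisVec j) + fderiv ℝ ψ v (basisVec j) * φ v := by
      intro v
      rw [fderiv_fun_mul (hψ.differentiable (by simp) v) (hφ.1.differentiable (by simp) v)]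
      simp only [_root_.add_apply, _root_.smul_apply, smul_eq_mul]
      ring
    have i1 : Integrable fun v => f v * (ψ v * fderiv ℝ φ v (basisVec j)) :=
      ((hφ.fderiv_apply _).mul_left hψ).integrable_mul h.1
    have i2 : Integrable fun v => f v * (fderiv ℝ ψ v (basisVec j) * φ v) :=
      (hφ.mul_left ((hψ.fderiv_right (m := ∞) (by simp)).clm_apply
        contDiff_const)).integrable_mul h.1
    have i3 : Integrable fun v => G v j * (ψ v * φ v) :=
      (hφ.mul_left hψ).integrable_mul (locallyIntegrable_coord h.2.1 j)
    simp only [hd, mul_add] at e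
    rw [integral_add i1 i2] at e
    have e3 : ∫ v, (ψ v • G v + f v • grad ψ v) j * φ v
        = (∫ v, G v j * (ψ v * φ v)) + ∫ v, f v * (fderiv ℝ ψ v (basisVec j) * φ v) := by
      rw [← integral_add i3 i2]
      congr 1; funext v
      simp only [PiLp.add_apply, PiLp.smul_apply, smul_eq_mul, grad_coord]
      ring
    have e4 : ∫ v, ψ v * f v * fderiv ℝ φ v (basisVec j)
        = ∫ v, f v * (ψ v * fderiv ℝ φ v (basisVec j)) := by
      congr 1; funext v; ring
    rw [e3, e4]
    linarith

/-- Bounded, compactly supported functions are square integrable. -/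
lemma memLp_of_bounded {E : Type*} [NormedAddCommGroup E] {g : V3 → E} {C r : ℝ}
    (hg : AEStronglyMeasurable g volume) (hC : ∀ v, ‖g v‖ ≤ C)
    (hr : ∀ v, r < ‖v‖ → g v = 0) : MemLp g 2 volume := by
  have h1 : MemLp ((Metric.closedBall (0 : V3) r).indicator fun _ => C) 2 volume :=
    memLp_indicator_const 2 measurableSet_closedBall C
      (Or.inr (isCompact_closedBall _ _).measure_lt_top.ne)
  refine h1.mono hg (Eventually.of_forall fun v => ?_)
  by_cases hv : v ∈ Metric.closedBall (0 : V3) r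
  · rw [indicator_of_mem hv]
    exact (hC v).trans (le_abs_self C)
  · rw [hr v (by simpa using hv)]
    simp

lemma exists_radius {E : Type*} [Zero E] {φ : V3 → E} (hφ : HasCompactSupport φ) :
    ∃ r, 0 < r ∧ ∀ v, r < ‖v‖ → φ v = 0 := by
  obtain ⟨r, hr0, hr⟩ := hφ.isCompact.isBounded.subset_closedBall_lt 0 0
  refine ⟨r, hr0, fun v hv => ?_⟩
  by_contra h
  have := hr (subset_tsupport _ h)
  simp at this
  linarith

lemma IsTest.exists_bound {φ : V3 → ℝ} (hφ : IsTest φ) : ∃ C, 0 ≤ C ∧ ∀ v, |φ v| ≤ C := by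
  obtain ⟨C, hC⟩ := hφ.continuous.bounded_above_of_compact_support hφ.2
  exact ⟨C, (norm_nonneg _).trans (hC 0), hC⟩

lemma IsTest.memLp {φ : V3 → ℝ} (hφ : IsTest φ) : MemLp φ 2 volume :=
  hφ.continuous.memLp_of_hasCompactSupport hφ.2

lemma aestronglyMeasurable_mv {A : V3 → Matrix (Fin 3) (Fin 3) ℝ} {z : V3 → V3}
    (hA : ∀ i j, Measurable fun v => A v i j) (hz : AEStronglyMeasurable z volume) :
    AEStronglyMeasurable (fun v => mv (A v) (z v)) volume := by
  have h1 : ∀ i, AEMeasurable (fun v => mv (A v) (z v) i) volume := by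
    intro i
    simp only [mv_coord]
    refine Finset.aemeasurable_fun_sum _ fun j _ => (hA i j).aemeasurable.mul ?_
    exact (EuclideanSpace.proj (𝕜 := ℝ) j).continuous.measurable.comp_aemeasurable hz.aemeasurable
  have h2 : AEMeasurable (fun v => WithLp.toLp 2 fun i => mv (A v) (z v) i) volume :=
    (WithLp.measurable_toLp 2 _).comp_aemeasurable (aemeasurable_pi_lambda _ h1)
  exact h2.aestronglyMeasurable

lemma norm_le_sum_abs (ξ : V3) : ‖ξ‖ ≤ ∑ i, |ξ i| := by
  refine abs_le_of_sq_le_sq' ?_ (by positivity) |>.2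
  rw [norm_sq_eq_sum, Fin.sum_univ_three, ← sq_abs (ξ 0), ← sq_abs (ξ 1),
    ← sq_abs (ξ 2)]
  have := abs_nonneg (ξ 0)
  have := abs_nonneg (ξ 1)
  have := abs_nonneg (ξ 2)
  nlinarith [mul_nonneg (abs_nonneg (ξ 0)) (abs_nonneg (ξ 1)),
    mul_nonneg (abs_nonneg (ξ 0)) (abs_nonneg (ξ 2)),
    mul_nonneg (abs_nonneg (ξ 1)) (abs_nonneg (ξ 2))]

lemma norm_mv_le {A : Matrix (Fin 3) (Fin 3) ℝ} {c : ℝ} (hA : ∀ i j, |A i j| ≤ c) (ξ : V3) :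
    ‖mv A ξ‖ ≤ 9 * c * ‖ξ‖ := by
  have h1 : ∀ i, |mv A ξ i| ≤ 3 * c * ‖ξ‖ := by
    intro i
    rw [mv_coord]
    refine (Finset.abs_sum_le_sum_abs _ _).trans ?_
    have : ∀ j ∈ Finset.univ, |A i j * ξ j| ≤ c * ‖ξ‖ := fun j _ => by
      rw [abs_mul]
      exact mul_le_mul (hA i j) (abs_apply_le ξ j) (abs_nonneg _) ((abs_nonneg _).trans (hA i j))
    refine (Finset.sum_le_sum this).trans ?_
    simp
    linarith
  refine (norm_le_sum_abs _).trans ((Finset.sum_le_sum fun i _ => h1 i).trans ?_)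
  simp
  linarith

end Landau

/-! ### The energy space as a closed subspace of L² × L² -/

namespace Landau

open Filter Topology

/-- Square integrable vector fields on `ℝ³`. -/
abbrev LV : Type := Lp V3 2 (volume : Measure V3)

/-- Pairs of a square integrable function and a square integrable vector field. -/
abbrev Pair : Type := WithLp 2 (L2 × LV)

variable {γ : ℝ} (ρ : Root γ)

lemma Root.S_mul_R (v : V3) : ρ.S v * ρ.R v = 1 := mul_eq_one_comm.1 (ρ.R_mul_S v)

/-- The gradient of `f`, where `u = (f, S (∇f + v f / 2))`. -/
noncomputable def gradOf (u : Pair) (v : V3) : V3 :=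
  mv (ρ.R v) (u.snd v) - ((1 / 2 : ℝ) * u.fst v) • v

lemma gradOf_coord (u : Pair) (v : V3) (j : Fin 3) :
    gradOf ρ u v j = mv (ρ.R v) (u.snd v) j - 1 / 2 * u.fst v * v j := by
  simp [gradOf]

lemma locallyIntegrable_L2 (f : L2) : LocallyIntegrable f volume :=
  (Lp.memLp f).locallyIntegrable (by norm_num)

lemma locallyIntegrable_gradOf (u : Pair) : LocallyIntegrable (gradOf ρ u) volume := by
  refine LocallyIntegrable.sub ?_ ?_
  · have h1 : LocallyIntegrable u.snd volume := (Lp.memLp u.snd).locallyIntegrable (by norm_num)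
    rw [locallyIntegrable_iff] at h1 ⊢
    intro K hK
    obtain ⟨r, hr0, hr⟩ := hK.isBounded.subset_closedBall_lt 0 0
    refine Integrable.mono' ((h1 K hK).norm.const_mul (9 * (ρ.C * (2 + r) ^ 2)))
      (aestronglyMeasurable_mv ρ.measurable_R
        (Lp.aestronglyMeasurable u.snd)).restrict ?_
    refine (ae_restrict_mem hK.measurableSet).mono fun v hv => ?_
    refine norm_mv_le (fun i j => (ρ.abs_R_le v i j).trans ?_) _
    have := hr hv
    simp only [Metric.mem_closedBall, dist_zero_right] at this
    have := ρ.C_nonneg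
    gcongr
  · have h1 := locallyIntegrable_L2 u.fst
    rw [locallyIntegrable_iff] at h1 ⊢
    intro K hK
    have h2 : IntegrableOn (fun v => (1 / 2 : ℝ) * u.fst v) K := (h1 K hK).const_mul (1 / 2)
    exact h2.smul_continuousOn continuousOn_id hK

/-- The first component of the functional that expresses the weak gradient. -/
noncomputable def testFst (φ : V3 → ℝ) (j : Fin 3) (v : V3) : ℝ :=
  fderiv ℝ φ v (basisVec j) + -(1 / 2 * v j) * φ v

/-- The second component of the functional that expresses the weak gradient. -/
noncomputable def testSnd (φ : V3 → ℝ) (j : Fin 3) (v : V3) : V3 :=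
  φ v • WithLp.toLp 2 (ρ.R v j)

lemma isTest_testFst {φ : V3 → ℝ} (hφ : IsTest φ) (j : Fin 3) : IsTest (testFst φ j) :=
  (hφ.fderiv_apply _).add (hφ.mul_left (contDiff_const.mul (contDiff_top_coord j)).neg)

lemma memLp_testSnd {φ : V3 → ℝ} (hφ : IsTest φ) (j : Fin 3) :
    MemLp (testSnd ρ φ j) 2 volume := by
  obtain ⟨C, hC0, hC⟩ := hφ.exists_bound
  obtain ⟨r, hr0, hr⟩ := exists_radius hφ.2
  have h0 := ρ.C_nonneg
  refine memLp_of_bounded (C := C * (3 * (ρ.C * (2 + r) ^ 2))) (r := r) ?_ (fun v => ?_)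
    (fun v hv => by rw [testSnd, hr v hv, zero_smul])
  · refine hφ.continuous.aestronglyMeasurable.smul ?_
    exact ((WithLp.measurable_toLp 2 _).comp
      (measurable_pi_lambda _ fun i => ρ.measurable_R j i)).aestronglyMeasurable
  · by_cases hv : r < ‖v‖
    · rw [testSnd, hr v hv, zero_smul, norm_zero]; positivity
    · push Not at hv
      rw [testSnd, norm_smul]
      refine mul_le_mul (hC v) ?_ (norm_nonneg _) hC0
      refine (norm_le_sum_abs _).trans ((Finset.sum_le_sum (g := fun _ => ρ.C * (2 + r) ^ 2)
        fun i _ => (ρ.abs_R_le v j i).trans ?_).trans_eq (by simp))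
      gcongr

/-- The functional that expresses the weak gradient, as a vector. -/
noncomputable def testVec (φ : {φ : V3 → ℝ // IsTest φ}) (j : Fin 3) : Pair :=
  WithLp.toLp 2 ((isTest_testFst φ.2 j).memLp.toLp _, (memLp_testSnd ρ φ.2 j).toLp _)

/-- The energy space: pairs `(f, S (∇f + v f / 2))` of square integrable functions. -/
noncomputable def energySpace : Submodule ℝ Pair :=
  ⨅ p : {φ : V3 → ℝ // IsTest φ} × Fin 3, (innerSL ℝ (testVec ρ p.1 p.2)).ker

lemma isClosed_energySpace : IsClosed (energySpace ρ : Set Pair) := by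
  rw [energySpace, Submodule.coe_iInf]
  exact isClosed_iInter fun p => ContinuousLinearMap.isClosed_ker _

instance : CompleteSpace (energySpace ρ) := (isClosed_energySpace ρ).completeSpace_coe

/-- The defect of u in the weak gradient identity is a continuous functional on L² × L²: on the
support of φ the matrix S⁻¹ is bounded and can be moved to the test side. This makes the energy
space closed without any limit argument. -/
lemma inner_testVec (φ : {φ : V3 → ℝ // IsTest φ}) (j : Fin 3) (u : Pair) :
    inner ℝ (testVec ρ φ j) u = (∫ v, u.fst v * fderiv ℝ φ.1 v (basisVec j))
      + ∫ v, gradOf ρ u v j * φ.1 v := by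
  have hφ := φ.2
  have e0 : inner ℝ (testVec ρ φ j) u = (∫ v, inner ℝ ((testVec ρ φ j).fst v) (u.fst v))
      + ∫ v, inner ℝ ((testVec ρ φ j).snd v) (u.snd v) := by
    rw [WithLp.prod_inner_apply, L2.inner_def, L2.inner_def]; rfl
  have e1 : ∫ v, inner ℝ ((testVec ρ φ j).fst v) (u.fst v)
      = ∫ v, (u.fst v * fderiv ℝ φ.1 v (basisVec j) + u.fst v * (-(1 / 2 * v j) * φ.1 v)) := by
    refine integral_congr_ae ?_
    filter_upwards [(isTest_testFst hφ j).memLp.coeFn_toLp] with v hv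
    simp only [testVec, WithLp.toLp_fst, hv]
    simp only [RCLike.inner_apply, conj_trivial, testFst]
    ring
  have e2 : ∫ v, inner ℝ ((testVec ρ φ j).snd v) (u.snd v)
      = ∫ v, (gradOf ρ u v j * φ.1 v + u.fst v * (1 / 2 * v j * φ.1 v)) := by
    refine integral_congr_ae ?_
    filter_upwards [(memLp_testSnd ρ hφ j).coeFn_toLp] with v hv
    simp only [testVec, WithLp.toLp_snd, hv, gradOf_coord, mv_coord]
    simp only [PiLp.inner_apply, RCLike.inner_apply, conj_trivial, testSnd, PiLp.smul_apply,
      smul_eq_mul, Fin.sum_univ_three]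
    ring
  have hc : ContDiff ℝ ∞ fun v : V3 => 1 / 2 * v j := contDiff_const.mul (contDiff_top_coord j)
  have hf := locallyIntegrable_L2 u.fst
  have i0 := (hφ.mul_left hc).integrable_mul hf
  have i1 := (hφ.mul_left hc.neg).integrable_mul hf
  rw [e0, e1, e2, integral_add ((hφ.fderiv_apply _).integrable_mul hf) i1,
    integral_add (hφ.integrable_mul (locallyIntegrable_coord (locallyIntegrable_gradOf ρ u) j)) i0]
  have e3 : ∫ v, u.fst v * (-(1 / 2 * v j) * φ.1 v) = -∫ v, u.fst v * (1 / 2 * v j * φ.1 v) := by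
    rw [← integral_neg]; congr 1; funext v; ring
  rw [e3]
  ring

lemma mem_energySpace {u : Pair} :
    u ∈ energySpace ρ ↔ HasWeakGradient u.fst (gradOf ρ u) := by
  simp only [energySpace, Submodule.mem_iInf, LinearMap.mem_ker, Prod.forall]
  constructor
  · intro h
    refine ⟨locallyIntegrable_L2 _, locallyIntegrable_gradOf ρ u, fun φ hφ j => ?_⟩
    have := h ⟨φ, hφ⟩ j
    rw [ContinuousLinearMap.coe_coe, innerSL_apply_apply, inner_testVec] at this
    simp only at this
    linarith
  · intro h φ j
    rw [ContinuousLinearMap.coe_coe, innerSL_apply_apply, inner_testVec, h.2.2 φ.1 φ.2 j]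
    ring

/-- `S (∇f + v f / 2)`. -/
noncomputable def twist (f : V3 → ℝ) (G : V3 → V3) (v : V3) : V3 :=
  mv (ρ.S v) (G v + ((1 / 2 : ℝ) * f v) • v)

/-- The pair (f, S(∇f + vf/2)) recovers the gradient of f because S is invertible. Hence every f
whose twisted gradient is square integrable comes from the energy space. -/
lemma exists_lift {f : L2} {G : V3 → V3} (hG : HasWeakGradient f G)
    (hm : MemLp (twist ρ f G) 2 volume) :
    ∃ u : energySpace ρ, u.1.fst = f ∧ u.1.snd = hm.toLp ∧ gradOf ρ u.1 =ᵐ[volume] G := by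
  set u : Pair := WithLp.toLp 2 (f, hm.toLp) with hu
  have h1 : gradOf ρ u =ᵐ[volume] G := by
    filter_upwards [hm.coeFn_toLp] with v hv
    simp only [hu, gradOf, WithLp.toLp_fst, WithLp.toLp_snd, hv, twist, mv_mv, ρ.R_mul_S, mv_one]
    abel
  exact ⟨⟨u, (mem_energySpace ρ).2 (hG.congr_ae Filter.EventuallyEq.rfl h1.symm)⟩, rfl, rfl, h1⟩

lemma snd_ae_eq_twist (u : Pair) : u.snd =ᵐ[volume] twist ρ u.fst (gradOf ρ u) :=
  Eventually.of_forall fun v => by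
    simp only [twist, gradOf, sub_add_cancel, mv_mv, ρ.S_mul_R, mv_one]

/-- The embedding of the energy space into `L²`. -/
noncomputable def emb : energySpace ρ →L[ℝ] L2 :=
  (WithLp.fstL 2 ℝ L2 LV).comp (energySpace ρ).subtypeL

lemma emb_apply (u : energySpace ρ) : emb ρ u = u.1.fst := rfl

lemma hasWeakGradient_emb (u : energySpace ρ) : HasWeakGradient (emb ρ u) (gradOf ρ u.1) :=
  (mem_energySpace ρ).1 u.2

lemma norm_sq_energySpace (u : energySpace ρ) : ‖u‖ ^ 2 = ‖emb ρ u‖ ^ 2 + ‖u.1.snd‖ ^ 2 :=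
  WithLp.prod_norm_sq_eq_of_L2 u.1

lemma inner_energySpace (u w : energySpace ρ) :
    inner ℝ u w = inner ℝ (emb ρ u) (emb ρ w) + inner ℝ u.1.snd w.1.snd :=
  WithLp.prod_inner_apply u.1 w.1

/-- Weak gradients are unique, so the second component is determined by the first. -/
lemma emb_injective : Function.Injective (emb ρ) := by
  intro u w h
  have h1 := (hasWeakGradient_emb ρ u).unique (h ▸ hasWeakGradient_emb ρ w)
  have hf : u.1.fst = w.1.fst := h
  have h2 : u.1.snd = w.1.snd := by
    refine Lp.ext ?_
    filter_upwards [snd_ae_eq_twist ρ u.1, snd_ae_eq_twist ρ w.1, h1] with v a b c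
    rw [a, b, twist, twist, c, hf]
  exact Subtype.ext (WithLp.ofLp_injective 2 (Prod.ext hf h2))

end Landau

/-! ### Lifting a weak solution to the energy space -/

namespace Landau

open Filter Topology

section Lift

variable {V H : Type*} [NormedAddCommGroup V] [NormedSpace ℝ V] [CompleteSpace V]
  [SecondCountableTopology V] [NormedAddCommGroup H] [NormedSpace ℝ H]

/-- Measurable lifts through an injective operator. -/
theorem exists_measurable_lift (ι : V →L[ℝ] H) (hι : Function.Injective ι) {f : ℝ → H}
    {ν : Measure ℝ} (hf : AEStronglyMeasurable f ν) :
    ∃ ft : ℝ → V, AEStronglyMeasurable ft ν ∧ (∀ s, f s ∈ range ι → ι (ft s) = f s) ∧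
      NullMeasurableSet {s | f s ∈ range ι} ν := by
  borelize V
  borelize H
  -- Lusin–Souslin: an injective continuous map from a Polish space is a Borel isomorphism onto its
  -- Borel range. Its left inverse, extended by 0, gives the measurable lift.
  have he : MeasurableEmbedding ι := ι.continuous.measurableEmbedding hι
  have hm : Measurable (Function.extend ι id fun _ => (0 : V)) :=
    he.measurable_extend measurable_id measurable_const
  refine ⟨fun s => Function.extend ι id (fun _ => 0) (f s),
    (hm.comp_aemeasurable hf.aemeasurable).aestronglyMeasurable, ?_,
    hf.aemeasurable.nullMeasurableSet_preimage he.measurableSet_range⟩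
  rintro s ⟨u, hu⟩
  simp only [← hu, hι.extend_apply, id]

end Lift

variable {γ : ℝ} (ρ : Root γ)

instance : Fact ((2 : ℝ≥0∞) ≠ ⊤) := ⟨by norm_num⟩

instance : SecondCountableTopology Pair := WithLp.secondCountableTopology 2 L2 LV

instance : SecondCountableTopology (energySpace ρ) :=
  TopologicalSpace.Subtype.secondCountableTopology _

lemma ofReal_norm_sq_eq_lintegral {E : Type*} [NormedAddCommGroup E] [InnerProductSpace ℝ E]
    (z : Lp E 2 (volume : Measure V3)) :
    ENNReal.ofReal (‖z‖ ^ 2) = ∫⁻ v, ENNReal.ofReal (‖z v‖ ^ 2) := by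
  rw [← real_inner_self_eq_norm_sq, L2.inner_def, ofReal_integral_eq_lintegral_ofReal
    (L2.integrable_inner z z) (Eventually.of_forall fun v => real_inner_self_nonneg)]
  simp only [real_inner_self_eq_norm_sq]

/-- The A-norm adds the squares of S∇f and S(vf/2), whereas the energy space takes the square of
their sum. The two differ by a cross term. -/
lemma normASq_eq {f : V3 → ℝ} {G : V3 → V3} (h : HasWeakGradient f G) :
    normASq γ f = ∫⁻ v, ENNReal.ofReal
      (‖mv (ρ.S v) (G v)‖ ^ 2 + ‖mv (ρ.S v) (((1 / 2 : ℝ) * f v) • v)‖ ^ 2) := by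
  rw [normASq, if_pos ⟨G, h⟩]
  refine lintegral_congr_ae ?_
  filter_upwards [h.weakGrad_ae_eq] with v hv
  rw [hv, ← real_inner_self_eq_norm_sq, ← real_inner_self_eq_norm_sq,
    norm_sq_mv_of_gram (ρ.gram v), norm_sq_mv_of_gram (ρ.gram v), ← Finset.sum_add_distrib]
  congr 1
  refine Finset.sum_congr rfl fun j _ => ?_
  rw [← Finset.sum_add_distrib]
  refine Finset.sum_congr rfl fun k _ => ?_
  simp only [PiLp.smul_apply, smul_eq_mul]
  ring

lemma aestronglyMeasurable_twist {f : V3 → ℝ} {G : V3 → V3}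
    (hf : AEStronglyMeasurable f volume) (hG : AEStronglyMeasurable G volume) :
    AEStronglyMeasurable (twist ρ f G) volume :=
  aestronglyMeasurable_mv ρ.measurable_S
    (hG.add ((hf.const_mul _).smul continuous_id.aestronglyMeasurable))

lemma norm_twist_sq_le (f : V3 → ℝ) (G : V3 → V3) (v : V3) :
    ‖twist ρ f G v‖ ^ 2
      ≤ 2 * (‖mv (ρ.S v) (G v)‖ ^ 2 + ‖mv (ρ.S v) (((1 / 2 : ℝ) * f v) • v)‖ ^ 2) := by
  rw [twist, map_add]
  have := norm_add_le (mv (ρ.S v) (G v)) (mv (ρ.S v) (((1 / 2 : ℝ) * f v) • v))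
  refine (pow_le_pow_left₀ (norm_nonneg _) this 2).trans ?_
  nlinarith [sq_nonneg (‖mv (ρ.S v) (G v)‖ - ‖mv (ρ.S v) (((1 / 2 : ℝ) * f v) • v)‖)]

/-- The easy half of the comparison of norms, |x + y|² ≤ 2(|x|² + |y|²). The converse needs an
integration by parts. -/
lemma exists_lift_of_normASq {f : L2} (h : normASq γ f ≠ ⊤) :
    ∃ u : energySpace ρ, emb ρ u = f ∧
      ENNReal.ofReal (‖u‖ ^ 2) ≤ ENNReal.ofReal (‖f‖ ^ 2) + 2 * normASq γ f := by
  have hex : ∃ G, HasWeakGradient f G := by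
    by_contra hn
    exact h (by rw [normASq, if_neg hn])
  obtain ⟨G, hG⟩ := hex
  have hm : AEStronglyMeasurable (twist ρ f G) volume :=
    aestronglyMeasurable_twist ρ (Lp.aestronglyMeasurable f) hG.2.1.aestronglyMeasurable
  have hle : ∫⁻ v, ENNReal.ofReal (‖twist ρ f G v‖ ^ 2) ≤ 2 * normASq γ f := by
    rw [normASq_eq ρ hG, ← lintegral_const_mul' _ _ (by norm_num)]
    refine lintegral_mono fun v => ?_
    refine (ENNReal.ofReal_le_ofReal (norm_twist_sq_le ρ f G v)).trans_eq ?_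
    rw [ENNReal.ofReal_mul (by norm_num)]
    norm_num
  have hfin : ∫⁻ v, ENNReal.ofReal (‖twist ρ f G v‖ ^ 2) < ⊤ :=
    hle.trans_lt (ENNReal.mul_lt_top (by norm_num) h.lt_top)
  have hmem : MemLp (twist ρ f G) 2 volume := by
    rw [memLp_two_iff_integrable_sq_norm hm]
    exact ⟨hm.norm.pow 2, (hasFiniteIntegral_iff_ofReal
      (Eventually.of_forall fun v => sq_nonneg _)).2 hfin⟩
  obtain ⟨u, hu1, hu2, -⟩ := exists_lift ρ hG hmem
  refine ⟨u, hu1, ?_⟩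
  rw [norm_sq_energySpace, emb_apply, hu1, hu2, ENNReal.ofReal_add (sq_nonneg _) (sq_nonneg _),
    ofReal_norm_sq_eq_lintegral (hmem.toLp _)]
  gcongr
  refine (lintegral_congr_ae ?_).trans_le hle
  filter_upwards [hmem.coeFn_toLp] with v hv
  rw [hv]

/-- Outside the range of the embedding the A-norm is infinite, so finite energy puts f s in the
range for almost every s. No measurability of s ↦ `normASq γ (f s)` is needed: it is only compared,
from below and from above, with measurable quantities. -/
theorem exists_integrable_lift {f : ℝ → L2} {T : ℝ} (hf : ContinuousOn f (Icc 0 T))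
    (hE : ∫⁻ s in Ioc 0 T, normASq γ (f s) < ⊤) :
    ∃ ft : ℝ → energySpace ρ, IntegrableOn ft (Ioc 0 T) ∧
      ∀ᵐ s ∂volume.restrict (Ioc 0 T), emb ρ (ft s) = f s := by
  have hfm : AEStronglyMeasurable f (volume.restrict (Ioc 0 T)) :=
    (hf.mono Ioc_subset_Icc_self).aestronglyMeasurable measurableSet_Ioc
  obtain ⟨ft, hft, hl, hN⟩ := exists_measurable_lift (emb ρ) (emb_injective ρ) hfm
  have hrange : ∀ᵐ s ∂volume.restrict (Ioc 0 T), f s ∈ range (emb ρ) := by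
    rw [ae_iff]
    by_contra hpos
    -- The energy dominates ∞ times the measure of the exceptional set, which is null measurable by
    -- the lifting theorem.
    have h1 : (⊤ : ℝ≥0∞) * volume.restrict (Ioc 0 T) {s | f s ∉ range (emb ρ)}
        ≤ ∫⁻ s in Ioc 0 T, normASq γ (f s) := by
      have hN' : NullMeasurableSet {s | f s ∉ range (emb ρ)} (volume.restrict (Ioc 0 T)) :=
        hN.compl
      rw [← lintegral_indicator_const₀ hN']
      refine lintegral_mono fun s => ?_
      by_cases hs : f s ∈ range (emb ρ)
      · rw [indicator_of_notMem (by simpa using hs)]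
        exact zero_le
      · have : normASq γ (f s) = ⊤ := by
          by_contra hne
          obtain ⟨u, hu, -⟩ := exists_lift_of_normASq ρ hne
          exact hs ⟨u, hu⟩
        rw [this]
        exact le_top
    rw [ENNReal.top_mul hpos] at h1
    exact absurd hE (not_lt.2 h1)
  have hae : ∀ᵐ s ∂volume.restrict (Ioc 0 T), emb ρ (ft s) = f s := hrange.mono hl
  refine ⟨ft, ⟨hft, ?_⟩, hae⟩
  obtain ⟨M, hM⟩ := isCompact_Icc.exists_bound_of_continuousOn hf
  have hb : ∀ᵐ s ∂volume.restrict (Ioc 0 T),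
      ‖ft s‖ₑ ≤ ENNReal.ofReal (1 + M ^ 2) + 2 * normASq γ (f s) := by
    filter_upwards [hae, ae_restrict_mem measurableSet_Ioc] with s hs hsm
    by_cases hne : normASq γ (f s) = ⊤
    · rw [hne]; simp
    obtain ⟨u, hu, hle⟩ := exists_lift_of_normASq ρ hne
    rw [emb_injective ρ (hs.trans hu.symm)]
    have h2 : ‖u‖ ≤ 1 + ‖u‖ ^ 2 := by nlinarith [sq_nonneg (‖u‖ - 1)]
    have h3 : ‖f s‖ ^ 2 ≤ M ^ 2 := by gcongr; exact hM s (Ioc_subset_Icc_self hsm)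
    rw [← ofReal_norm, ENNReal.ofReal_add zero_le_one (sq_nonneg M), add_assoc]
    refine (ENNReal.ofReal_le_ofReal h2).trans ?_
    rw [ENNReal.ofReal_add zero_le_one (sq_nonneg _)]
    gcongr
    exact hle.trans (by gcongr)
  refine (lintegral_mono_ae hb).trans_lt ?_
  rw [lintegral_add_left measurable_const, lintegral_const_mul' _ _ (by norm_num)]
  refine ENNReal.add_lt_top.2 ⟨?_, ENNReal.mul_lt_top (by norm_num) hE⟩
  simp [ENNReal.mul_lt_top_iff]

end Landau

/-! ### Mollification and weak convergence -/

namespace Landau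

open Filter Topology
open ContinuousLinearMap (lsmul)
open scoped Convolution

/-- The convolution of two scalar functions on `ℝ³`. -/
noncomputable def conv (p q : V3 → ℝ) (v : V3) : ℝ := ∫ t, p t * q (v - t)

lemma conv_eq_convolution (p q : V3 → ℝ) : conv p q = p ⋆[lsmul ℝ ℝ, volume] q := rfl

lemma conv_swap (p q : V3 → ℝ) (v : V3) : conv p q v = ∫ w, q w * p (v - w) := by
  rw [conv, ← integral_sub_left_eq_self _ volume v]
  congr 1; funext w
  rw [sub_sub_cancel, mul_comm]

/-- Correlations of square integrable functions are continuous. -/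
lemma continuous_correlation {p q : V3 → ℝ} (hp : MemLp p 2 volume) (hq : MemLp q 2 volume) :
    Continuous fun s => ∫ v, q (v + s) * p v := by
  -- Translations act continuously on L².
  have h1 : Continuous fun s : V3 => inner ℝ (hp.toLp p) (DomAddAct.mk s +ᵥ hq.toLp q) := by
    have : Continuous fun s : V3 => (DomAddAct.mk s +ᵥ hq.toLp q : L2) :=
      (continuous_induced_rng.2 continuous_id : Continuous (DomAddAct.mk (M := V3))).vadd
        continuous_const
    fun_prop
  refine h1.congr fun s => ?_
  rw [L2.inner_def]
  refine integral_congr_ae ?_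
  have h2 : (fun v => hq.toLp q (s + v)) =ᵐ[volume] fun v => q (s + v) :=
    (measurePreserving_add_left volume s).quasiMeasurePreserving.ae_eq_comp hq.coeFn_toLp
  filter_upwards [hp.coeFn_toLp, DomAddAct.vadd_Lp_ae_eq (DomAddAct.mk s) (hq.toLp q), h2]
    with v a b c
  rw [a, b]
  simp only [DomAddAct.mk.symm_apply_apply, vadd_eq_add] at c ⊢
  rw [c, add_comm s v]
  simp [mul_comm]

lemma integrable_mul_translate {p q : V3 → ℝ} {r : V3 → ℝ} (hp : MemLp p 2 volume)
    (hq : MemLp q 2 volume) (hr : Integrable r) :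
    Integrable (fun x : V3 × V3 => r x.2 * q (x.1 - x.2) * p x.1) (volume.prod volume) := by
  have h1 : Integrable (fun x : V3 × V3 => r x.2 * q (x.1 - x.2) ^ 2) (volume.prod volume) :=
    hr.convolution_integrand (lsmul ℝ ℝ) hq.integrable_sq
  have h2 : Integrable (fun x : V3 × V3 => p x.1 ^ 2 * r x.2) (volume.prod volume) :=
    hp.integrable_sq.mul_prod hr
  have hqm : AEStronglyMeasurable (fun x : V3 × V3 => q (x.1 - x.2)) (volume.prod volume) :=
    hq.aestronglyMeasurable.comp_quasiMeasurePreserving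
      (quasiMeasurePreserving_sub volume volume)
  refine (h1.norm.add h2.norm).mono'
    ((hr.aestronglyMeasurable.comp_snd.mul hqm).mul hp.aestronglyMeasurable.comp_fst)
    (Eventually.of_forall fun x => ?_)
  simp only [Pi.add_apply, norm_mul, norm_pow, Real.norm_eq_abs, sq_abs]
  have h3 : |q (x.1 - x.2)| * |p x.1| ≤ q (x.1 - x.2) ^ 2 + p x.1 ^ 2 := by
    rw [← sq_abs (q _), ← sq_abs (p _)]
    nlinarith [sq_nonneg (|q (x.1 - x.2)| - |p x.1|), sq_nonneg |q (x.1 - x.2)|,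
      sq_nonneg |p x.1|]
  nlinarith [mul_le_mul_of_nonneg_left h3 (abs_nonneg (r x.2))]

lemma integral_conv_mul {p q r : V3 → ℝ} (hp : MemLp p 2 volume)
    (hq : MemLp q 2 volume) (hr : Integrable r) :
    Integrable (fun v => conv r q v * p v) ∧
    ∫ v, conv r q v * p v = conv r (fun s => ∫ v, q (v + s) * p v) 0 := by
  have hi := integrable_mul_translate hp hq hr
  have e : ∀ v, conv r q v * p v = ∫ t, r t * q (v - t) * p v := fun v => by
    rw [conv, integral_mul_const]
  constructor
  · simp only [e]
    exact hi.integral_prod_left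
  · simp only [e]
    rw [integral_integral_swap hi, conv]
    congr 1; funext t
    rw [← integral_const_mul]
    congr 1; funext v
    rw [zero_sub, ← sub_eq_add_neg]
    ring

/-- Mollifications converge weakly. -/
lemma tendsto_integral_conv_mul {p q : V3 → ℝ} (hp : MemLp p 2 volume) (hq : MemLp q 2 volume)
    {φ : ℕ → ContDiffBump (0 : V3)} (hφ : Tendsto (fun n => (φ n).rOut) atTop (𝓝 0)) :
    Tendsto (fun n => ∫ v, conv ((φ n).normed volume) q v * p v) atTop
      (𝓝 (∫ v, q v * p v)) := by
  have h1 := ContDiffBump.convolution_tendsto_right_of_continuous (μ := volume) hφ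
    (continuous_correlation hp hq) 0
  simp only [add_zero] at h1
  refine h1.congr fun n => ?_
  rw [(integral_conv_mul hp hq (φ n).integrable_normed).2, conv_eq_convolution]

/-- The derivative of the convolution falls on r. Since w ↦ r(v - w) is a test function, the weak
gradient identity then moves it to f. -/
lemma fderiv_conv {r f : V3 → ℝ} {G : V3 → V3} (hr : IsTest r) (h : HasWeakGradient f G)
    (j : Fin 3) (v : V3) :
    fderiv ℝ (conv r f) v (basisVec j) = conv r (fun w => G w j) v := by
  have h1 : HasFDerivAt (conv r f) _ v := hr.2.hasFDerivAt_convolution_left (lsmul ℝ ℝ)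
    (hr.1.of_le (by simp)) h.1 v
  have h2 : IsTest fun w => r (v - w) :=
    ⟨hr.1.comp (contDiff_const.sub contDiff_id),
      hr.2.comp_homeomorph (Homeomorph.subLeft v)⟩
  have h3 : ∀ w, fderiv ℝ (fun w => r (v - w)) w (basisVec j)
      = -fderiv ℝ r (v - w) (basisVec j) := by
    intro w
    have := ((hr.1.differentiable (by simp) (v - w)).hasFDerivAt.comp w
      ((hasFDerivAt_id w).const_sub v)).fderiv
    simp only [Function.comp_def] at this
    rw [this]
    simp
  have hex : ConvolutionExistsAt (fderiv ℝ r) f v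
      ((lsmul ℝ ℝ).precompL V3) volume :=
    (hr.2.fderiv (𝕜 := ℝ)).convolutionExists_left _
      (hr.1.continuous_fderiv (by simp)) h.1 v
  have h4 : fderiv ℝ (conv r f) v (basisVec j)
      = conv (fun t => fderiv ℝ r t (basisVec j)) f v := by
    rw [h1.fderiv, convolution_def, ContinuousLinearMap.integral_apply hex]
    rfl
  rw [h4, conv_swap, conv_swap]
  have h5 := h.2.2 _ h2 j
  simp only [h3, mul_neg, integral_neg, neg_inj] at h5
  exact h5

lemma isTest_conv {r f : V3 → ℝ} (hr : IsTest r) (hf : LocallyIntegrable f volume)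
    (hf' : HasCompactSupport f) : IsTest (conv r f) :=
  ⟨hr.2.contDiff_convolution_left (lsmul ℝ ℝ) hr.1 hf, hr.2.convolution (lsmul ℝ ℝ) hf'⟩

lemma conv_eq_zero {r f : V3 → ℝ} {R ε : ℝ} (hr : ∀ v, ε < ‖v‖ → r v = 0)
    (hf : ∀ v, R < ‖v‖ → f v = 0) {v : V3} (hv : R + ε < ‖v‖) : conv r f v = 0 := by
  rw [conv, ← integral_zero V3 ℝ (μ := volume)]
  congr 1; funext t
  by_cases ht : ε < ‖t‖
  · rw [hr t ht, zero_mul]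
  · rw [hf (v - t), mul_zero]
    have := norm_sub_norm_le v t
    linarith

end Landau

/-! ### Orthogonality to test functions, compactly supported case -/

namespace Landau

open Filter Topology

variable {γ : ℝ} (ρ : Root γ)

/-- The elements of the energy space that are given by test functions. -/
noncomputable def testSpace : Submodule ℝ (energySpace ρ) where
  carrier := {u | ∃ φ, IsTest φ ∧ emb ρ u =ᵐ[volume] φ}
  zero_mem' := ⟨0, ⟨contDiff_const, HasCompactSupport.zero⟩, by
    rw [map_zero]; exact Lp.coeFn_zero _ _ _⟩
  add_mem' := by
    rintro u w ⟨φ, hφ, h1⟩ ⟨ψ, hψ, h2⟩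
    refine ⟨_, hφ.add hψ, ?_⟩
    rw [map_add]
    filter_upwards [Lp.coeFn_add (emb ρ u) (emb ρ w), h1, h2] with v a b c
    rw [a, Pi.add_apply, b, c]
  smul_mem' := by
    rintro c u ⟨φ, hφ, h1⟩
    refine ⟨_, hφ.mul_left (contDiff_const (c := c)), ?_⟩
    rw [map_smul]
    filter_upwards [Lp.coeFn_smul c (emb ρ u), h1] with v a b
    rw [a, Pi.smul_apply, b, smul_eq_mul]

lemma memLp_coord {G : V3 → V3} (hG : MemLp G 2 volume) (k : Fin 3) :
    MemLp (fun v => G v k) 2 volume := by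
  refine hG.mono ((EuclideanSpace.proj (𝕜 := ℝ) k).continuous.comp_aestronglyMeasurable
    hG.aestronglyMeasurable) (Eventually.of_forall fun v => abs_apply_le _ _)

lemma norm_twist_le (f : V3 → ℝ) (G : V3 → V3) (v : V3) :
    ‖twist ρ f G v‖ ≤ 9 * (ρ.C * (1 + ‖v‖)) * (‖G v‖ + ‖v‖ * |f v|) := by
  refine (norm_mv_le (fun i j => ρ.abs_S_le v i j) _).trans ?_
  have h0 := ρ.C_nonneg
  refine mul_le_mul_of_nonneg_left ((norm_add_le _ _).trans ?_) (by positivity)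
  rw [norm_smul, Real.norm_eq_abs, abs_mul, abs_of_pos (by norm_num : (0 : ℝ) < 1 / 2)]
  nlinarith [mul_nonneg (norm_nonneg v) (abs_nonneg (f v))]

lemma memLp_twist {f : V3 → ℝ} {G : V3 → V3} {r : ℝ} (hr : 0 ≤ r) (hf : MemLp f 2 volume)
    (hG : MemLp G 2 volume) (hf0 : ∀ v, r < ‖v‖ → f v = 0) (hG0 : ∀ v, r < ‖v‖ → G v = 0) :
    MemLp (twist ρ f G) 2 volume := by
  have h1 : MemLp (fun v => 9 * (ρ.C * (1 + r)) * (‖G v‖ + r * ‖f v‖)) 2 volume :=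
    (hG.norm.add (hf.norm.const_mul r)).const_mul _
  refine h1.mono (aestronglyMeasurable_twist ρ hf.aestronglyMeasurable hG.aestronglyMeasurable)
    (Eventually.of_forall fun v => ?_)
  have h0 := ρ.C_nonneg
  rw [Real.norm_of_nonneg (by positivity)]
  refine (norm_twist_le ρ f G v).trans ?_
  by_cases hv : r < ‖v‖
  · rw [hf0 v hv, hG0 v hv]; simp
  · push Not at hv
    rw [← Real.norm_eq_abs]
    gcongr

/-- The inner product of `h` with the pair given by `f` and `G`. -/
noncomputable def pairing (h : Pair) (f : V3 → ℝ) (G : V3 → V3) : ℝ :=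
  (∫ v, f v * h.fst v) + ∫ v, inner ℝ (twist ρ f G v) (h.snd v)

lemma inner_eq_pairing (u w : energySpace ρ) :
    inner ℝ u w = pairing ρ w.1 (emb ρ u) (gradOf ρ u.1) := by
  rw [inner_energySpace, L2.inner_def, L2.inner_def, pairing]
  congr 1
  · refine integral_congr_ae (Eventually.of_forall fun v => ?_)
    change inner ℝ (emb ρ u v) (emb ρ w v) = emb ρ u v * emb ρ w v
    rw [RCLike.inner_apply, conj_trivial, mul_comm]
  · refine integral_congr_ae ?_
    filter_upwards [snd_ae_eq_twist ρ u.1] with v hv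
    rw [hv, emb_apply]

/-- Local representation of the pairing. -/
lemma exists_local_pairing (h : Pair) (r : ℝ) : ∃ (H₀ : V3 → ℝ) (H : Fin 3 → V3 → ℝ),
    MemLp H₀ 2 volume ∧ (∀ k, MemLp (H k) 2 volume) ∧
    ∀ (f : V3 → ℝ) (G : V3 → V3), MemLp f 2 volume → MemLp G 2 volume →
      (∀ v, r < ‖v‖ → f v = 0) → (∀ v, r < ‖v‖ → G v = 0) →
      pairing ρ h f G = (∫ v, f v * H₀ v) + ∑ k, ∫ v, G v k * H k v := by
  set B := Metric.closedBall (0 : V3) r with hB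
  have hBm : MeasurableSet B := measurableSet_closedBall
  have h0 := ρ.C_nonneg
  -- The matrix S is moved by transposition onto the fixed element h, where it is bounded on the
  -- ball. Plain weak L² convergence of f and of ∇f then suffices; no commutator of S with the
  -- mollifier appears.
  set H : Fin 3 → V3 → ℝ := fun k => B.indicator fun v => ∑ i, ρ.S v i k * h.snd v i with hH
  set H₀ : V3 → ℝ := fun v => h.fst v + ∑ k, B.indicator (fun v => 1 / 2 * v k) v * H k v with hH₀
  have hs := Lp.memLp h.snd
  have hHm : ∀ k, MemLp (H k) 2 volume := by
    intro k
    have h1 : MemLp (fun v => 3 * (ρ.C * (1 + r)) * ‖h.snd v‖) 2 volume := hs.norm.const_mul _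
    refine h1.mono ?_ (Eventually.of_forall fun v => ?_)
    · refine AEStronglyMeasurable.indicator ?_ hBm
      refine Finset.aestronglyMeasurable_fun_sum _ fun i _ => ?_
      exact (ρ.measurable_S i k).aestronglyMeasurable.mul (memLp_coord hs i).aestronglyMeasurable
    · simp only [hH]
      by_cases hv : v ∈ B
      · have hv' : ‖v‖ ≤ r := by simpa [hB] using hv
        have hr : 0 ≤ r := (norm_nonneg _).trans hv'
        rw [indicator_of_mem hv, Real.norm_of_nonneg (by positivity : (0 : ℝ) ≤ 3 * _ * _)]
        refine (norm_sum_le _ _).trans ?_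
        have : ∀ i ∈ Finset.univ, ‖ρ.S v i k * h.snd v i‖ ≤ ρ.C * (1 + r) * ‖h.snd v‖ := by
          intro i _
          rw [norm_mul]
          refine mul_le_mul ((ρ.abs_S_le v i k).trans (by gcongr)) (abs_apply_le _ _)
            (norm_nonneg _) (by positivity)
        refine (Finset.sum_le_sum this).trans_eq ?_
        simp; ring
      · rw [indicator_of_notMem hv, norm_zero]; exact norm_nonneg _
  have hb : ∀ k v, |B.indicator (fun v : V3 => 1 / 2 * v k) v| ≤ |r| := by
    intro k v
    by_cases hv : v ∈ B
    · have hv' : ‖v‖ ≤ r := by simpa [hB] using hv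
      rw [indicator_of_mem hv, abs_mul, abs_of_pos (by norm_num : (0 : ℝ) < 1 / 2)]
      have := abs_apply_le v k
      have := le_abs_self r
      linarith [abs_nonneg (v k)]
    · rw [indicator_of_notMem hv]; simp
  have hm0 : ∀ k, MemLp (fun v => B.indicator (fun v : V3 => 1 / 2 * v k) v * H k v) 2 volume := by
    intro k
    refine ((hHm k).norm.const_mul |r|).mono (AEStronglyMeasurable.mul
      (AEStronglyMeasurable.indicator (by fun_prop) hBm)
      (hHm k).aestronglyMeasurable) (Eventually.of_forall fun v => ?_)
    rw [norm_mul, norm_mul, norm_norm, Real.norm_eq_abs, Real.norm_eq_abs |r|, abs_abs]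
    exact mul_le_mul_of_nonneg_right (hb k v) (norm_nonneg _)
  refine ⟨H₀, H, (Lp.memLp h.fst).add (memLp_finsetSum _ fun k _ => hm0 k), hHm,
    fun f G hf hG hf0 hG0 => ?_⟩
  have i1 : Integrable fun v => f v * h.fst v := hf.integrable_mul (Lp.memLp h.fst)
  have i2 : ∀ k, Integrable fun v => f v * (B.indicator (fun v : V3 => 1 / 2 * v k) v * H k v) :=
    fun k => hf.integrable_mul (hm0 k)
  have i3 : ∀ k, Integrable fun v => G v k * H k v := fun k =>
    (memLp_coord hG k).integrable_mul (hHm k)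
  have e1 : ∀ v, inner ℝ (twist ρ f G v) (h.snd v)
      = (∑ k, f v * (B.indicator (fun v : V3 => 1 / 2 * v k) v * H k v)) + ∑ k, G v k * H k v := by
    intro v
    by_cases hv : v ∈ B
    · simp only [hH, indicator_of_mem hv, twist, PiLp.inner_apply, mv_coord, RCLike.inner_apply,
        conj_trivial, Fin.sum_univ_three, PiLp.add_apply, PiLp.smul_apply, smul_eq_mul]
      ring
    · have hv' : r < ‖v‖ := by simpa [hB] using hv
      simp only [hH, indicator_of_notMem hv, twist, hf0 v hv', hG0 v hv']
      simp
  simp only [pairing, e1]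
  rw [integral_add (integrable_finsetSum _ fun k _ => i2 k) (integrable_finsetSum _ fun k _ => i3 k),
    integral_finsetSum _ fun k _ => i3 k, ← add_assoc,
    ← integral_add i1 (integrable_finsetSum _ fun k _ => i2 k)]
  simp only [hH₀, mul_add, Finset.mul_sum]

/-- Orthogonality to test functions, for compactly supported elements. -/
lemma pairing_eq_zero_of_compact {h : energySpace ρ} (hh : h ∈ (testSpace ρ)ᗮ) {f : V3 → ℝ}
    {G : V3 → V3} {r : ℝ} (hfG : HasWeakGradient f G) (hf : MemLp f 2 volume)
    (hG : MemLp G 2 volume) (hf0 : ∀ v, r < ‖v‖ → f v = 0) (hG0 : ∀ v, r < ‖v‖ → G v = 0) :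
    pairing ρ h.1 f G = 0 := by
  set b : ℕ → ContDiffBump (0 : V3) := fun n =>
    ⟨1 / (2 * ((n : ℝ) + 1)), 1 / ((n : ℝ) + 1), by positivity, by
      rw [div_lt_div_iff_of_pos_left one_pos (by positivity) (by positivity)]
      have : (0 : ℝ) ≤ n := n.cast_nonneg
      linarith⟩ with hb
  have hb0 : Tendsto (fun n => (b n).rOut) atTop (𝓝 0) := tendsto_one_div_add_atTop_nhds_zero_nat
  have hb1 : ∀ n, (b n).rOut ≤ 1 := fun n => by
    simp only [hb]
    rw [div_le_one (by positivity)]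
    have : (0 : ℝ) ≤ n := n.cast_nonneg
    linarith
  have hbt : ∀ n, IsTest ((b n).normed volume) := fun n =>
    ⟨(b n).contDiff_normed, (b n).hasCompactSupport_normed⟩
  have hbs : ∀ n v, 1 < ‖v‖ → (b n).normed volume v = 0 := by
    intro n v hv
    by_contra h0
    have : v ∈ Function.support ((b n).normed volume) := h0
    rw [ContDiffBump.support_normed_eq] at this
    simp only [Metric.mem_ball, dist_zero_right] at this
    linarith [hb1 n]
  -- The mollifiers live in the unit ball, so supports grow from radius r to at most r + 1.
  obtain ⟨H₀, H, hH₀, hH, hrep⟩ := exists_local_pairing ρ h.1 (r + 1)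
  have hlift : ∀ n, (∫ v, conv ((b n).normed volume) f v * H₀ v)
      + ∑ k, ∫ v, conv ((b n).normed volume) (fun w => G w k) v * H k v = 0 := by
    intro n
    set ψ := conv ((b n).normed volume) f with hψ
    have hfc : HasCompactSupport f := HasCompactSupport.intro (isCompact_closedBall (0 : V3) r)
      fun v hv => hf0 v (by simpa using hv)
    have hψt : IsTest ψ := isTest_conv (hbt n) hfG.1 hfc
    have hψ0 : ∀ v, r + 1 < ‖v‖ → ψ v = 0 := fun v hv => conv_eq_zero (hbs n) hf0 hv
    have hgc : ∀ v k, grad ψ v k = conv ((b n).normed volume) (fun w => G w k) v := fun v k =>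
      fderiv_conv (hbt n) hfG k v
    have hg0 : ∀ v, r + 1 < ‖v‖ → grad ψ v = 0 := by
      intro v hv
      refine PiLp.ext fun k => ?_
      rw [hgc]
      exact conv_eq_zero (hbs n) (fun w hw => by rw [hG0 w hw]; rfl) hv
    have hgm : MemLp (grad ψ) 2 volume :=
      (continuous_grad (hψt.1.of_le (by simp))).memLp_of_hasCompactSupport
        (HasCompactSupport.intro (isCompact_closedBall (0 : V3) (r + 1))
          fun v hv => hg0 v (by simpa using hv))
    have hwg := hasWeakGradient_grad (hψt.1.of_le (by simp))
    have htm := memLp_twist ρ (r := max (r + 1) 0) (le_max_right _ _) hψt.memLp hgm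
      (fun v hv => hψ0 v ((le_max_left _ _).trans_lt hv))
      (fun v hv => hg0 v ((le_max_left _ _).trans_lt hv))
    have hae := hψt.memLp.coeFn_toLp
    have htm' : MemLp (twist ρ (hψt.memLp.toLp ψ) (grad ψ)) 2 volume := by
      refine htm.ae_eq ?_
      filter_upwards [hae] with v hv
      rw [twist, twist, hv]
    obtain ⟨u, hu1, hu2, hu3⟩ := exists_lift ρ (hwg.congr_ae hae.symm EventuallyEq.rfl) htm'
    have hut : u ∈ testSpace ρ := ⟨ψ, hψt, by rw [emb_apply, hu1]; exact hae⟩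
    have h1 := (Submodule.mem_orthogonal _ _).1 hh u hut
    rw [inner_eq_pairing] at h1
    have h2 : pairing ρ h.1 (emb ρ u) (gradOf ρ u.1) = pairing ρ h.1 ψ (grad ψ) := by
      rw [pairing, pairing, emb_apply, hu1]
      congr 1
      · refine integral_congr_ae ?_
        filter_upwards [hae] with v hv
        rw [hv]
      · refine integral_congr_ae ?_
        filter_upwards [hae, hu3] with v hv hv'
        rw [twist, twist, hv, hv']
    rw [h2, hrep ψ (grad ψ) hψt.memLp hgm hψ0 hg0] at h1
    simpa only [hgc] using h1
  have hlim : Tendsto (fun n => (∫ v, conv ((b n).normed volume) f v * H₀ v)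
      + ∑ k, ∫ v, conv ((b n).normed volume) (fun w => G w k) v * H k v) atTop
      (𝓝 ((∫ v, f v * H₀ v) + ∑ k, ∫ v, G v k * H k v)) :=
    (tendsto_integral_conv_mul hH₀ hf hb0).add (tendsto_finsetSum _ fun k _ =>
      tendsto_integral_conv_mul (hH k) (memLp_coord hG k) hb0)
  simp only [hlift] at hlim
  rw [hrep f G hf hG (fun v hv => hf0 v (by linarith)) (fun v hv => hG0 v (by linarith))]
  exact (tendsto_nhds_unique hlim tendsto_const_nhds)

end Landau

/-! ### Density of test functions in the energy space -/

namespace Landau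

open Filter Topology

variable {γ : ℝ} (ρ : Root γ)

/-- Smooth cutoff functions with slowly decaying gradients. -/
lemma exists_cutoff : ∃ (χ : ℕ → V3 → ℝ) (C : ℝ), 0 ≤ C ∧ (∀ n, ContDiff ℝ ∞ (χ n)) ∧
    (∀ n v, |χ n v| ≤ 1) ∧ (∀ (n : ℕ) v, 2 * ((n : ℝ) + 1) < ‖v‖ → χ n v = 0) ∧
    (∀ v, Tendsto (fun n => χ n v) atTop (𝓝 1)) ∧
    (∀ n v, ‖grad (χ n) v‖ ≤ C / ((n : ℝ) + 1)) ∧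
    (∀ (n : ℕ) v, 2 * ((n : ℝ) + 1) < ‖v‖ → grad (χ n) v = 0) := by
  set b : ContDiffBump (0 : V3) := ⟨1, 2, one_pos, one_lt_two⟩ with hb
  have hbC : ContDiff ℝ ∞ b := b.contDiff
  have hgc : HasCompactSupport (grad b) := by
    refine HasCompactSupport.intro (b.hasCompactSupport.fderiv (𝕜 := ℝ)).isCompact fun v hv => ?_
    refine PiLp.ext fun k => ?_
    rw [grad_coord, image_eq_zero_of_notMem_tsupport hv]
    rfl
  obtain ⟨C, hC⟩ := (continuous_grad (hbC.of_le (by simp))).bounded_above_of_compact_support hgc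
  have hpos : ∀ n : ℕ, (0 : ℝ) < (n : ℝ) + 1 := fun n => by positivity
  have hzero : ∀ (n : ℕ) (v : V3), 2 * ((n : ℝ) + 1) < ‖v‖ → b (((n : ℝ) + 1)⁻¹ • v) = 0 := by
    intro n v hv
    refine b.zero_of_le_dist ?_
    rw [dist_zero_right, norm_smul, norm_inv, Real.norm_of_nonneg (hpos n).le, inv_mul_eq_div,
      le_div_iff₀ (hpos n)]
    exact hv.le
  have hg : ∀ (n : ℕ) (v : V3), grad (fun v => b (((n : ℝ) + 1)⁻¹ • v)) v
      = ((n : ℝ) + 1)⁻¹ • grad b (((n : ℝ) + 1)⁻¹ • v) := by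
    intro n v
    refine PiLp.ext fun k => ?_
    have h1 := ((hbC.differentiable (by simp) (((n : ℝ) + 1)⁻¹ • v)).hasFDerivAt.comp v
      ((hasFDerivAt_id v).const_smul ((n : ℝ) + 1)⁻¹)).fderiv
    simp only [Function.comp_def] at h1
    rw [grad_coord, PiLp.smul_apply, grad_coord, h1]
    simp
  refine ⟨fun n v => b (((n : ℝ) + 1)⁻¹ • v), C, (norm_nonneg _).trans (hC 0), fun n => ?_,
    fun n v => ?_, hzero, fun v => ?_, fun n v => ?_, fun n v hv => ?_⟩
  · exact hbC.comp (contDiff_id.const_smul _)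
  · rw [abs_of_nonneg b.nonneg]; exact b.le_one
  · refine tendsto_const_nhds.congr' ?_
    filter_upwards [eventually_ge_atTop ⌈‖v‖⌉₊] with n hn
    refine (b.one_of_mem_closedBall ?_).symm
    rw [mem_closedBall_zero_iff, norm_smul, norm_inv, Real.norm_of_nonneg (hpos n).le,
      inv_mul_eq_div, div_le_iff₀ (hpos n)]
    have := (Nat.le_ceil ‖v‖).trans (Nat.cast_le.2 hn)
    simp only [hb]
    linarith
  · rw [hg, norm_smul, norm_inv, Real.norm_of_nonneg (hpos n).le, inv_mul_eq_div]
    exact div_le_div_of_nonneg_right (hC _) (hpos n).le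
  · rw [hg]
    refine PiLp.ext fun k => ?_
    have : (((n : ℝ) + 1)⁻¹ • v) ∉ tsupport b := by
      rw [b.tsupport_eq, mem_closedBall_zero_iff, norm_smul, norm_inv,
        Real.norm_of_nonneg (hpos n).le, inv_mul_eq_div, not_le, lt_div_iff₀ (hpos n)]
      exact hv
    rw [PiLp.smul_apply, grad_coord,
      image_eq_zero_of_notMem_tsupport (notMem_subset (tsupport_fderiv_subset ℝ) this)]
    simp

lemma twist_cutoff (f ψ : V3 → ℝ) (G : V3 → V3) (v : V3) :
    twist ρ (fun v => ψ v * f v) (fun v => ψ v • G v + f v • grad ψ v) v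
      = ψ v • twist ρ f G v + f v • mv (ρ.S v) (grad ψ v) := by
  simp only [twist, ← map_smul, ← map_add]
  congr 1
  module

/-- On the ball of radius r the inverse factor is bounded, so there the gradient itself is square
integrable, and not only its image under S. -/
lemma memLp_gradOf_cutoff (u : Pair) {ψ : V3 → ℝ} {r C : ℝ} (hr : 0 ≤ r) (hψ : ContDiff ℝ ∞ ψ)
    (h1 : ∀ v, |ψ v| ≤ 1) (h2 : ∀ v, ‖grad ψ v‖ ≤ C) (h0 : ∀ v, r < ‖v‖ → ψ v = 0) :
    MemLp (fun v => ψ v • gradOf ρ u v + u.fst v • grad ψ v) 2 volume := by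
  have hC := ρ.C_nonneg
  have hC' : 0 ≤ C := (norm_nonneg _).trans (h2 0)
  have hf := Lp.memLp u.fst
  have hs := Lp.memLp u.snd
  have hb : MemLp (fun v => 9 * (ρ.C * (2 + r) ^ 2) * ‖u.snd v‖ + (r + C) * ‖u.fst v‖) 2 volume :=
    (hs.norm.const_mul _).add (hf.norm.const_mul _)
  refine hb.mono ?_ (Eventually.of_forall fun v => ?_)
  · exact (hψ.continuous.aestronglyMeasurable.smul
      (locallyIntegrable_gradOf ρ u).aestronglyMeasurable).add
      (hf.aestronglyMeasurable.smul (continuous_grad (hψ.of_le (by simp))).aestronglyMeasurable)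
  · rw [Real.norm_of_nonneg (by positivity), add_mul]
    have e2 : ‖u.fst v • grad ψ v‖ ≤ C * ‖u.fst v‖ := by
      rw [norm_smul, mul_comm]
      exact mul_le_mul_of_nonneg_right (h2 v) (norm_nonneg _)
    have e1 : ‖ψ v • gradOf ρ u v‖ ≤ 9 * (ρ.C * (2 + r) ^ 2) * ‖u.snd v‖ + r * ‖u.fst v‖ := by
      by_cases hv : r < ‖v‖
      · rw [h0 v hv, zero_smul, norm_zero]; positivity
      · push Not at hv
        rw [norm_smul]
        refine (mul_le_of_le_one_left (norm_nonneg _) (h1 v)).trans ?_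
        refine (norm_sub_le _ _).trans (add_le_add ?_ ?_)
        · refine norm_mv_le (fun i j => (ρ.abs_R_le v i j).trans ?_) _
          gcongr
        · rw [norm_smul, norm_mul, Real.norm_of_nonneg (by norm_num : (0 : ℝ) ≤ 1 / 2)]
          nlinarith [mul_le_mul_of_nonneg_right hv (norm_nonneg (u.fst v)),
            mul_nonneg (norm_nonneg (u.fst v)) (norm_nonneg v)]
    linarith [norm_add_le (ψ v • gradOf ρ u v) (u.fst v • grad ψ v)]

/-- Test functions are dense in the energy space. -/
theorem dense_testSpace : Dense (testSpace ρ : Set (energySpace ρ)) := by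
  rw [Submodule.dense_iff_topologicalClosure_eq_top, Submodule.topologicalClosure_eq_top_iff,
    Submodule.eq_bot_iff]
  intro h hh
  obtain ⟨χ, C, hC0, hχ, hχ1, hχ0, hχl, hgb, hg0⟩ := exists_cutoff
  have hρ := ρ.C_nonneg
  set f : V3 → ℝ := fun v => h.1.fst v with hf
  set G := gradOf ρ h.1 with hG
  have hfm : MemLp f 2 volume := Lp.memLp h.1.fst
  have hwg : HasWeakGradient f G := hasWeakGradient_emb ρ h
  have hpos : ∀ n : ℕ, (0 : ℝ) < (n : ℝ) + 1 := fun n => by positivity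
  have hz : ∀ n, pairing ρ h.1 (fun v => χ n v * f v)
      (fun v => χ n v • G v + f v • grad (χ n) v) = 0 := by
    intro n
    refine pairing_eq_zero_of_compact ρ hh (r := 2 * ((n : ℝ) + 1)) (hwg.mul_smooth (hχ n)) ?_
      (memLp_gradOf_cutoff ρ h.1 (by positivity) (hχ n) (hχ1 n) (hgb n) (hχ0 n))
      (fun v hv => by rw [hχ0 n v hv, zero_mul])
      (fun v hv => by rw [hχ0 n v hv, hg0 n v hv, zero_smul, smul_zero, add_zero])
    refine hfm.mono ((hχ n).continuous.aestronglyMeasurable.mul hfm.aestronglyMeasurable)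
      (Eventually.of_forall fun v => ?_)
    rw [norm_mul]
    exact mul_le_of_le_one_left (norm_nonneg _) (hχ1 n v)
  have htw := snd_ae_eq_twist ρ h.1
  have hsm := Lp.memLp h.1.snd
  have htm : AEStronglyMeasurable (twist ρ f G) volume :=
    aestronglyMeasurable_twist ρ hfm.aestronglyMeasurable hwg.2.1.aestronglyMeasurable
  have hgS : ∀ n v, ‖mv (ρ.S v) (grad (χ n) v)‖ ≤ 9 * (ρ.C * (1 + ‖v‖)) * (C / ((n : ℝ) + 1)) :=
    fun n v => (norm_mv_le (fun i j => ρ.abs_S_le v i j) _).trans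
      (mul_le_mul_of_nonneg_left (hgb n v) (by positivity))
  -- S grows linearly, |∇χₙ| ≤ C/(n+1), and ∇χₙ vanishes beyond |v| = 2(n+1). So S∇χₙ is uniformly
  -- bounded and tends to 0 pointwise, as dominated convergence requires.
  have hgS' : ∀ n v, ‖mv (ρ.S v) (grad (χ n) v)‖ ≤ 27 * (ρ.C * C) := by
    intro n v
    by_cases hv : 2 * ((n : ℝ) + 1) < ‖v‖
    · rw [hg0 n v hv, map_zero, norm_zero]; positivity
    · push Not at hv
      refine (hgS n v).trans ?_
      have h0 : (0 : ℝ) ≤ n := n.cast_nonneg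
      have : 1 + ‖v‖ ≤ 3 * ((n : ℝ) + 1) := by linarith
      calc 9 * (ρ.C * (1 + ‖v‖)) * (C / ((n : ℝ) + 1))
          ≤ 9 * (ρ.C * (3 * ((n : ℝ) + 1))) * (C / ((n : ℝ) + 1)) := by gcongr
        _ = _ := by have := (hpos n).ne'; field_simp; ring
  have hgS0 : ∀ v, Tendsto (fun n => mv (ρ.S v) (grad (χ n) v)) atTop (𝓝 0) := by
    intro v
    refine squeeze_zero_norm (hgS · v) ?_
    have := (tendsto_const_div_atTop_nhds_zero_nat C).comp (tendsto_add_atTop_nat 1)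
    have h2 : Tendsto (fun n : ℕ => C / ((n : ℝ) + 1)) atTop (𝓝 0) := by
      refine this.congr fun n => ?_
      simp
    simpa using h2.const_mul (9 * (ρ.C * (1 + ‖v‖)))
  have hlim : Tendsto (fun n => pairing ρ h.1 (fun v => χ n v * f v)
      (fun v => χ n v • G v + f v • grad (χ n) v)) atTop (𝓝 (pairing ρ h.1 f G)) := by
    refine Tendsto.add ?_ ?_
    · refine tendsto_integral_of_dominated_convergence (fun v => ‖f v * h.1.fst v‖) (fun n => ?_)
        (hfm.integrable_mul hfm).norm (fun n => Eventually.of_forall fun v => ?_)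
        (Eventually.of_forall fun v => ?_)
      · exact ((hχ n).continuous.aestronglyMeasurable.mul hfm.aestronglyMeasurable).mul
          hfm.aestronglyMeasurable
      · rw [mul_assoc, norm_mul]
        exact mul_le_of_le_one_left (norm_nonneg _) (hχ1 n v)
      · simpa using ((hχl v).mul_const (f v)).mul_const (h.1.fst v)
    · simp only [twist_cutoff]
      refine tendsto_integral_of_dominated_convergence
        (fun v => ‖h.1.snd v‖ * ‖h.1.snd v‖ + 27 * (ρ.C * C) * (‖f v‖ * ‖h.1.snd v‖))
        (fun n => ?_) ?_ (fun n => ?_) (Eventually.of_forall fun v => ?_)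
      · refine AEStronglyMeasurable.inner (AEStronglyMeasurable.add
          ((hχ n).continuous.aestronglyMeasurable.smul htm) (hfm.aestronglyMeasurable.smul
          (aestronglyMeasurable_mv ρ.measurable_S (continuous_grad
            ((hχ n).of_le (by simp))).aestronglyMeasurable))) hsm.aestronglyMeasurable
      · exact (hsm.norm.integrable_mul hsm.norm).add
          ((hfm.norm.integrable_mul hsm.norm).const_mul _)
      · filter_upwards [htw] with v hv
        refine (norm_inner_le_norm _ _).trans ?_
        have e1 : ‖χ n v • twist ρ f G v‖ ≤ ‖h.1.snd v‖ := by
          rw [norm_smul, hv]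
          exact mul_le_of_le_one_left (norm_nonneg _) (hχ1 n v)
        have e2 : ‖f v • mv (ρ.S v) (grad (χ n) v)‖ ≤ 27 * (ρ.C * C) * ‖f v‖ := by
          rw [norm_smul, mul_comm]
          exact mul_le_mul_of_nonneg_right (hgS' n v) (norm_nonneg _)
        refine (mul_le_mul_of_nonneg_right ((norm_add_le _ _).trans (add_le_add e1 e2))
          (norm_nonneg _)).trans_eq ?_
        ring
      · have := (((hχl v).smul_const (twist ρ f G v)).add
          ((hgS0 v).const_smul (f v))).inner (𝕜 := ℝ) (tendsto_const_nhds (x := h.1.snd v))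
        simpa using this
  simp only [hz] at hlim
  -- The truncations of h are orthogonal to h and their pairings converge to ‖h‖².
  have h0 : inner ℝ h h = 0 := by
    rw [inner_eq_pairing]
    exact tendsto_nhds_unique hlim tendsto_const_nhds
  exact inner_self_eq_zero.1 h0

end Landau

/-! ### Comparison of the A-norm with the energy norm -/

namespace Landau

open Filter Topology

variable {γ : ℝ} (ρ : Root γ)

/-- √μ is bounded below on compact sets. -/
lemma IsTest.muDecay₁ {φ : V3 → ℝ} (hφ : IsTest φ) : MuDecay₁ φ := by
  have key : ∀ ψ : V3 → ℝ, IsTest ψ → ∃ C, ∀ v, |ψ v| ≤ C * sqrtMu v := by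
    intro ψ hψ
    have h1 : Continuous fun v => (sqrtMu v)⁻¹ * ψ v :=
      (continuous_sqrtMu.inv₀ fun v => (sqrtMu_pos v).ne').mul hψ.continuous
    obtain ⟨C, hC⟩ := h1.bounded_above_of_compact_support hψ.2.mul_left
    refine ⟨C, fun v => ?_⟩
    have h2 := hC v
    rw [norm_mul, norm_inv, Real.norm_of_nonneg (sqrtMu_pos v).le, Real.norm_eq_abs,
      inv_mul_le_iff₀ (sqrtMu_pos v)] at h2
    linarith
  obtain ⟨C, hC⟩ := key φ hφ
  choose D hD using fun k : Fin 3 => key _ (hφ.fderiv_apply (basisVec k))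
  have h0 := fun v => (sqrtMu_pos v).le
  refine ⟨hφ.1.of_le (by simp), |C| + ∑ k, |D k|, fun v => ⟨(hC v).trans ?_, fun k =>
    (hD k v).trans ?_⟩⟩
  · refine mul_le_mul_of_nonneg_right ?_ (h0 v)
    have : 0 ≤ ∑ k, |D k| := Finset.sum_nonneg fun k _ => abs_nonneg _
    linarith [le_abs_self C]
  · refine mul_le_mul_of_nonneg_right ?_ (h0 v)
    have := Finset.single_le_sum (f := fun k => |D k|) (fun k _ => abs_nonneg _)
      (Finset.mem_univ k)
    linarith [le_abs_self (D k), abs_nonneg C]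

lemma integrable_mu : Integrable mu :=
  (integrable_gau.const_mul (24 ^ 3)).mono' continuous_mu.aestronglyMeasurable (Eventually.of_forall fun v => by
    rw [Real.norm_of_nonneg (mu_pos v).le]; exact mu_le_gau v)

/-- Near the singularity μ ≤ 1 and the power is integrable; away from it the power is at most 1 and
μ is integrable. -/
lemma exists_rpow_mu_bound (hγ₁ : -3 < γ) (hγ₂ : γ < 0) :
    ∃ C, 0 ≤ C ∧ ∀ v, |∫ w, ‖v - w‖ ^ γ * mu w| ≤ C := by
  have h1 := integrable_norm_rpow_ball hγ₁
  set σ := fun z : V3 => (Metric.ball (0 : V3) 1).indicator (fun z => ‖z‖ ^ γ) z with hσ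
  have hσ0 : ∀ z, 0 ≤ σ z := fun z => indicator_nonneg (fun z _ => by positivity) z
  refine ⟨(∫ z, σ z) + ∫ w, mu w, add_nonneg (integral_nonneg hσ0)
    (integral_nonneg fun w => (mu_pos w).le), fun v => ?_⟩
  have h2 : Integrable fun w => σ (v - w) := h1.comp_sub_left v
  rw [← integral_sub_left_eq_self σ volume v, ← integral_add h2 integrable_mu, ← Real.norm_eq_abs]
  refine norm_integral_le_of_norm_le (h2.add integrable_mu) (Eventually.of_forall fun w => ?_)
  have h3 := mu_pos w
  have h4 : mu w ≤ 1 := (mu_le_sqrtMu w).trans (sqrtMu_le_one w)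
  have h5 : 0 ≤ ‖v - w‖ ^ γ := Real.rpow_nonneg (norm_nonneg _) _
  rw [Real.norm_of_nonneg (by positivity)]
  by_cases h : v - w ∈ Metric.ball (0 : V3) 1
  · have : σ (v - w) = ‖v - w‖ ^ γ := indicator_of_mem h _
    rw [this]
    nlinarith
  · have : ‖v - w‖ ^ γ ≤ 1 :=
      Real.rpow_le_one_of_one_le_of_nonpos (by simpa using h) hγ₂.le
    nlinarith [hσ0 (v - w)]

lemma locallyIntegrable_aBar (hγ₁ : -3 < γ) (hγ₂ : γ < 0) (j k : Fin 3) :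
    LocallyIntegrable (aBar γ j k) volume := by
  obtain ⟨C, hC, hb⟩ := exists_abs_aBar_le hγ₁ hγ₂
  refine (Continuous.locallyIntegrable (f := fun v : V3 => C * (1 + ‖v‖ ^ 2))
    (by fun_prop)).mono (measurable_aBar γ j k).aestronglyMeasurable
    (Eventually.of_forall fun v => ?_)
  rw [Real.norm_eq_abs, Real.norm_of_nonneg (by positivity)]
  exact hb j k v

lemma twist_zero_left (G : V3 → V3) (v : V3) : twist ρ 0 G v = mv (ρ.S v) (G v) := by
  simp [twist]

lemma twist_zero_right (f : V3 → ℝ) (v : V3) :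
    twist ρ f 0 v = mv (ρ.S v) (((1 / 2 : ℝ) * f v) • v) := by
  simp [twist]

lemma twist_eq_add (f : V3 → ℝ) (G : V3 → V3) (v : V3) :
    twist ρ f G v = twist ρ 0 G v + twist ρ f 0 v := by
  rw [twist_zero_left, twist_zero_right, twist, map_add]

/-- The gradient of a test function vanishes outside a ball. -/
lemma IsTest.grad_props {φ : V3 → ℝ} (hφ : IsTest φ) : MemLp (grad φ) 2 volume ∧
    ∃ r, 0 ≤ r ∧ (∀ v, r < ‖v‖ → φ v = 0) ∧ ∀ v, r < ‖v‖ → grad φ v = 0 := by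
  have hc : HasCompactSupport (grad φ) := by
    refine HasCompactSupport.intro (hφ.2.fderiv (𝕜 := ℝ)).isCompact fun v hv => ?_
    refine PiLp.ext fun k => ?_
    rw [grad_coord, image_eq_zero_of_notMem_tsupport hv]
    rfl
  obtain ⟨r, hr0, hr⟩ := exists_radius hφ.2
  obtain ⟨s, hs0, hs⟩ := exists_radius hc
  exact ⟨(continuous_grad (hφ.1.of_le (by simp))).memLp_of_hasCompactSupport hc, max r s,
    hr0.le.trans (le_max_left _ _), fun v hv => hr v ((le_max_left _ _).trans_lt hv),
    fun v hv => hs v ((le_max_right _ _).trans_lt hv)⟩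

/-- The cross term is a quarter of ∫ (āv)·∇(φ²), so the divergence of āv turns it into a term
without derivatives. -/
lemma integral_inner_twist (hγ₁ : -3 < γ) (hγ₂ : γ < 0) {φ : V3 → ℝ} (hφ : IsTest φ) :
    2 * ∫ v, inner ℝ (twist ρ 0 (grad φ) v) (twist ρ φ 0 v)
      = -((3 + γ) * ∫ v, (∫ w, ‖v - w‖ ^ γ * mu w) * φ v ^ 2) := by
  have hφ2 : IsTest fun v => φ v * φ v := hφ.mul_left hφ.1
  have hk := sum_integral_aBar_mul_fderiv hγ₁ hγ₂ hφ2.muDecay₁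
  have hd : ∀ v j, fderiv ℝ (fun v => φ v * φ v) v (basisVec j)
      = 2 * (φ v * fderiv ℝ φ v (basisVec j)) := by
    intro v j
    have := hφ.1.differentiable (by simp) v
    rw [fderiv_fun_mul this this]
    simp only [_root_.add_apply, _root_.smul_apply, smul_eq_mul]
    ring
  have hi : ∀ j, Integrable fun v => (∑ k, aBar γ j k v * v k)
      * fderiv ℝ (fun v => φ v * φ v) v (basisVec j) := by
    intro j
    have : Integrable fun v => ∑ k, aBar γ j k v
        * (v k * fderiv ℝ (fun v => φ v * φ v) v (basisVec j)) :=
      integrable_finsetSum _ fun k _ => ((hφ2.fderiv_apply _).mul_left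
        (contDiff_top_coord k)).integrable_mul (locallyIntegrable_aBar hγ₁ hγ₂ j k)
    refine this.congr (Eventually.of_forall fun v => ?_)
    simp only [Finset.sum_mul, mul_assoc]
  rw [← integral_finsetSum _ fun j _ => hi j] at hk
  have e1 : ∀ v, inner ℝ (twist ρ 0 (grad φ) v) (twist ρ φ 0 v)
      = 1 / 4 * ∑ j, (∑ k, aBar γ j k v * v k)
        * fderiv ℝ (fun v => φ v * φ v) v (basisVec j) := by
    intro v
    rw [twist_zero_left, twist_zero_right, norm_sq_mv_of_gram (ρ.gram v)]
    simp only [hd, grad_coord, PiLp.smul_apply, smul_eq_mul, Fin.sum_univ_three]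
    ring
  simp only [e1]
  rw [integral_const_mul, hk]
  have e2 : ∫ v, 2 * (3 + γ) * (∫ w, ‖v - w‖ ^ γ * mu w) * (φ v * φ v)
      = 2 * (3 + γ) * ∫ v, (∫ w, ‖v - w‖ ^ γ * mu w) * φ v ^ 2 := by
    rw [← integral_const_mul]; congr 1; funext v; ring
  rw [e2]
  ring

/-- The energy density integral of an element of the energy space. -/
lemma normASq_emb (u : energySpace ρ) : normASq γ (emb ρ u) = ∫⁻ v, ENNReal.ofReal
    (‖u.1.snd v - mv (ρ.S v) (((1 / 2 : ℝ) * u.1.fst v) • v)‖ ^ 2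
      + ‖mv (ρ.S v) (((1 / 2 : ℝ) * u.1.fst v) • v)‖ ^ 2) := by
  rw [normASq_eq ρ (hasWeakGradient_emb ρ u)]
  congr 1; funext v
  rw [emb_apply, gradOf, map_sub, mv_mv, ρ.S_mul_R, mv_one]

/-- For a test function the A-norm is the squared second component plus (3+γ)∫(|·|^γ * μ)φ², which
is at most a multiple of ‖φ‖². -/
lemma exists_normASq_testSpace_le (hγ₁ : -3 < γ) (hγ₂ : γ < 0) :
    ∃ K, 0 ≤ K ∧ ∀ u ∈ testSpace ρ, normASq γ (emb ρ u) ≤ ENNReal.ofReal (K * ‖u‖ ^ 2) := by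
  obtain ⟨C, hC0, hC⟩ := exists_rpow_mu_bound hγ₁ hγ₂
  refine ⟨1 + (3 + γ) * C, by nlinarith, ?_⟩
  rintro u ⟨φ, hφ, hu⟩
  have hwg : HasWeakGradient (emb ρ u) (grad φ) :=
    (hasWeakGradient_grad (hφ.1.of_le (by simp))).congr_ae hu.symm EventuallyEq.rfl
  have hg : gradOf ρ u.1 =ᵐ[volume] grad φ := (hasWeakGradient_emb ρ u).unique hwg
  obtain ⟨hgm, r, hr0, hr1, hr2⟩ := hφ.grad_props
  have hX : MemLp (twist ρ 0 (grad φ)) 2 volume :=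
    memLp_twist ρ hr0 MemLp.zero hgm (fun v hv => rfl) hr2
  have hY : MemLp (twist ρ φ 0) 2 volume :=
    memLp_twist ρ hr0 hφ.memLp MemLp.zero hr1 (fun v hv => rfl)
  have hX2 := hX.integrable_norm_pow (by norm_num)
  have hY2 := hY.integrable_norm_pow (by norm_num)
  simp only at hX2 hY2
  have hXY : Integrable fun v => inner ℝ (twist ρ 0 (grad φ) v) (twist ρ φ 0 v) :=
    (hX.norm.integrable_mul hY.norm).mono'
      (hX.aestronglyMeasurable.inner hY.aestronglyMeasurable)
      (Eventually.of_forall fun v => norm_inner_le_norm _ _)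
  have e1 : normASq γ (emb ρ u)
      = ∫⁻ v, ENNReal.ofReal (‖twist ρ 0 (grad φ) v‖ ^ 2 + ‖twist ρ φ 0 v‖ ^ 2) := by
    rw [normASq_eq ρ hwg]
    refine lintegral_congr_ae ?_
    filter_upwards [hu] with v hv
    rw [twist_zero_left, twist_zero_right, hv]
  have e2 : ‖u.1.snd‖ ^ 2 = ∫ v, ‖twist ρ φ (grad φ) v‖ ^ 2 := by
    rw [← real_inner_self_eq_norm_sq, L2.inner_def]
    refine integral_congr_ae ?_
    filter_upwards [snd_ae_eq_twist ρ u.1, hg, hu] with v a b c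
    rw [emb_apply] at c
    rw [a, real_inner_self_eq_norm_sq, twist, twist, b, c]
  have e3 : ‖emb ρ u‖ ^ 2 = ∫ v, φ v ^ 2 := by
    rw [← real_inner_self_eq_norm_sq, L2.inner_def]
    refine integral_congr_ae ?_
    filter_upwards [hu] with v c
    rw [c, real_inner_self_eq_norm_sq, Real.norm_eq_abs, sq_abs]
  have hs1 : Integrable fun v => ‖twist ρ 0 (grad φ) v‖ ^ 2 + ‖twist ρ φ 0 v‖ ^ 2 := hX2.add hY2
  have e4 : ∫ v, ‖twist ρ φ (grad φ) v‖ ^ 2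
      = (∫ v, (‖twist ρ 0 (grad φ) v‖ ^ 2 + ‖twist ρ φ 0 v‖ ^ 2))
        + 2 * ∫ v, inner ℝ (twist ρ 0 (grad φ) v) (twist ρ φ 0 v) := by
    rw [← integral_const_mul, ← integral_add hs1 (hXY.const_mul 2)]
    congr 1; funext v
    rw [twist_eq_add ρ φ (grad φ), norm_add_sq_real]
    ring
  have e5 : |∫ v, (∫ w, ‖v - w‖ ^ γ * mu w) * φ v ^ 2| ≤ C * ∫ v, φ v ^ 2 := by
    rw [← integral_const_mul, ← Real.norm_eq_abs]
    refine norm_integral_le_of_norm_le (hφ.memLp.integrable_sq.const_mul C)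
      (Eventually.of_forall fun v => ?_)
    rw [norm_mul, Real.norm_eq_abs, Real.norm_of_nonneg (sq_nonneg _)]
    exact mul_le_mul_of_nonneg_right (hC v) (sq_nonneg _)
  rw [e1, ← ofReal_integral_eq_lintegral_ofReal hs1
    (Eventually.of_forall fun v => by positivity)]
  refine ENNReal.ofReal_le_ofReal ?_
  rw [norm_sq_energySpace, e2, e3, e4, integral_inner_twist ρ hγ₁ hγ₂ hφ]
  have h3 : 0 ≤ (3 + γ) * C := mul_nonneg (by linarith) hC0
  have h4 : ‖u.1.snd‖ ^ 2 = _ := e2.trans e4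
  rw [integral_inner_twist ρ hγ₁ hγ₂ hφ] at h4
  have h5 : 0 ≤ ∫ v, φ v ^ 2 := integral_nonneg fun v => sq_nonneg _
  have h6 := mul_le_mul_of_nonneg_left (abs_le.1 e5).2 (by linarith : (0 : ℝ) ≤ 3 + γ)
  nlinarith [sq_nonneg ‖u.1.snd‖, mul_nonneg h3 (sq_nonneg ‖u.1.snd‖)]

/-- Density of test functions and Fatou's lemma extend the bound. Integrability of the cross term is
never needed for a general element. -/
theorem exists_normASq_le (hγ₁ : -3 < γ) (hγ₂ : γ < 0) :
    ∃ K, 0 ≤ K ∧ ∀ u : energySpace ρ, normASq γ (emb ρ u) ≤ ENNReal.ofReal (K * ‖u‖ ^ 2) := by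
  obtain ⟨K, hK0, hK⟩ := exists_normASq_testSpace_le ρ hγ₁ hγ₂
  refine ⟨K, hK0, fun u => ?_⟩
  obtain ⟨w, hw, hwu⟩ := mem_closure_iff_seq_limit.1 (dense_testSpace ρ u)
  have h1 : Tendsto (fun n => (w n).1.fst) atTop (𝓝 u.1.fst) :=
    ((emb ρ).continuous.tendsto u).comp hwu
  -- Two successive subsequences give almost everywhere convergence of both components.
  obtain ⟨a, ha, ha'⟩ := (tendstoInMeasure_of_tendsto_Lp h1).exists_seq_tendsto_ae
  have h2 : Tendsto (fun n => (w (a n)).1.snd) atTop (𝓝 u.1.snd) :=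
    ((((WithLp.sndL 2 ℝ L2 LV).comp (energySpace ρ).subtypeL).continuous.tendsto u).comp
      hwu).comp ha.tendsto_atTop
  obtain ⟨c, hc, hc'⟩ := (tendstoInMeasure_of_tendsto_Lp h2).exists_seq_tendsto_ae
  set d : ℕ → energySpace ρ := fun n => w (a (c n)) with hd
  have hdu : Tendsto d atTop (𝓝 u) := hwu.comp (ha.tendsto_atTop.comp hc.tendsto_atTop)
  have hyc : ∀ v, Continuous fun t : ℝ => mv (ρ.S v) (((1 / 2 : ℝ) * t) • v) := fun v =>
    (LinearMap.continuous_of_finiteDimensional _).comp (by fun_prop)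
  set N : energySpace ρ → V3 → ℝ≥0∞ := fun u v => ENNReal.ofReal
    (‖u.1.snd v - mv (ρ.S v) (((1 / 2 : ℝ) * u.1.fst v) • v)‖ ^ 2
      + ‖mv (ρ.S v) (((1 / 2 : ℝ) * u.1.fst v) • v)‖ ^ 2) with hN
  have hNm : ∀ n, AEMeasurable (N (d n)) volume := by
    intro n
    have h3 : AEStronglyMeasurable
        (fun v => mv (ρ.S v) (((1 / 2 : ℝ) * (d n).1.fst v) • v)) volume :=
      (aestronglyMeasurable_twist ρ (G := 0) (Lp.aestronglyMeasurable (d n).1.fst)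
        aestronglyMeasurable_zero).congr (Eventually.of_forall fun v => twist_zero_right ρ _ v)
    exact ((((Lp.aestronglyMeasurable _).sub h3).norm.pow 2).add
      (h3.norm.pow 2)).aemeasurable.ennreal_ofReal
  have hlim : ∀ᵐ v, Tendsto (fun n => N (d n) v) atTop (𝓝 (N u v)) := by
    filter_upwards [ha', hc'] with v b1 b2
    have b3 : Tendsto (fun n => mv (ρ.S v) (((1 / 2 : ℝ) * (d n).1.fst v) • v)) atTop
        (𝓝 (mv (ρ.S v) (((1 / 2 : ℝ) * u.1.fst v) • v))) :=
      ((hyc v).tendsto (u.1.fst v)).comp (b1.comp hc.tendsto_atTop)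
    exact ENNReal.tendsto_ofReal (((b2.sub b3).norm.pow 2).add (b3.norm.pow 2))
  calc normASq γ (emb ρ u) = ∫⁻ v, N u v := normASq_emb ρ u
    _ = ∫⁻ v, liminf (fun n => N (d n) v) atTop :=
        lintegral_congr_ae (hlim.mono fun v hv => hv.liminf_eq.symm)
    _ ≤ liminf (fun n => ∫⁻ v, N (d n) v) atTop := lintegral_liminf_le' hNm
    _ ≤ liminf (fun n => ENNReal.ofReal (K * ‖d n‖ ^ 2)) atTop :=
        liminf_le_liminf (Eventually.of_forall fun n =>
          (normASq_emb ρ (d n)).symm.trans_le (hK _ (hw _)))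
    _ = ENNReal.ofReal (K * ‖u‖ ^ 2) :=
        (ENNReal.tendsto_ofReal ((hdu.norm.pow 2).const_mul K)).liminf_eq

end Landau

/-! ### The nonlocal part as a bounded form on L² -/

namespace Landau

open Filter Topology

variable {γ : ℝ}

lemma one_add_norm_mul_sqrtMu_le (v : V3) : (1 + ‖v‖) * sqrtMu v ≤ 2 * 24 ^ 3 * gau v := by
  have h6 := sqrtMu_mul_pow_le v
  have h7 : 1 + ‖v‖ ≤ 2 * (1 + ‖v‖ ^ 2) ^ 3 := by
    have : (1 + ‖v‖ ^ 2) ^ 1 ≤ (1 + ‖v‖ ^ 2) ^ 3 :=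
      pow_le_pow_right₀ (by nlinarith [sq_nonneg ‖v‖]) (by norm_num)
    nlinarith [sq_nonneg (‖v‖ - 1)]
  nlinarith [mul_le_mul_of_nonneg_right h7 (sqrtMu_pos v).le]

/-- The constant 17 is 8 + 9: the two scalar terms give at most 6 + 2, since 0 < 3 + γ < 3, and the
double sum has nine terms. -/
lemma abs_ibpKernel_le (hγ₁ : -3 < γ) (hγ₂ : γ < 0) (v w : V3) :
    |ibpKernel γ v w| ≤ 17 * kmaj γ (v - w) * ((1 + ‖v‖) * (1 + ‖w‖)) := by
  have h0 : 0 ≤ ‖v - w‖ ^ γ := Real.rpow_nonneg (norm_nonneg _) γ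
  have hk := kmaj_nonneg γ (v - w)
  have h1 : ‖v - w‖ ^ γ ≤ kmaj γ (v - w) := by unfold kmaj; nlinarith [sq_nonneg ‖v - w‖]
  have h2 : ‖v - w‖ ^ 2 * ‖v - w‖ ^ γ ≤ kmaj γ (v - w) := by
    have := norm_sq_mul_rpow_le hγ₂ (v - w)
    unfold kmaj; linarith
  have h2' : 0 ≤ ‖v - w‖ ^ 2 * ‖v - w‖ ^ γ := by positivity
  have h3 : |∑ j, ∑ k, aCoef γ j k (v - w) * v j * w k|
      ≤ 9 * (kmaj γ (v - w) * (‖v‖ * ‖w‖)) := by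
    have : ∀ j k, |aCoef γ j k (v - w) * v j * w k| ≤ kmaj γ (v - w) * (‖v‖ * ‖w‖) := by
      intro j k
      rw [abs_mul, abs_mul, mul_assoc]
      have := abs_aCoef_le_kmaj hγ₂ j k (v - w)
      rw [one_mul] at this
      exact mul_le_mul this (mul_le_mul (abs_apply_le _ _) (abs_apply_le _ _) (abs_nonneg _)
        (norm_nonneg _)) (by positivity) hk
    refine (Finset.abs_sum_le_sum_abs _ _).trans ((Finset.sum_le_sum fun j _ =>
      (Finset.abs_sum_le_sum_abs _ _).trans (Finset.sum_le_sum fun k _ => this j k)).trans_eq ?_)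
    simp; ring
  have hp : 1 ≤ (1 + ‖v‖) * (1 + ‖w‖) := by
    nlinarith [norm_nonneg v, norm_nonneg w, mul_nonneg (norm_nonneg v) (norm_nonneg w)]
  have hq : ‖v‖ * ‖w‖ ≤ (1 + ‖v‖) * (1 + ‖w‖) := by nlinarith [norm_nonneg v, norm_nonneg w]
  have h4 := mul_le_mul_of_nonneg_left hp hk
  have h5 := mul_le_mul_of_nonneg_left hq hk
  have h6 : |2 * (3 + γ) * ‖v - w‖ ^ γ - 2 * (‖v - w‖ ^ 2 * ‖v - w‖ ^ γ)|
      ≤ 8 * kmaj γ (v - w) := by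
    rw [abs_le]; constructor <;> nlinarith
  rw [ibpKernel]
  refine (abs_add_le _ _).trans ?_
  linarith

lemma one_add_sq_mul_gau_le (v : V3) : (1 + ‖v‖ ^ 2) * gau v ≤ 8 := by
  have h1 := Real.add_one_le_exp (‖v‖ ^ 2 / 8)
  rw [gau, Real.exp_neg, ← div_eq_mul_inv, div_le_iff₀ (Real.exp_pos _)]
  nlinarith [sq_nonneg ‖v‖]

/-- The bilinear form of the nonlocal part of the linearized operator. -/
noncomputable def coupling (γ : ℝ) (f h : V3 → ℝ) : ℝ :=
  ∫ x : V3 × V3, ibpKernel γ x.1 x.2 * (sqrtMu x.1 * h x.1) * (sqrtMu x.2 * f x.2)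
    ∂(volume.prod volume)

lemma exists_kmaj_sq_bound (hγ₁ : -3 < γ) (hγ₂ : γ < 0) : ∃ C, 0 ≤ C ∧ ∀ f : V3 → ℝ,
    MemLp f 2 volume →
    Integrable (fun x : V3 × V3 => kmaj γ (x.1 - x.2) * gau x.1 * (gau x.2 * f x.2 ^ 2))
      (volume.prod volume) ∧
    ∫ x : V3 × V3, kmaj γ (x.1 - x.2) * gau x.1 * (gau x.2 * f x.2 ^ 2) ∂(volume.prod volume)
      ≤ C * ∫ v, f v ^ 2 := by
  obtain ⟨C, hC0, hC⟩ := exists_kmaj_bound hγ₁ hγ₂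
  refine ⟨C * 8, by positivity, fun f hf => ?_⟩
  have hq : AEStronglyMeasurable (fun w => gau w * f w ^ 2) volume :=
    continuous_gau.aestronglyMeasurable.mul (hf.aestronglyMeasurable.pow 2)
  have hi : Integrable (fun x : V3 × V3 => kmaj γ (x.1 - x.2) * gau x.1 * (gau x.2 * f x.2 ^ 2))
      (volume.prod volume) := by
    refine integrable_prod_kernel (c := 1) (c' := 1) hγ₁ hγ₂ (measurable_kmaj γ) (fun z => ?_)
      continuous_gau.aestronglyMeasurable (Eventually.of_forall fun v => ?_) hq ?_
    · rw [abs_of_nonneg (kmaj_nonneg γ z), one_mul]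
    · rw [abs_of_pos (gau_pos v), one_mul]
    · refine (hf.integrable_sq.const_mul 8).mono'
        ((by fun_prop : Continuous fun w : V3 => 1 + ‖w‖ ^ 2).aestronglyMeasurable.mul hq)
        (Eventually.of_forall fun w => ?_)
      have := gau_pos w
      rw [Real.norm_of_nonneg (by positivity), ← mul_assoc]
      exact mul_le_mul_of_nonneg_right (one_add_sq_mul_gau_le w) (sq_nonneg _)
  refine ⟨hi, ?_⟩
  rw [integral_prod_symm _ hi, ← integral_const_mul]
  refine integral_mono_of_nonneg (Eventually.of_forall fun w => integral_nonneg fun v => ?_)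
    (hf.integrable_sq.const_mul _) (Eventually.of_forall fun w => ?_)
  · have := gau_pos v
    have := gau_pos w
    have := kmaj_nonneg γ (v - w)
    dsimp only
    positivity
  · dsimp only
    rw [integral_mul_const]
    have := gau_pos w
    calc (∫ v, kmaj γ (v - w) * gau v) * (gau w * f w ^ 2)
        ≤ C * (1 + ‖w‖ ^ 2) * (gau w * f w ^ 2) :=
          mul_le_mul_of_nonneg_right (hC w).2 (by positivity)
      _ = C * ((1 + ‖w‖ ^ 2) * gau w) * f w ^ 2 := by ring
      _ ≤ C * 8 * f w ^ 2 := mul_le_mul_of_nonneg_right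
          (mul_le_mul_of_nonneg_left (one_add_sq_mul_gau_le w) hC0) (sq_nonneg _)

lemma measurable_ibpKernel (γ : ℝ) : Measurable fun x : V3 × V3 => ibpKernel γ x.1 x.2 := by
  unfold ibpKernel
  have := measurable_aCoef γ
  refine Measurable.add (by fun_prop) ?_
  refine Finset.measurable_fun_sum _ fun j _ => Finset.measurable_fun_sum _ fun k _ => ?_
  have h := (this j k).comp (measurable_fst.sub measurable_snd : Measurable
    fun x : V3 × V3 => x.1 - x.2)
  simp only [Function.comp_def] at h
  fun_prop

/-- Schur-type estimate: the factors √μ absorb the polynomial growth of the kernel and leave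
Gaussian weights in both variables. Each of the squares f² and h² is then integrated against the
kernel in the other variable. -/
lemma exists_coupling_bound (hγ₁ : -3 < γ) (hγ₂ : γ < 0) : ∃ C, 0 ≤ C ∧ ∀ f h : V3 → ℝ,
    MemLp f 2 volume → MemLp h 2 volume →
    Integrable (fun x : V3 × V3 => ibpKernel γ x.1 x.2 * (sqrtMu x.1 * h x.1)
      * (sqrtMu x.2 * f x.2)) (volume.prod volume) ∧
    |coupling γ f h| ≤ C * ((∫ v, f v ^ 2) + ∫ v, h v ^ 2) := by
  obtain ⟨C, hC0, hC⟩ := exists_kmaj_sq_bound hγ₁ hγ₂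
  set c : ℝ := 17 * (2 * 24 ^ 3) ^ 2 with hc
  have hc0 : 0 ≤ c := by positivity
  refine ⟨c * C, by positivity, fun f h hf hh => ?_⟩
  obtain ⟨i1, b1⟩ := hC f hf
  obtain ⟨i2, b2⟩ := hC h hh
  have i2' := i2.swap
  have b2' : ∫ x : V3 × V3, kmaj γ (x.2 - x.1) * gau x.2 * (gau x.1 * h x.1 ^ 2)
      ∂(volume.prod volume) ≤ C * ∫ v, h v ^ 2 := by
    rw [← integral_prod_swap] at b2
    exact b2
  have hm : AEStronglyMeasurable (fun x : V3 × V3 => ibpKernel γ x.1 x.2 * (sqrtMu x.1 * h x.1)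
      * (sqrtMu x.2 * f x.2)) (volume.prod volume) :=
    ((measurable_ibpKernel γ).aestronglyMeasurable.mul
      (continuous_sqrtMu.aestronglyMeasurable.mul hh.aestronglyMeasurable).comp_fst).mul
      (continuous_sqrtMu.aestronglyMeasurable.mul hf.aestronglyMeasurable).comp_snd
  have hb : ∀ x : V3 × V3, ‖ibpKernel γ x.1 x.2 * (sqrtMu x.1 * h x.1) * (sqrtMu x.2 * f x.2)‖
      ≤ c * (kmaj γ (x.1 - x.2) * gau x.1 * (gau x.2 * f x.2 ^ 2))
        + c * (kmaj γ (x.2 - x.1) * gau x.2 * (gau x.1 * h x.1 ^ 2)) := by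
    rintro ⟨v, w⟩
    have hv := sqrtMu_pos v
    have hw := sqrtMu_pos w
    have gv := gau_pos v
    have gw := gau_pos w
    have hk := kmaj_nonneg γ (v - w)
    have e1 : |h v| * |f w| ≤ f w ^ 2 + h v ^ 2 := by
      rw [← sq_abs (f w), ← sq_abs (h v)]
      nlinarith [sq_nonneg (|h v| - |f w|), sq_nonneg |h v|, sq_nonneg |f w|]
    have e2 : ((1 + ‖v‖) * sqrtMu v) * ((1 + ‖w‖) * sqrtMu w)
        ≤ (2 * 24 ^ 3 * gau v) * (2 * 24 ^ 3 * gau w) :=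
      mul_le_mul (one_add_norm_mul_sqrtMu_le v) (one_add_norm_mul_sqrtMu_le w)
        (by positivity) (by positivity)
    rw [kmaj_sub_comm γ w v, norm_mul, norm_mul, norm_mul, norm_mul, Real.norm_of_nonneg hv.le,
      Real.norm_of_nonneg hw.le]
    simp only [Real.norm_eq_abs]
    calc |ibpKernel γ v w| * (sqrtMu v * |h v|) * (sqrtMu w * |f w|)
        ≤ 17 * kmaj γ (v - w) * ((1 + ‖v‖) * (1 + ‖w‖)) * (sqrtMu v * |h v|)
          * (sqrtMu w * |f w|) := by
          have := abs_ibpKernel_le hγ₁ hγ₂ v w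
          gcongr
      _ = 17 * kmaj γ (v - w) * (((1 + ‖v‖) * sqrtMu v) * ((1 + ‖w‖) * sqrtMu w))
          * (|h v| * |f w|) := by ring
      _ ≤ 17 * kmaj γ (v - w) * ((2 * 24 ^ 3 * gau v) * (2 * 24 ^ 3 * gau w))
          * (f w ^ 2 + h v ^ 2) := by gcongr
      _ = _ := by rw [hc]; ring
  have hI := (i1.const_mul c).add (i2'.const_mul c)
  refine ⟨hI.mono' hm (Eventually.of_forall hb), ?_⟩
  rw [coupling, ← Real.norm_eq_abs]
  refine (norm_integral_le_of_norm_le hI (Eventually.of_forall hb)).trans ?_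
  have e : ∫ x, ((fun x : V3 × V3 => c * (kmaj γ (x.1 - x.2) * gau x.1 * (gau x.2 * f x.2 ^ 2)))
      + fun x : V3 × V3 => c * (kmaj γ (x.2 - x.1) * gau x.2 * (gau x.1 * h x.1 ^ 2))) x
      ∂(volume.prod volume) = _ := integral_add (i1.const_mul c) (i2'.const_mul c)
  refine e.trans_le ?_
  rw [integral_const_mul, integral_const_mul]
  nlinarith [mul_le_mul_of_nonneg_left b1 hc0, mul_le_mul_of_nonneg_left b2' hc0]

lemma integral_sq_L2 (f : L2) : ∫ v, f v ^ 2 = ‖f‖ ^ 2 := by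
  rw [← real_inner_self_eq_norm_sq, L2.inner_def]
  congr 1; funext v
  rw [real_inner_self_eq_norm_sq, Real.norm_eq_abs, sq_abs]

lemma coupling_congr {f f' h h' : V3 → ℝ} (hf : f =ᵐ[volume] f') (hh : h =ᵐ[volume] h') :
    coupling γ f h = coupling γ f' h' := by
  refine integral_congr_ae ?_
  filter_upwards [Measure.quasiMeasurePreserving_fst.ae_eq_comp hh,
    Measure.quasiMeasurePreserving_snd.ae_eq_comp hf] with x a b
  simp only [Function.comp_apply] at a b
  rw [a, b]

lemma coupling_add_left (hγ₁ : -3 < γ) (hγ₂ : γ < 0) (f g h : L2) :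
    coupling γ (f + g : L2) h = coupling γ f h + coupling γ g h := by
  obtain ⟨C, -, hC⟩ := exists_coupling_bound hγ₁ hγ₂
  rw [coupling_congr (Lp.coeFn_add f g) (EventuallyEq.refl _ _), coupling, coupling, coupling,
    ← integral_add (hC f h (Lp.memLp f) (Lp.memLp h)).1 (hC g h (Lp.memLp g) (Lp.memLp h)).1]
  congr 1; funext x
  simp only [Pi.add_apply]; ring

lemma coupling_add_right (hγ₁ : -3 < γ) (hγ₂ : γ < 0) (f g h : L2) :
    coupling γ f (g + h : L2) = coupling γ f g + coupling γ f h := by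
  obtain ⟨C, -, hC⟩ := exists_coupling_bound hγ₁ hγ₂
  rw [coupling_congr (EventuallyEq.refl _ _) (Lp.coeFn_add g h), coupling, coupling, coupling,
    ← integral_add (hC f g (Lp.memLp f) (Lp.memLp g)).1 (hC f h (Lp.memLp f) (Lp.memLp h)).1]
  congr 1; funext x
  simp only [Pi.add_apply]; ring

lemma coupling_smul_left (c : ℝ) (f h : L2) :
    coupling γ (c • f : L2) h = c * coupling γ f h := by
  rw [coupling_congr (Lp.coeFn_smul c f) (EventuallyEq.refl _ _), coupling, coupling,
    ← integral_const_mul]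
  congr 1; funext x
  simp only [Pi.smul_apply, smul_eq_mul]; ring

lemma coupling_smul_right (c : ℝ) (f h : L2) :
    coupling γ f (c • h : L2) = c * coupling γ f h := by
  rw [coupling_congr (EventuallyEq.refl _ _) (Lp.coeFn_smul c h), coupling, coupling,
    ← integral_const_mul]
  congr 1; funext x
  simp only [Pi.smul_apply, smul_eq_mul]; ring

/-- Bilinearity: normalizing f and h turns the bound by ‖f‖² + ‖h‖² into one by the product. -/
lemma exists_coupling_bound' (hγ₁ : -3 < γ) (hγ₂ : γ < 0) :
    ∃ C, 0 ≤ C ∧ ∀ f h : L2, |coupling γ f h| ≤ C * ‖f‖ * ‖h‖ := by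
  obtain ⟨C, hC0, hC⟩ := exists_coupling_bound hγ₁ hγ₂
  have hC' : ∀ f h : L2, |coupling γ f h| ≤ C * (‖f‖ ^ 2 + ‖h‖ ^ 2) := fun f h => by
    have := (hC f h (Lp.memLp f) (Lp.memLp h)).2
    rwa [integral_sq_L2, integral_sq_L2] at this
  refine ⟨2 * C, by positivity, fun f h => ?_⟩
  rcases eq_or_ne f 0 with rfl | hf
  · have := coupling_smul_left (γ := γ) 0 0 h
    simp only [zero_smul, zero_mul] at this
    rw [this, abs_zero, norm_zero]
    simp
  rcases eq_or_ne h 0 with rfl | hh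
  · have := coupling_smul_right (γ := γ) 0 f 0
    simp only [zero_smul, zero_mul] at this
    rw [this, abs_zero, norm_zero]
    simp
  have hf' : 0 < ‖f‖ := norm_pos_iff.2 hf
  have hh' : 0 < ‖h‖ := norm_pos_iff.2 hh
  have h1 := hC' (‖f‖⁻¹ • f) (‖h‖⁻¹ • h)
  rw [coupling_smul_left, coupling_smul_right, norm_smul, norm_smul, norm_inv, norm_inv,
    norm_norm, norm_norm, inv_mul_cancel₀ hf'.ne', inv_mul_cancel₀ hh'.ne', abs_mul, abs_mul,
    abs_of_pos (inv_pos.2 hf'), abs_of_pos (inv_pos.2 hh'), inv_mul_le_iff₀ hf',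
    inv_mul_le_iff₀ hh'] at h1
  linarith

/-- The bilinear form of the linearized operator. -/
theorem exists_energyForm (hγ₁ : -3 < γ) (hγ₂ : γ < 0) (ρ : Root γ) :
    ∃ (b : energySpace ρ →L[ℝ] energySpace ρ →L[ℝ] ℝ) (B C : ℝ), 0 ≤ C ∧
      (∀ u w, b u w = inner ℝ u.1.snd w.1.snd - coupling γ (emb ρ u) (emb ρ w)) ∧
      (∀ u w, |b u w| ≤ B * ‖u‖ * ‖w‖) ∧ ∀ u, ‖u‖ ^ 2 ≤ b u u + C * ‖emb ρ u‖ ^ 2 := by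
  obtain ⟨C, hC0, hC⟩ := exists_coupling_bound' hγ₁ hγ₂
  set β : energySpace ρ →ₗ[ℝ] energySpace ρ →ₗ[ℝ] ℝ := LinearMap.mk₂ ℝ
    (fun u w => inner ℝ u.1.snd w.1.snd - coupling γ (emb ρ u) (emb ρ w))
    (fun u u' w => by
      have : (u + u').1.snd = u.1.snd + u'.1.snd := rfl
      rw [this, inner_add_left, map_add, coupling_add_left hγ₁ hγ₂]; ring)
    (fun c u w => by
      have : (c • u).1.snd = c • u.1.snd := rfl
      rw [this, real_inner_smul_left, map_smul, coupling_smul_left, smul_eq_mul]; ring)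
    (fun u w w' => by
      have : (w + w').1.snd = w.1.snd + w'.1.snd := rfl
      rw [this, inner_add_right, map_add, coupling_add_right hγ₁ hγ₂]; ring)
    (fun c u w => by
      have : (c • w).1.snd = c • w.1.snd := rfl
      rw [this, real_inner_smul_right, map_smul, coupling_smul_right, smul_eq_mul]; ring) with hβ
  have hfst : ∀ u : energySpace ρ, ‖emb ρ u‖ ≤ ‖u‖ := fun u => by
    refine abs_le_of_sq_le_sq' ?_ (norm_nonneg _) |>.2
    rw [norm_sq_energySpace]; linarith [sq_nonneg ‖u.1.snd‖]
  have hsnd : ∀ u : energySpace ρ, ‖u.1.snd‖ ≤ ‖u‖ := fun u => by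
    refine abs_le_of_sq_le_sq' ?_ (norm_nonneg _) |>.2
    rw [norm_sq_energySpace ρ u]; linarith [sq_nonneg ‖emb ρ u‖]
  have hb : ∀ u w, ‖β u w‖ ≤ (1 + C) * ‖u‖ * ‖w‖ := by
    intro u w
    have h1 := abs_real_inner_le_norm u.1.snd w.1.snd
    have h2 := hC (emb ρ u) (emb ρ w)
    have h3 : ‖u.1.snd‖ * ‖w.1.snd‖ ≤ ‖u‖ * ‖w‖ :=
      mul_le_mul (hsnd u) (hsnd w) (norm_nonneg _) (norm_nonneg _)
    have h4 : ‖emb ρ u‖ * ‖emb ρ w‖ ≤ ‖u‖ * ‖w‖ :=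
      mul_le_mul (hfst u) (hfst w) (norm_nonneg _) (norm_nonneg _)
    have h5 := mul_le_mul_of_nonneg_left h4 hC0
    have h6 := abs_sub (inner ℝ u.1.snd w.1.snd) (coupling γ (emb ρ u) (emb ρ w))
    rw [Real.norm_eq_abs]
    change |inner ℝ u.1.snd w.1.snd - coupling γ (emb ρ u) (emb ρ w)| ≤ _
    linarith
  -- In the coercivity bound, C compensates the nonlocal part and the additional 1 supplies the L²
  -- component of the norm.
  refine ⟨β.mkContinuous₂ (1 + C) hb, 1 + C, 1 + C, by positivity, fun u w => rfl, hb,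
    fun u => ?_⟩
  have h2 := (abs_le.1 (hC (emb ρ u) (emb ρ u))).2
  have h3 : β.mkContinuous₂ (1 + C) hb u u
    = inner ℝ u.1.snd u.1.snd - coupling γ (emb ρ u) (emb ρ u) := rfl
  rw [h3, real_inner_self_eq_norm_sq, norm_sq_energySpace]
  nlinarith

end Landau

/-! ### The local part of the linearized operator -/

namespace Landau

open Filter Topology

variable {γ : ℝ} (ρ : Root γ)

/-- The twisted derivative `∂ⱼφ + vⱼ φ / 2`. -/
noncomputable def twd (φ : V3 → ℝ) (j : Fin 3) (v : V3) : ℝ :=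
  fderiv ℝ φ v (basisVec j) + 1 / 2 * v j * φ v

lemma isTest_twd {φ : V3 → ℝ} (hφ : IsTest φ) (j : Fin 3) : IsTest (twd φ j) :=
  (hφ.fderiv_apply _).add (hφ.mul_left (contDiff_const.mul (contDiff_top_coord j)))

/-- The twisted gradient of an element of the energy space. -/
noncomputable def dvec (u : Pair) (v : V3) : V3 := mv (ρ.R v) (u.snd v)

lemma gradOf_eq_dvec (u : Pair) (v : V3) (j : Fin 3) :
    gradOf ρ u v j = dvec ρ u v j - 1 / 2 * u.fst v * v j := gradOf_coord ρ u v j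

lemma isTest_inv_sqrtMu_mul {φ : V3 → ℝ} (hφ : IsTest φ) :
    IsTest fun v => (sqrtMu v)⁻¹ * φ v :=
  hφ.mul_left (contDiff_sqrtMu.inv fun v => (sqrtMu_pos v).ne')

lemma differentiable_sqrtMu : Differentiable ℝ sqrtMu := contDiff_sqrtMu.differentiable (by simp)

/-- Conjugation by √μ turns ∂ⱼ into ∂ⱼ + vⱼ/2; this is why the energy space is built on the twisted
gradient. -/
lemma fderiv_inv_sqrtMu_mul {φ : V3 → ℝ} (hφ : IsTest φ) (j : Fin 3) (v : V3) :
    fderiv ℝ (fun v => (sqrtMu v)⁻¹ * φ v) v (basisVec j) = (sqrtMu v)⁻¹ * twd φ j v := by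
  set ψ : V3 → ℝ := fun v => (sqrtMu v)⁻¹ * φ v with hψ
  have hψt : IsTest ψ := isTest_inv_sqrtMu_mul hφ
  have h0 := (sqrtMu_pos v).ne'
  have e : φ = fun v => sqrtMu v * ψ v := by
    funext v; simp only [hψ]; rw [mul_inv_cancel_left₀ (sqrtMu_pos v).ne']
  have h1 : fderiv ℝ φ v (basisVec j)
      = sqrtMu v * fderiv ℝ ψ v (basisVec j) - v j / 2 * sqrtMu v * ψ v := by
    conv_lhs => rw [e]
    rw [fderiv_fun_mul (differentiable_sqrtMu v) (hψt.1.differentiable (by simp) v)]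
    simp only [_root_.add_apply, _root_.smul_apply, smul_eq_mul, fderiv_sqrtMu]
    ring
  rw [twd, h1, congrFun e v]
  field_simp
  ring

/-- The counterpart for √μφ: it identifies the combination ∂ⱼF + vⱼF of the double integration by
parts with a weighted twisted derivative. -/
lemma fderiv_sqrtMu_mul {φ : V3 → ℝ} (hφ : IsTest φ) (j : Fin 3) (v : V3) :
    fderiv ℝ (fun v => sqrtMu v * φ v) v (basisVec j) + v j * (sqrtMu v * φ v)
      = sqrtMu v * twd φ j v := by
  rw [fderiv_fun_mul (differentiable_sqrtMu v) (hφ.1.differentiable (by simp) v), twd]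
  simp only [_root_.add_apply, _root_.smul_apply, smul_eq_mul, fderiv_sqrtMu]
  ring

lemma weakGrad_sqrtMu_mul (u : energySpace ρ) : ∀ᵐ v, ∀ k,
    weakGrad (fun v => sqrtMu v * emb ρ u v) v k
      = sqrtMu v * (dvec ρ u.1 v k - emb ρ u v * v k) := by
  have := ((hasWeakGradient_emb ρ u).mul_smooth contDiff_sqrtMu).weakGrad_ae_eq
  filter_upwards [this] with v hv k
  rw [hv]
  simp only [PiLp.add_apply, PiLp.smul_apply, smul_eq_mul, grad_coord, fderiv_sqrtMu,
    gradOf_eq_dvec, emb_apply]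
  ring

lemma weakGrad_mu : ∀ᵐ v, ∀ k, weakGrad (fun v => sqrtMu v * sqrtMu v) v k = -(v k * mu v) := by
  simp only [sqrtMu_mul_self]
  have := (hasWeakGradient_grad (contDiff_mu.of_le (by simp) : ContDiff ℝ 1 mu)).weakGrad_ae_eq
  filter_upwards [this] with v hv k
  change weakGrad mu v k = _
  rw [hv, grad_coord, fderiv_mu]

lemma sum_aBar_mul_coord (hγ₁ : -3 < γ) (hγ₂ : γ < 0) (j : Fin 3) (v : V3) :
    ∑ k, aBar γ j k v * v k = ∑ k, ∫ w, aCoef γ j k (v - w) * (w k * mu w) := by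
  have i1 := fun k => (integrable_aCoef_mul_mu hγ₁ hγ₂ j k v).mul_const (v k)
  have i2 := fun k => (isKernel_aCoef hγ₂ j k).integrable_mul hγ₁ hγ₂ (muDecay_coord_mu k) v
  simp only [aBar, ← integral_mul_const]
  rw [← integral_finsetSum _ fun k _ => i1 k, ← integral_finsetSum _ fun k _ => i2 k]
  congr 1
  funext w
  have := sum_aCoef_sub_mul γ j v w
  calc _ = (∑ k, aCoef γ j k (v - w) * v k) * mu w := by
        rw [Finset.sum_mul]; exact Finset.sum_congr rfl fun k _ => by ring
    _ = _ := by
        rw [← this, Finset.sum_mul]; exact Finset.sum_congr rfl fun k _ => by ring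

/-- The derivative of √μf leaves a drift -v_k f, and the derivative of μ a drift w_k f. Under the
kernel a(v - w) they cancel, and only the twisted gradient remains. -/
lemma flux_local (hγ₁ : -3 < γ) (hγ₂ : γ < 0) (u : energySpace ρ) (j : Fin 3) :
    ∀ᵐ v, flux γ (fun v => sqrtMu v * sqrtMu v) (fun v => sqrtMu v * emb ρ u v) j v
      = sqrtMu v * ∑ k, aBar γ j k v * dvec ρ u.1 v k := by
  filter_upwards [weakGrad_sqrtMu_mul ρ u] with v hv
  have e1 : ∀ k, ∫ w, aCoef γ j k (v - w) * ((sqrtMu w * sqrtMu w)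
      * weakGrad (fun v => sqrtMu v * emb ρ u v) v k
      - weakGrad (fun v => sqrtMu v * sqrtMu v) w k * (sqrtMu v * emb ρ u v))
      = aBar γ j k v * (sqrtMu v * (dvec ρ u.1 v k - emb ρ u v * v k))
        + (∫ w, aCoef γ j k (v - w) * (w k * mu w)) * (sqrtMu v * emb ρ u v) := by
    intro k
    rw [aBar, ← integral_mul_const, ← integral_mul_const,
      ← integral_add ((integrable_aCoef_mul_mu hγ₁ hγ₂ j k v).mul_const _)
        (((isKernel_aCoef hγ₂ j k).integrable_mul hγ₁ hγ₂ (muDecay_coord_mu k) v).mul_const _)]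
    refine integral_congr_ae ?_
    filter_upwards [weakGrad_mu] with w hw
    rw [hv, hw, sqrtMu_mul_self]
    ring
  rw [flux, Finset.sum_congr rfl fun k _ => e1 k, Finset.sum_add_distrib, ← Finset.sum_mul,
    ← sum_aBar_mul_coord hγ₁ hγ₂, Finset.sum_mul, ← Finset.sum_add_distrib, Finset.mul_sum]
  exact Finset.sum_congr rfl fun k _ => by ring

lemma locallyIntegrable_dvec (u : Pair) (k : Fin 3) :
    LocallyIntegrable (fun v => dvec ρ u v k) volume := by
  have h1 := locallyIntegrable_coord (locallyIntegrable_gradOf ρ u) k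
  have h2 := LocallyIntegrable.continuous_mul' (locallyIntegrable_L2 u.fst)
    (by fun_prop : Continuous fun v : V3 => 1 / 2 * v k)
  refine (h1.add h2).congr (Eventually.of_forall fun v => ?_)
  rw [Pi.add_apply, gradOf_eq_dvec]
  ring

lemma locallyIntegrable_aBar_mul (hγ₁ : -3 < γ) (hγ₂ : γ < 0) (j k : Fin 3) {g : V3 → ℝ}
    (hg : LocallyIntegrable g volume) :
    LocallyIntegrable (fun v => aBar γ j k v * g v) volume := by
  obtain ⟨C, hC, hb⟩ := exists_abs_aBar_le hγ₁ hγ₂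
  refine (LocallyIntegrable.continuous_mul' hg
    (by fun_prop : Continuous fun v : V3 => C * (1 + ‖v‖ ^ 2))).mono
    ((measurable_aBar γ j k).aestronglyMeasurable.mul hg.aestronglyMeasurable)
    (Eventually.of_forall fun v => ?_)
  rw [norm_mul, norm_mul, Real.norm_eq_abs, Real.norm_of_nonneg (by positivity : (0 : ℝ) ≤ C * _)]
  exact mul_le_mul_of_nonneg_right (hb j k v) (norm_nonneg _)

lemma snd_ae_eq_twist_test {w : energySpace ρ} {φ : V3 → ℝ} (hφ : IsTest φ)
    (hw : emb ρ w =ᵐ[volume] φ) : ∀ᵐ v, w.1.snd v = twist ρ φ (grad φ) v ∧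
      ∀ k, dvec ρ w.1 v k = twd φ k v := by
  have hwg : HasWeakGradient (emb ρ w) (grad φ) :=
    (hasWeakGradient_grad (hφ.1.of_le (by simp))).congr_ae hw.symm EventuallyEq.rfl
  filter_upwards [snd_ae_eq_twist ρ w.1, (hasWeakGradient_emb ρ w).unique hwg, hw] with v a b c
  rw [emb_apply] at c
  have h1 : w.1.snd v = twist ρ φ (grad φ) v := by rw [a, twist, twist, b, c]
  refine ⟨h1, fun k => ?_⟩
  rw [dvec, h1, twist, mv_mv, ρ.R_mul_S, mv_one, twd]
  simp only [PiLp.add_apply, PiLp.smul_apply, smul_eq_mul, grad_coord]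
  ring

/-- The local part of the linearized operator. -/
lemma pairGamma_local (hγ₁ : -3 < γ) (hγ₂ : γ < 0) (u w : energySpace ρ) {φ : V3 → ℝ}
    (hφ : IsTest φ) (hw : emb ρ w =ᵐ[volume] φ) :
    -pairGamma γ sqrtMu (emb ρ u) φ = inner ℝ u.1.snd w.1.snd := by
  have e1 : ∀ j, ∫ v, flux γ (fun v => sqrtMu v * sqrtMu v) (fun v => sqrtMu v * emb ρ u v) j v
      * fderiv ℝ (fun v => (sqrtMu v)⁻¹ * φ v) v (basisVec j)
      = ∫ v, (∑ k, aBar γ j k v * dvec ρ u.1 v k) * twd φ j v := by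
    intro j
    refine integral_congr_ae ?_
    filter_upwards [flux_local ρ hγ₁ hγ₂ u j] with v hv
    rw [hv, fderiv_inv_sqrtMu_mul hφ]
    have := (sqrtMu_pos v).ne'
    field_simp
  have i1 : ∀ j, Integrable fun v => (∑ k, aBar γ j k v * dvec ρ u.1 v k) * twd φ j v := by
    intro j
    have : Integrable fun v => ∑ k, (aBar γ j k v * dvec ρ u.1 v k) * twd φ j v :=
      integrable_finsetSum _ fun k _ => (isTest_twd hφ j).integrable_mul
        (locallyIntegrable_aBar_mul hγ₁ hγ₂ j k (locallyIntegrable_dvec ρ u.1 k))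
    refine this.congr (Eventually.of_forall fun v => ?_)
    simp only [Finset.sum_mul]
  rw [pairGamma, pairQ, neg_neg, Finset.sum_congr rfl fun j _ => e1 j,
    ← integral_finsetSum _ fun j _ => i1 j, L2.inner_def]
  refine integral_congr_ae ?_
  filter_upwards [snd_ae_eq_twist_test ρ hφ hw] with v hv
  have e2 : u.1.snd v = mv (ρ.S v) (dvec ρ u.1 v) := by rw [dvec, mv_mv, ρ.S_mul_R, mv_one]
  rw [hv.1, twist, real_inner_comm, e2, norm_sq_mv_of_gram (ρ.gram v)]
  refine Finset.sum_congr rfl fun j _ => ?_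
  rw [Finset.sum_mul]
  refine Finset.sum_congr rfl fun k _ => ?_
  simp only [twd, PiLp.add_apply, PiLp.smul_apply, smul_eq_mul, grad_coord]
  ring

end Landau

/-! ### The nonlocal part and the form of the linearized operator -/

namespace Landau

open Filter Topology

variable {γ : ℝ} (ρ : Root γ)

lemma memLp_gau : MemLp gau 2 volume := by
  rw [memLp_two_iff_integrable_sq continuous_gau.aestronglyMeasurable]
  refine integrable_gau.mono' (continuous_gau.pow 2).aestronglyMeasurable
    (Eventually.of_forall fun v => ?_)
  have := gau_pos v
  rw [Real.norm_of_nonneg (by positivity), sq]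
  exact mul_le_of_le_one_left this.le (gau_le_one v)

lemma one_add_sq_mul_sqrtMu_le (v : V3) :
    (1 + ‖v‖ ^ 2) * ((1 + ‖v‖ ^ 2) ^ 2 * sqrtMu v) ≤ 24 ^ 3 * gau v := by
  refine le_trans (le_of_eq ?_) (sqrtMu_mul_pow_le v)
  ring

/-- Functions with an integrable quadratic moment. -/
def Moment (q : V3 → ℝ) : Prop :=
  AEStronglyMeasurable q volume ∧ Integrable fun w => (1 + ‖w‖ ^ 2) * q w

lemma moment_of_le {q g : V3 → ℝ} {C : ℝ} (hC : 0 ≤ C) (hq : AEStronglyMeasurable q volume)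
    (hg : MemLp g 2 volume) (h : ∀ w, |q w| ≤ C * ((1 + ‖w‖ ^ 2) ^ 2 * sqrtMu w) * |g w|) :
    Moment q := by
  refine ⟨hq, ((memLp_gau.integrable_mul hg.norm).const_mul (C * 24 ^ 3)).mono'
    ((by fun_prop : Continuous fun w : V3 => 1 + ‖w‖ ^ 2).aestronglyMeasurable.mul hq)
    (Eventually.of_forall fun w => ?_)⟩
  rw [norm_mul, Real.norm_of_nonneg (by positivity : (0 : ℝ) ≤ 1 + ‖w‖ ^ 2), Real.norm_eq_abs]
  have h1 := one_add_sq_mul_sqrtMu_le w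
  calc (1 + ‖w‖ ^ 2) * |q w|
      ≤ (1 + ‖w‖ ^ 2) * (C * ((1 + ‖w‖ ^ 2) ^ 2 * sqrtMu w) * |g w|) := by gcongr; exact h w
    _ = C * ((1 + ‖w‖ ^ 2) * ((1 + ‖w‖ ^ 2) ^ 2 * sqrtMu w)) * |g w| := by ring
    _ ≤ C * (24 ^ 3 * gau w) * |g w| := by gcongr
    _ = _ := by simp only [Pi.mul_apply, Real.norm_eq_abs]; ring

lemma moment_sqrtMu_mul (f : L2) : Moment fun w => sqrtMu w * f w := by
  refine moment_of_le zero_le_one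
    (continuous_sqrtMu.aestronglyMeasurable.mul (Lp.aestronglyMeasurable f)) (Lp.memLp f)
    fun w => ?_
  rw [abs_mul, abs_of_pos (sqrtMu_pos w), one_mul]
  refine mul_le_mul_of_nonneg_right (le_mul_of_one_le_left (sqrtMu_pos w).le ?_) (abs_nonneg _)
  exact one_le_pow₀ (by linarith [sq_nonneg ‖w‖])

lemma moment_coord_mul (f : L2) (k : Fin 3) : Moment fun w => w k * (sqrtMu w * f w) := by
  refine moment_of_le zero_le_one ((by fun_prop : Continuous fun w : V3 => w k).aestronglyMeasurable.mul
    (continuous_sqrtMu.aestronglyMeasurable.mul (Lp.aestronglyMeasurable f))) (Lp.memLp f)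
    fun w => ?_
  rw [abs_mul, abs_mul, abs_of_pos (sqrtMu_pos w), one_mul, ← mul_assoc]
  refine mul_le_mul_of_nonneg_right (mul_le_mul_of_nonneg_right ?_ (sqrtMu_pos w).le)
    (abs_nonneg _)
  nlinarith [abs_apply_le w k, sq_nonneg (‖w‖ - 1), sq_nonneg ‖w‖, sq_nonneg (‖w‖ ^ 2)]

lemma aestronglyMeasurable_dvec (u : Pair) (k : Fin 3) :
    AEStronglyMeasurable (fun w => dvec ρ u w k) volume :=
  (locallyIntegrable_dvec ρ u k).aestronglyMeasurable

lemma two_add_norm_sq_le (w : V3) : (2 + ‖w‖) ^ 2 ≤ 8 * (1 + ‖w‖ ^ 2) := by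
  nlinarith [sq_nonneg (‖w‖ - 1), sq_nonneg ‖w‖]

lemma moment_dvec (u : Pair) (k : Fin 3) : Moment fun w => sqrtMu w * dvec ρ u w k := by
  have h0 := ρ.C_nonneg
  refine moment_of_le (C := 9 * (ρ.C * 8)) (by positivity)
    (continuous_sqrtMu.aestronglyMeasurable.mul (aestronglyMeasurable_dvec ρ u k))
    (Lp.memLp u.snd).norm fun w => ?_
  have hs := (sqrtMu_pos w).le
  rw [abs_mul, abs_of_pos (sqrtMu_pos w), abs_norm]
  have h1 : |dvec ρ u w k| ≤ 9 * (ρ.C * (2 + ‖w‖) ^ 2) * ‖u.snd w‖ :=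
    (abs_apply_le _ _).trans (norm_mv_le (fun i j => ρ.abs_R_le w i j) _)
  have h2 : (2 + ‖w‖) ^ 2 ≤ 8 * (1 + ‖w‖ ^ 2) ^ 2 :=
    (two_add_norm_sq_le w).trans (by nlinarith [sq_nonneg ‖w‖, sq_nonneg (‖w‖ ^ 2)])
  calc sqrtMu w * |dvec ρ u w k|
      ≤ sqrtMu w * (9 * (ρ.C * (8 * (1 + ‖w‖ ^ 2) ^ 2)) * ‖u.snd w‖) :=
        mul_le_mul_of_nonneg_left (h1.trans (by gcongr)) hs
    _ = _ := by ring

/-- For q with only a moment the convolution integral may diverge on a null set of v. Fubini applied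
with a Gaussian factor in v, which is then divided out, gives convergence almost everywhere. -/
lemma IsKernel.integrable_ae (hγ₁ : -3 < γ) (hγ₂ : γ < 0) {κ : V3 → ℝ} (hκ : IsKernel γ κ)
    {q : V3 → ℝ} (hq : Moment q) : ∀ᵐ v, Integrable fun w => κ (v - w) * q w := by
  obtain ⟨hκm, c, hc⟩ := hκ
  have h := integrable_prod_kernel (c' := 1) hγ₁ hγ₂ hκm hc continuous_gau.aestronglyMeasurable
    (Eventually.of_forall fun v => by rw [abs_of_pos (gau_pos v), one_mul]) hq.1 hq.2
  filter_upwards [h.prod_right_ae] with v hv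
  refine (hv.const_mul (gau v)⁻¹).congr (Eventually.of_forall fun w => ?_)
  have := (gau_pos v).ne'
  field_simp

lemma IsKernel.integrable_prod_moment (hγ₁ : -3 < γ) (hγ₂ : γ < 0) {κ : V3 → ℝ}
    (hκ : IsKernel γ κ) {p q : V3 → ℝ} (hp : MuDecay p) (hq : Moment q) :
    Integrable (fun x : V3 × V3 => κ (x.1 - x.2) * p x.1 * q x.2) (volume.prod volume) := by
  obtain ⟨hκm, c, hc⟩ := hκ
  obtain ⟨C, -, hC⟩ := hp.abs_le_gau'
  exact integrable_prod_kernel hγ₁ hγ₂ hκm hc hp.1.aestronglyMeasurable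
    (Eventually.of_forall hC) hq.1 hq.2

lemma flux_nonlocal (hγ₁ : -3 < γ) (hγ₂ : γ < 0) (u : energySpace ρ) (j : Fin 3) :
    ∀ᵐ v, flux γ (fun v => sqrtMu v * emb ρ u v) (fun v => sqrtMu v * sqrtMu v) j v
      = -(mu v * ∑ k, ∫ w, aCoef γ j k (v - w) * (sqrtMu w * dvec ρ u.1 w k)) := by
  have hK := isKernel_aCoef hγ₂
  filter_upwards [weakGrad_mu,
    ae_all_iff.2 fun k => (hK j k).integrable_ae hγ₁ hγ₂ (moment_sqrtMu_mul (emb ρ u)),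
    ae_all_iff.2 fun k => (hK j k).integrable_ae hγ₁ hγ₂ (moment_coord_mul (emb ρ u) k),
    ae_all_iff.2 fun k => (hK j k).integrable_ae hγ₁ hγ₂ (moment_dvec ρ u.1 k)]
    with v hv i1 i2 i3
  have i12 : ∀ k, Integrable fun w => -(mu v * v k) * (aCoef γ j k (v - w)
      * (sqrtMu w * emb ρ u w)) + mu v * (aCoef γ j k (v - w) * (w k * (sqrtMu w * emb ρ u w))) :=
    fun k => ((i1 k).const_mul _).add ((i2 k).const_mul _)
  have e1 : ∀ k, ∫ w, aCoef γ j k (v - w) * ((sqrtMu w * emb ρ u w)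
      * weakGrad (fun v => sqrtMu v * sqrtMu v) v k
      - weakGrad (fun v => sqrtMu v * emb ρ u v) w k * (sqrtMu v * sqrtMu v))
      = -(mu v) * (∫ w, aCoef γ j k (v - w) * (sqrtMu w * dvec ρ u.1 w k))
        + ∫ w, (-(mu v * v k) * (aCoef γ j k (v - w) * (sqrtMu w * emb ρ u w))
          + mu v * (aCoef γ j k (v - w) * (w k * (sqrtMu w * emb ρ u w)))) := by
    intro k
    rw [← integral_const_mul, ← integral_add ((i3 k).const_mul _) (i12 k)]
    refine integral_congr_ae ?_
    filter_upwards [weakGrad_sqrtMu_mul ρ u] with w hw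
    rw [hv, hw, sqrtMu_mul_self]
    ring
  -- The same cancellation of drifts as in the local part, now with f depending on the integration
  -- variable.
  have e2 : ∑ k, ∫ w, (-(mu v * v k) * (aCoef γ j k (v - w) * (sqrtMu w * emb ρ u w))
          + mu v * (aCoef γ j k (v - w) * (w k * (sqrtMu w * emb ρ u w)))) = 0 := by
    rw [← integral_finsetSum _ fun k _ => i12 k,
      ← integral_zero V3 ℝ (μ := volume)]
    congr 1; funext w
    have h1 := sum_aCoef_sub_mul γ j v w
    calc _ = (mu v * (sqrtMu w * emb ρ u w)) * ((∑ k, aCoef γ j k (v - w) * w k)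
          - ∑ k, aCoef γ j k (v - w) * v k) := by
          rw [← Finset.sum_sub_distrib, Finset.mul_sum]
          exact Finset.sum_congr rfl fun k _ => by ring
      _ = 0 := by rw [h1, sub_self, mul_zero]
  rw [flux, Finset.sum_congr rfl fun k _ => e1 k, Finset.sum_add_distrib, e2, add_zero,
    ← Finset.mul_sum, neg_mul]

/-- The nonlocal part of the operator, before integration by parts. -/
noncomputable def nonlocal (u : Pair) (φ : V3 → ℝ) : ℝ :=
  ∑ j, ∑ k, ∫ x : V3 × V3, aCoef γ j k (x.1 - x.2) * (sqrtMu x.1 * twd φ j x.1)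
    * (sqrtMu x.2 * dvec ρ u x.2 k) ∂(volume.prod volume)

lemma isTest_sqrtMu_mul {φ : V3 → ℝ} (hφ : IsTest φ) : IsTest fun v => sqrtMu v * φ v :=
  hφ.mul_left contDiff_sqrtMu

lemma muDecay_sqrtMu_twd {φ : V3 → ℝ} (hφ : IsTest φ) (j : Fin 3) :
    MuDecay fun v => sqrtMu v * twd φ j v :=
  (isTest_sqrtMu_mul (isTest_twd hφ j)).muDecay₁.muDecay

lemma pairGamma_eq_nonlocal (hγ₁ : -3 < γ) (hγ₂ : γ < 0) (u : energySpace ρ) {φ : V3 → ℝ}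
    (hφ : IsTest φ) : -pairGamma γ (emb ρ u) sqrtMu φ = -nonlocal ρ u.1 φ := by
  have hI := fun j k => (isKernel_aCoef hγ₂ j k).integrable_prod_moment hγ₁ hγ₂
    (muDecay_sqrtMu_twd hφ j) (moment_dvec ρ u.1 k)
  have e1 : ∀ j, ∫ v, flux γ (fun v => sqrtMu v * emb ρ u v) (fun v => sqrtMu v * sqrtMu v) j v
      * fderiv ℝ (fun v => (sqrtMu v)⁻¹ * φ v) v (basisVec j)
      = -∑ k, ∫ x : V3 × V3, aCoef γ j k (x.1 - x.2) * (sqrtMu x.1 * twd φ j x.1)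
        * (sqrtMu x.2 * dvec ρ u.1 x.2 k) ∂(volume.prod volume) := by
    intro j
    have e2 : ∀ k, ∫ x : V3 × V3, aCoef γ j k (x.1 - x.2) * (sqrtMu x.1 * twd φ j x.1)
        * (sqrtMu x.2 * dvec ρ u.1 x.2 k) ∂(volume.prod volume)
        = ∫ v, (sqrtMu v * twd φ j v) * ∫ w, aCoef γ j k (v - w)
          * (sqrtMu w * dvec ρ u.1 w k) := by
      intro k
      rw [integral_prod _ (hI j k)]
      congr 1; funext v
      rw [← integral_const_mul]
      congr 1; funext w
      ring
    have i2 : ∀ k, Integrable fun v => (sqrtMu v * twd φ j v) * ∫ w, aCoef γ j k (v - w)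
          * (sqrtMu w * dvec ρ u.1 w k) := by
      intro k
      refine (hI j k).integral_prod_left.congr (Eventually.of_forall fun v => ?_)
      dsimp only
      rw [← integral_const_mul]
      congr 1; funext w
      ring
    rw [Finset.sum_congr rfl fun k _ => e2 k, ← integral_finsetSum _ fun k _ => i2 k,
      ← integral_neg]
    refine integral_congr_ae ?_
    filter_upwards [flux_nonlocal ρ hγ₁ hγ₂ u j] with v hv
    rw [hv, fderiv_inv_sqrtMu_mul hφ, ← sqrtMu_mul_self, ← Finset.mul_sum]
    have := (sqrtMu_pos v).ne'
    field_simp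
  rw [pairGamma, pairQ, neg_neg, Finset.sum_congr rfl fun j _ => e1 j, Finset.sum_neg_distrib,
    nonlocal]

/-- When f is itself a test function, √μf is smooth enough for the double integration by parts. -/
lemma nonlocal_eq_coupling_of_test (hγ₁ : -3 < γ) (hγ₂ : γ < 0) {u : energySpace ρ}
    {φ ψ : V3 → ℝ} (hφ : IsTest φ) (hψ : IsTest ψ) (hu : emb ρ u =ᵐ[volume] ψ) :
    nonlocal ρ u.1 φ = coupling γ (emb ρ u) φ := by
  have hd : ∀ᵐ v, ∀ k, dvec ρ u.1 v k = twd ψ k v :=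
    (snd_ae_eq_twist_test ρ hψ hu).mono fun v hv => hv.2
  have hI := fun j k => (isKernel_aCoef hγ₂ j k).integrable_prod_moment hγ₁ hγ₂
    (muDecay_sqrtMu_twd hφ j) (moment_dvec ρ u.1 k)
  have key := double_integration_by_parts hγ₁ hγ₂ (isTest_sqrtMu_mul hψ).muDecay₁
    (isTest_sqrtMu_mul hφ).muDecay₁
  simp only [fderiv_sqrtMu_mul hφ, fderiv_sqrtMu_mul hψ] at key
  rw [coupling_congr hu (EventuallyEq.refl _ _), coupling, ← key, nonlocal,
    integral_congr_ae (g := fun x : V3 × V3 => ∑ j, ∑ k, aCoef γ j k (x.1 - x.2)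
      * (sqrtMu x.1 * twd φ j x.1) * (sqrtMu x.2 * dvec ρ u.1 x.2 k)),
    integral_finsetSum _ fun j _ => integrable_finsetSum _ fun k _ => hI j k]
  · exact Finset.sum_congr rfl fun j _ => (integral_finsetSum _ fun k _ => hI j k).symm
  · filter_upwards [Measure.quasiMeasurePreserving_snd.ae hd] with x hx
    simp only [hx]

/-- For fixed φ the v-integral is O(1 + |w|²); together with S⁻¹ and √μ it forms a square integrable
field. So the expression is continuous in u although it involves the gradient of u, which allows an
argument by density. -/
lemma exists_nonlocal_vector (hγ₁ : -3 < γ) (hγ₂ : γ < 0) {φ : V3 → ℝ} (hφ : IsTest φ) :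
    ∃ W : LV, ∀ u : Pair, nonlocal ρ u φ = inner ℝ u.snd W := by
  have h0 := ρ.C_nonneg
  set τ : Fin 3 → Fin 3 → V3 → ℝ := fun j k w =>
    ∫ v, aCoef γ j k (v - w) * (sqrtMu v * twd φ j v) with hτ
  have hp := muDecay_sqrtMu_twd hφ
  have hτm : ∀ j k, Measurable (τ j k) := by
    intro j k
    have : StronglyMeasurable fun x : V3 × V3 => aCoef γ j k (x.1 - x.2)
        * (sqrtMu x.1 * twd φ j x.1) :=
      (((measurable_aCoef γ j k).comp (measurable_fst.sub measurable_snd)).mul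
        ((hp j).1.comp measurable_fst)).stronglyMeasurable
    exact this.integral_prod_left'.measurable
  obtain ⟨C, hC0, hC⟩ := exists_kmaj_bound hγ₁ hγ₂
  choose D hD0 hD using fun j => (hp j).abs_le_gau'
  set E : ℝ := ∑ j, D j with hE
  have hE0 : 0 ≤ E := Finset.sum_nonneg fun j _ => hD0 j
  have hτb : ∀ j k w, |τ j k w| ≤ E * C * (1 + ‖w‖ ^ 2) := by
    intro j k w
    have h1 : ∀ v, ‖aCoef γ j k (v - w) * (sqrtMu v * twd φ j v)‖
        ≤ E * (kmaj γ (v - w) * gau v) := by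
      intro v
      have h2 := abs_aCoef_le_kmaj hγ₂ j k (v - w)
      have h3 : D j ≤ E := Finset.single_le_sum (f := D) (fun j _ => hD0 j) (Finset.mem_univ j)
      have hg := (gau_pos v).le
      have hk := kmaj_nonneg γ (v - w)
      rw [norm_mul, Real.norm_eq_abs, Real.norm_eq_abs]
      rw [one_mul] at h2
      calc _ ≤ kmaj γ (v - w) * (E * gau v) :=
            mul_le_mul h2 ((hD j v).trans (by gcongr)) (abs_nonneg _) hk
        _ = _ := by ring
    have h4 := norm_integral_le_of_norm_le ((hC w).1.const_mul E) (Eventually.of_forall h1)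
    rw [integral_const_mul, Real.norm_eq_abs] at h4
    refine h4.trans ?_
    rw [mul_assoc]
    exact mul_le_mul_of_nonneg_left (hC w).2 hE0
  set W : V3 → V3 := fun w => WithLp.toLp 2 fun i => ∑ k, ρ.R w k i * (sqrtMu w * ∑ j, τ j k w)
    with hW
  have hWi : ∀ w i, W w i = ∑ k, ρ.R w k i * (sqrtMu w * ∑ j, τ j k w) := fun w i => rfl
  have hWm : AEStronglyMeasurable W volume := by
    have hs := continuous_sqrtMu.measurable
    have hR := ρ.measurable_R
    exact ((WithLp.measurable_toLp 2 _).comp (measurable_pi_lambda _ fun i => by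
      fun_prop)).aestronglyMeasurable
  have hWL : MemLp W 2 volume := by
    refine (memLp_gau.const_mul (27 * (8 * ρ.C * (E * C)) * 24 ^ 3)).mono hWm
      (Eventually.of_forall fun w => ?_)
    have hs := (sqrtMu_pos w).le
    have hg := (gau_pos w).le
    rw [Real.norm_of_nonneg (by positivity)]
    have h1 : ∀ i k, |ρ.R w k i * (sqrtMu w * ∑ j, τ j k w)|
        ≤ (ρ.C * (8 * (1 + ‖w‖ ^ 2))) * (sqrtMu w * (3 * (E * C * (1 + ‖w‖ ^ 2)))) := by
      intro i k
      rw [abs_mul, abs_mul, abs_of_nonneg hs]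
      refine mul_le_mul ((ρ.abs_R_le w k i).trans
        (mul_le_mul_of_nonneg_left (two_add_norm_sq_le w) h0)) ?_ (by positivity) (by positivity)
      refine mul_le_mul_of_nonneg_left ?_ hs
      refine (Finset.abs_sum_le_sum_abs _ _).trans ((Finset.sum_le_sum fun j _ =>
        hτb j k w).trans_eq ?_)
      simp
    calc ‖W w‖ ≤ ∑ i, |W w i| := norm_le_sum_abs _
      _ ≤ ∑ _i : Fin 3, ∑ _k : Fin 3,
          (ρ.C * (8 * (1 + ‖w‖ ^ 2))) * (sqrtMu w * (3 * (E * C * (1 + ‖w‖ ^ 2)))) :=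
          Finset.sum_le_sum fun i _ => by
            rw [hWi]
            exact (Finset.abs_sum_le_sum_abs _ _).trans (Finset.sum_le_sum fun k _ => h1 i k)
      _ = 27 * (8 * ρ.C * (E * C)) * ((1 + ‖w‖ ^ 2) ^ 2 * sqrtMu w) := by
          simp; ring
      _ ≤ 27 * (8 * ρ.C * (E * C)) * (24 ^ 3 * gau w) := by
          refine mul_le_mul_of_nonneg_left (le_trans ?_ (one_add_sq_mul_sqrtMu_le w))
            (by positivity)
          exact le_mul_of_one_le_left (by positivity) (by linarith [sq_nonneg ‖w‖])
      _ = _ := by ring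
  refine ⟨hWL.toLp W, fun u => ?_⟩
  have hI := fun j k => (isKernel_aCoef hγ₂ j k).integrable_prod_moment hγ₁ hγ₂
    (hp j) (moment_dvec ρ u k)
  have e1 : ∀ j k, ∫ x : V3 × V3, aCoef γ j k (x.1 - x.2) * (sqrtMu x.1 * twd φ j x.1)
        * (sqrtMu x.2 * dvec ρ u x.2 k) ∂(volume.prod volume)
      = ∫ w, τ j k w * (sqrtMu w * dvec ρ u w k) := by
    intro j k
    rw [integral_prod_symm _ (hI j k)]
    simp only [hτ, integral_mul_const]
  have i1 : ∀ j k, Integrable fun w => τ j k w * (sqrtMu w * dvec ρ u w k) := by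
    intro j k
    refine (hI j k).integral_prod_right.congr (Eventually.of_forall fun w => ?_)
    simp only [hτ, integral_mul_const]
  rw [nonlocal, Finset.sum_congr rfl fun j _ => Finset.sum_congr rfl fun k _ => e1 j k,
    Finset.sum_congr rfl fun j _ => (integral_finsetSum _ fun k _ => i1 j k).symm,
    ← integral_finsetSum _ fun j _ => integrable_finsetSum _ fun k _ => i1 j k, L2.inner_def]
  refine integral_congr_ae ?_
  filter_upwards [hWL.coeFn_toLp] with w hw
  rw [hw]
  simp only [PiLp.inner_apply, RCLike.inner_apply, conj_trivial, hWi, dvec, mv_coord,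
    Fin.sum_univ_three]
  ring

/-- Both sides are continuous in u for the energy norm and agree on the dense subspace of test
functions. -/
lemma nonlocal_eq_coupling (hγ₁ : -3 < γ) (hγ₂ : γ < 0) (u w : energySpace ρ)
    {φ : V3 → ℝ} (hφ : IsTest φ) (hw : emb ρ w =ᵐ[volume] φ) :
    nonlocal ρ u.1 φ = coupling γ (emb ρ u) (emb ρ w) := by
  obtain ⟨b, B, C, -, hb, -⟩ := exists_energyForm hγ₁ hγ₂ ρ
  obtain ⟨W, hW⟩ := exists_nonlocal_vector ρ hγ₁ hγ₂ hφ
  have hs : Continuous fun u : energySpace ρ => u.1.snd :=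
    ((WithLp.sndL 2 ℝ L2 LV).comp (energySpace ρ).subtypeL).continuous
  have c1 : Continuous fun u : energySpace ρ => nonlocal ρ u.1 φ := by
    simp only [hW]
    exact hs.inner continuous_const
  have c2 : Continuous fun u : energySpace ρ => coupling γ (emb ρ u) (emb ρ w) := by
    have : Continuous fun u : energySpace ρ => inner ℝ u.1.snd w.1.snd - b u w :=
      (hs.inner continuous_const).sub (b.continuous.clm_apply continuous_const)
    refine this.congr fun u => ?_
    rw [hb]; ring
  refine congrFun (c1.ext_on (dense_testSpace ρ) c2 ?_) u
  rintro u ⟨ψ, hψ, hu⟩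
  dsimp only
  rw [nonlocal_eq_coupling_of_test ρ hγ₁ hγ₂ hφ hψ hu]
  exact coupling_congr (EventuallyEq.refl _ _) hw.symm

/-- The distributional pairing agrees with the bilinear form. -/
theorem pairL_eq (hγ₁ : -3 < γ) (hγ₂ : γ < 0) (u w : energySpace ρ)
    {φ : V3 → ℝ} (hφ : IsTest φ) (hw : emb ρ w =ᵐ[volume] φ) :
    pairL γ (emb ρ u) φ
      = inner ℝ u.1.snd w.1.snd - coupling γ (emb ρ u) (emb ρ w) := by
  have h1 := pairGamma_local ρ hγ₁ hγ₂ u w hφ hw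
  have h2 := pairGamma_eq_nonlocal ρ hγ₁ hγ₂ u hφ
  rw [nonlocal_eq_coupling ρ hγ₁ hγ₂ u w hφ hw] at h2
  rw [pairL]
  linarith

end Landau

/-! ### Sobolev estimates in time -/

namespace Landau

section TimeRegularity

lemma ofReal_sq_sub_le {u u' : ℝ → ℝ} {a b r s : ℝ}
    (hu : ∀ τ ∈ Ioo a b, HasDerivAt u (u' τ) τ) (hc : ContinuousOn u' (Ioo a b))
    (hr : r ∈ Ioo a b) (hs : s ∈ Ioo a b) (hrs : r ≤ s) :
    ENNReal.ofReal ((u s - u r) ^ 2)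
      ≤ ENNReal.ofReal (s - r) * ∫⁻ τ in Ioc r s, ENNReal.ofReal (u' τ ^ 2) := by
  have hsub : uIcc r s ⊆ Ioo a b := by
    rw [uIcc_of_le hrs]
    exact Icc_subset_Ioo hr.1 hs.2
  have hi : IntervalIntegrable u' volume r s := (hc.mono hsub).intervalIntegrable
  have hi2 : IntervalIntegrable (fun τ => u' τ ^ 2) volume r s :=
    ((hc.mono hsub).pow 2).intervalIntegrable
  have h1 : ∫ τ in r..s, u' τ = u s - u r :=
    intervalIntegral.integral_eq_sub_of_hasDerivAt (fun τ hτ => hu τ (hsub hτ)) hi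
  have h2 : (u s - u r) ^ 2 ≤ (s - r) * ∫ τ in r..s, u' τ ^ 2 := by
    set J := u s - u r with hJ
    set L := s - r with hL
    rcases hrs.eq_or_lt with h | h
    · simp [hJ, hL, h]
    have hL0 : 0 < L := sub_pos.2 h
    -- Cauchy–Schwarz, obtained by expanding a nonnegative square: L times the derivative minus the
    -- total increment J.
    have h3 : 0 ≤ ∫ τ in r..s, (L * u' τ - J) ^ 2 :=
      intervalIntegral.integral_nonneg hrs fun τ _ => sq_nonneg _
    have h4 : ∫ τ in r..s, (L * u' τ - J) ^ 2
        = L ^ 2 * (∫ τ in r..s, u' τ ^ 2) - 2 * L * J * J + J ^ 2 * L := by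
      have e : ∀ τ, (L * u' τ - J) ^ 2 = L ^ 2 * u' τ ^ 2 - 2 * L * J * u' τ + J ^ 2 := fun τ => by
        ring
      simp only [e]
      rw [intervalIntegral.integral_add ((hi2.const_mul _).sub (hi.const_mul _))
        intervalIntegrable_const, intervalIntegral.integral_sub (hi2.const_mul _) (hi.const_mul _),
        intervalIntegral.integral_const_mul, intervalIntegral.integral_const_mul, h1,
        intervalIntegral.integral_const, smul_eq_mul]
      ring
    rw [h4] at h3
    have h5 : 0 ≤ L * (L * (∫ τ in r..s, u' τ ^ 2) - J ^ 2) := by linarith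
    linarith [nonneg_of_mul_nonneg_right h5 hL0]
  refine (ENNReal.ofReal_le_ofReal h2).trans_eq ?_
  rw [ENNReal.ofReal_mul (sub_nonneg.2 hrs), intervalIntegral.integral_of_le hrs,
    ofReal_integral_eq_lintegral_ofReal ((intervalIntegrable_iff_integrableOn_Ioc_of_le hrs).1 hi2)
      (Filter.Eventually.of_forall fun τ => sq_nonneg _)]

/-- From u(s)² ≤ 2u(r)² + 2(u(s) - u(r))², with the increment bounded through the derivative, and
integration over r ∈ ]0, T[. -/
lemma ofReal_sq_le {u u' : ℝ → ℝ} {T s : ℝ}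
    (hu : ∀ τ ∈ Ioo 0 T, HasDerivAt u (u' τ) τ) (hc : ContinuousOn u' (Ioo 0 T))
    (hs : s ∈ Ioo 0 T) :
    ENNReal.ofReal T * ENNReal.ofReal (u s ^ 2)
      ≤ 2 * (∫⁻ τ in Ioo 0 T, ENNReal.ofReal (u τ ^ 2))
        + 2 * ENNReal.ofReal T ^ 2 * ∫⁻ τ in Ioo 0 T, ENNReal.ofReal (u' τ ^ 2) := by
  set I := ∫⁻ τ in Ioo 0 T, ENNReal.ofReal (u' τ ^ 2) with hI
  have h1 : ∀ r ∈ Ioo 0 T, ENNReal.ofReal (u s ^ 2)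
      ≤ 2 * ENNReal.ofReal (u r ^ 2) + 2 * ENNReal.ofReal T * I := by
    intro r hr
    have h2 : ENNReal.ofReal ((u s - u r) ^ 2) ≤ ENNReal.ofReal T * I := by
      have key : ∀ p ∈ Ioo 0 T, ∀ q ∈ Ioo 0 T, p ≤ q →
          ENNReal.ofReal ((u q - u p) ^ 2) ≤ ENNReal.ofReal T * I := by
        intro p hp q hq hpq
        refine (ofReal_sq_sub_le hu hc hp hq hpq).trans ?_
        refine mul_le_mul' (ENNReal.ofReal_le_ofReal (by linarith [hp.1, hq.2]))
          (lintegral_mono_set fun τ hτ => ⟨hp.1.trans hτ.1, hτ.2.trans_lt hq.2⟩)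
      rcases le_total r s with h | h
      · exact key r hr s hs h
      · have := key s hs r hr h
        rwa [← neg_sq, neg_sub] at this
    have h3 : u s ^ 2 ≤ 2 * u r ^ 2 + 2 * (u s - u r) ^ 2 := by nlinarith [sq_nonneg (u s - 2 * u r)]
    refine (ENNReal.ofReal_le_ofReal h3).trans ?_
    rw [ENNReal.ofReal_add (by positivity) (by positivity), ENNReal.ofReal_mul (by norm_num),
      ENNReal.ofReal_mul (by norm_num), mul_assoc]
    norm_num only [ENNReal.ofReal_ofNat]
    gcongr
  have h4 := setLIntegral_mono' (μ := volume) measurableSet_Ioo h1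
  rw [lintegral_const, lintegral_add_right _ measurable_const, lintegral_const,
    lintegral_const_mul' _ _ (by norm_num)] at h4
  simp only [Measure.restrict_apply_univ, Real.volume_Ioo, sub_zero] at h4
  calc _ = ENNReal.ofReal (u s ^ 2) * ENNReal.ofReal T := mul_comm _ _
    _ ≤ _ := h4
    _ = _ := by ring

lemma aemeasurable_of_continuousOn {f : ℝ × V3 → ℝ} {a b : ℝ}
    (hf : ContinuousOn f (Ioo a b ×ˢ univ)) :
    AEMeasurable (fun x => ENNReal.ofReal (f x ^ 2))
      ((volume.restrict (Ioo a b)).prod (volume : Measure V3)) := by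
  have h1 := (hf.pow 2).aemeasurable (μ := (volume : Measure (ℝ × V3)))
    (measurableSet_Ioo.prod MeasurableSet.univ)
  rw [Measure.volume_eq_prod, ← Measure.prod_restrict, Measure.restrict_univ] at h1
  exact h1.ennreal_ofReal

/-- Increments in time are controlled by the time derivative. -/
lemma lintegral_sq_sub_le {u u' : ℝ × V3 → ℝ} {a b r s : ℝ} {K : ℝ≥0∞}
    (hu : ∀ v, ∀ τ ∈ Ioo a b, HasDerivAt (fun τ => u (τ, v)) (u' (τ, v)) τ)
    (hc : ContinuousOn u' (Ioo a b ×ˢ univ)) (hr : r ∈ Ioo a b) (hs : s ∈ Ioo a b) (hrs : r ≤ s)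
    (hK : ∀ τ ∈ Ioo a b, ∫⁻ v, ENNReal.ofReal (u' (τ, v) ^ 2) ≤ K) :
    ∫⁻ v, ENNReal.ofReal ((u (s, v) - u (r, v)) ^ 2) ≤ ENNReal.ofReal ((s - r) ^ 2) * K := by
  have hsub : Ioc r s ⊆ Ioo a b := fun τ hτ => ⟨hr.1.trans hτ.1, hτ.2.trans_lt hs.2⟩
  have hm : AEMeasurable (fun x : ℝ × V3 => ENNReal.ofReal (u' x ^ 2))
      ((volume.restrict (Ioc r s)).prod (volume : Measure V3)) :=
    (aemeasurable_of_continuousOn hc).mono_measure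
      (Measure.prod_mono (Measure.restrict_mono_set _ hsub) le_rfl)
  have hcv : ∀ v : V3, ContinuousOn (fun τ => u' (τ, v)) (Ioo a b) := fun v =>
    hc.comp (by fun_prop) fun τ hτ => ⟨hτ, mem_univ _⟩
  calc ∫⁻ v, ENNReal.ofReal ((u (s, v) - u (r, v)) ^ 2)
      ≤ ∫⁻ v, ENNReal.ofReal (s - r) * ∫⁻ τ in Ioc r s, ENNReal.ofReal (u' (τ, v) ^ 2) :=
        lintegral_mono fun v => ofReal_sq_sub_le (hu v) (hcv v) hr hs hrs
    _ = ENNReal.ofReal (s - r) * ∫⁻ τ in Ioc r s, ∫⁻ v, ENNReal.ofReal (u' (τ, v) ^ 2) := by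
        rw [lintegral_const_mul' _ _ ENNReal.ofReal_ne_top, lintegral_lintegral_swap (hm.prod_swap)]
    _ ≤ ENNReal.ofReal (s - r) * ∫⁻ _τ in Ioc r s, K := by
        refine mul_le_mul' le_rfl ?_
        exact setLIntegral_mono' measurableSet_Ioc fun τ hτ => hK τ (hsub hτ)
    _ = _ := by
        rw [lintegral_const, Measure.restrict_apply_univ, Real.volume_Ioc, sq,
          ENNReal.ofReal_mul (sub_nonneg.2 hrs)]
        ring

/-- A Sobolev estimate in time. -/
lemma lintegral_sq_le {u u' : ℝ × V3 → ℝ} {T s : ℝ} {K K' : ℝ≥0∞}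
    (hu : ∀ v, ∀ τ ∈ Ioo 0 T, HasDerivAt (fun τ => u (τ, v)) (u' (τ, v)) τ)
    (hcu : ContinuousOn u (Ioo 0 T ×ˢ univ))
    (hc : ContinuousOn u' (Ioo 0 T ×ˢ univ)) (hs : s ∈ Ioo 0 T)
    (hK : ∫⁻ x in Ioo 0 T ×ˢ univ, ENNReal.ofReal (u x ^ 2) ≤ K)
    (hK' : ∫⁻ x in Ioo 0 T ×ˢ univ, ENNReal.ofReal (u' x ^ 2) ≤ K') :
    ENNReal.ofReal T * ∫⁻ v, ENNReal.ofReal (u (s, v) ^ 2)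
      ≤ 2 * K + 2 * ENNReal.ofReal T ^ 2 * K' := by
  have hcv : ∀ v : V3, ContinuousOn (fun τ => u' (τ, v)) (Ioo 0 T) := fun v =>
    hc.comp (by fun_prop) fun τ hτ => ⟨hτ, mem_univ _⟩
  have hm := aemeasurable_of_continuousOn hcu
  have hm' := aemeasurable_of_continuousOn hc
  rw [Measure.volume_eq_prod, ← Measure.prod_restrict, Measure.restrict_univ,
    lintegral_prod_symm _ hm] at hK
  rw [Measure.volume_eq_prod, ← Measure.prod_restrict, Measure.restrict_univ,
    lintegral_prod_symm _ hm'] at hK'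
  rw [← lintegral_const_mul' _ _ ENNReal.ofReal_ne_top]
  refine (lintegral_mono fun v => ofReal_sq_le (hu v) (hcv v) hs).trans ?_
  have hmv : AEMeasurable
      (fun v : V3 => 2 * ∫⁻ τ in Ioo 0 T, ENNReal.ofReal (u (τ, v) ^ 2)) volume :=
    hm.prod_swap.lintegral_prod_right'.const_mul 2
  rw [lintegral_add_left' hmv,
    lintegral_const_mul' _ _ (by norm_num), lintegral_const_mul' _ _ (by finiteness)]
  gcongr

end TimeRegularity

end Landau

/-! ### The source as a curve in L² -/

namespace Landau

section Source

lemma contDiffOn_dirDeriv {u : ℝ × V3 → ℝ} {Ω : Set (ℝ × V3)} (hΩ : IsOpen Ω) (e : ℝ × V3)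
    (hu : ContDiffOn ℝ ∞ u Ω) : ContDiffOn ℝ ∞ (dirDeriv e u) Ω :=
  (hu.fderiv_of_isOpen hΩ (m := ∞) le_rfl).clm_apply contDiffOn_const

lemma isOpen_slab (T : ℝ) : IsOpen (Ioo 0 T ×ˢ (univ : Set V3)) := isOpen_Ioo.prod isOpen_univ

lemma contDiffOn_iterate_dirDeriv {g : ℝ × V3 → ℝ} {T : ℝ}
    (hg : ContDiffOn ℝ ∞ g (Ioo 0 T ×ˢ univ)) (k : ℕ) :
    ContDiffOn ℝ ∞ ((dirDeriv (1, 0))^[k] g) (Ioo 0 T ×ˢ univ) := by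
  induction k with
  | zero => exact hg
  | succ k ih =>
    rw [Function.iterate_succ_apply']
    exact contDiffOn_dirDeriv (isOpen_slab T) _ ih

lemma hasDerivAt_time {u : ℝ × V3 → ℝ} {T τ : ℝ} (hu : ContDiffOn ℝ ∞ u (Ioo 0 T ×ˢ univ))
    (v : V3) (hτ : τ ∈ Ioo 0 T) :
    HasDerivAt (fun τ => u (τ, v)) (dirDeriv (1, 0) u (τ, v)) τ := by
  have h1 : DifferentiableAt ℝ u (τ, v) :=
    (hu.differentiableOn (by simp)).differentiableAt ((isOpen_slab T).mem_nhds ⟨hτ, mem_univ _⟩)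
  have h2 : HasDerivAt (fun τ : ℝ => (τ, v)) ((1 : ℝ), (0 : V3)) τ :=
    (hasDerivAt_id τ).prodMk (hasDerivAt_const τ v)
  exact h1.hasFDerivAt.comp_hasDerivAt τ h2

lemma lintegral_ofReal_sq {α : Type*} [MeasurableSpace α] {ν : Measure α} (f : α → ℝ) :
    ∫⁻ x, ENNReal.ofReal (f x ^ 2) ∂ν = eLpNorm f 2 ν ^ 2 := by
  have h := eLpNorm_nnreal_pow_eq_lintegral (f := f) (μ := ν) (p := 2) (by norm_num)
  norm_num at h
  rw [h]
  refine lintegral_congr fun x => ?_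
  rw [← sq_abs, ENNReal.ofReal_pow (abs_nonneg _), Real.enorm_eq_ofReal_abs]

/-- L² bounds of ∂ₜᵏg and ∂ₜᵏ⁺¹g on the slab bound the L² norm of every time slice of ∂ₜᵏg. The case
k = 2 calls for three time derivatives of g. -/
lemma exists_slice_bound {T A : ℝ} (hT : 0 < T) (hA : 0 < A) :
    ∃ K : ℝ, 0 ≤ K ∧ ∀ g : ℝ × V3 → ℝ, IsAnalyticL2 A (Ioo 0 T ×ˢ univ) g →
      ∀ k < 3, ∀ s ∈ Ioo 0 T,
        ∫⁻ v, ENNReal.ofReal ((dirDeriv (1, 0))^[k] g (s, v) ^ 2) ≤ ENNReal.ofReal (K ^ 2) := by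
  set N : ℕ → ℝ := fun k => (A ^ (k + 1) * k.factorial) ^ 2 with hN
  have hN0 : ∀ k, 0 ≤ N k := fun k => sq_nonneg _
  set c : ℕ → ℝ := fun k => (2 * N k + 2 * T ^ 2 * N (k + 1)) / T with hc
  have hc0 : ∀ k, 0 ≤ c k := fun k => by
    have := hN0 k
    have := hN0 (k + 1)
    positivity
  refine ⟨√(∑ k ∈ Finset.range 3, c k), Real.sqrt_nonneg _, fun g hg k hk s hs => ?_⟩
  rw [Real.sq_sqrt (Finset.sum_nonneg fun k _ => hc0 k)]
  have hb : ∀ k, ∫⁻ x in Ioo 0 T ×ˢ univ, ENNReal.ofReal ((dirDeriv (1, 0))^[k] g x ^ 2)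
      ≤ ENNReal.ofReal (N k) := fun k => by
    rw [lintegral_ofReal_sq]
    have h := hg.bound k 0
    simp only [mixedPartial, Pi.zero_apply, Function.iterate_zero, id_eq, Finset.sum_const_zero,
      add_zero, Nat.factorial_zero, Finset.prod_const_one, mul_one] at h
    rw [hN, ENNReal.ofReal_pow (by positivity)]
    exact pow_le_pow_left' h 2
  have hs1 := contDiffOn_iterate_dirDeriv hg.smooth k
  have hs2 := contDiffOn_iterate_dirDeriv hg.smooth (k + 1)
  have h := lintegral_sq_le (u := (dirDeriv (1, 0))^[k] g) (u' := (dirDeriv (1, 0))^[k + 1] g)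
    (fun v τ hτ => by
      rw [Function.iterate_succ_apply']
      exact hasDerivAt_time hs1 v hτ)
    hs1.continuousOn hs2.continuousOn hs (hb k) (hb (k + 1))
  refine le_trans ?_ (ENNReal.ofReal_le_ofReal
    (Finset.single_le_sum (fun k _ => hc0 k) (Finset.mem_range.2 hk)))
  have h0 := hN0 k
  have h1 := hN0 (k + 1)
  rw [hc, ENNReal.ofReal_div_of_pos hT, ENNReal.le_div_iff_mul_le (by simp [hT]) (by simp),
    mul_comm]
  refine h.trans_eq ?_
  rw [ENNReal.ofReal_add (by positivity) (by positivity), ENNReal.ofReal_mul (by positivity),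
    ENNReal.ofReal_mul (by positivity), ENNReal.ofReal_mul (by positivity),
    ENNReal.ofReal_pow hT.le]
  norm_num

lemma norm_le_of_lintegral_le {z : L2} {p : V3 → ℝ} {c : ℝ} (hz : z =ᵐ[volume] p) (hc : 0 ≤ c)
    (h : ∫⁻ v, ENNReal.ofReal (p v ^ 2) ≤ ENNReal.ofReal (c ^ 2)) : ‖z‖ ≤ c := by
  have h1 : ENNReal.ofReal (‖z‖ ^ 2) ≤ ENNReal.ofReal (c ^ 2) := by
    rw [ofReal_norm_sq_eq_lintegral]
    refine (lintegral_congr_ae ?_).trans_le h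
    filter_upwards [hz] with v hv
    rw [hv, Real.norm_eq_abs, sq_abs]
  exact le_of_sq_le_sq ((ENNReal.ofReal_le_ofReal_iff (sq_nonneg _)).1 h1) hc

/-- An analytic source is a twice Lipschitz curve in `L²`, with uniform bounds. -/
lemma exists_source {T A : ℝ} (hT : 0 < T) (hA : 0 < A) :
    ∃ K : ℝ, 0 ≤ K ∧ ∀ g : ℝ × V3 → ℝ, IsAnalyticL2 A (Ioo 0 T ×ˢ univ) g →
      ∃ G : ℝ → L2, (∀ s ∈ Ioo 0 T, G s =ᵐ[volume] fun v => g (s, v)) ∧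
        ContinuousOn G (Ioo 0 T) ∧ (∀ s ∈ Ioo 0 T, ‖G s‖ ≤ K) ∧
        (∀ h > 0, ∀ s ∈ Ioo h T, ‖diffq h G s‖ ≤ K) ∧
        ∀ h > 0, ∀ s ∈ Ioo (2 * h) T, ‖diffq h (diffq h G) s‖ ≤ K := by
  obtain ⟨K, hK, hKb⟩ := exists_slice_bound hT hA
  refine ⟨K, hK, fun g hg => ?_⟩
  have hsm := contDiffOn_iterate_dirDeriv hg.smooth
  have hb := hKb g hg
  have hd : ∀ k v, ∀ τ ∈ Ioo 0 T, HasDerivAt (fun τ => (dirDeriv (1, 0))^[k] g (τ, v))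
      ((dirDeriv (1, 0))^[k + 1] g (τ, v)) τ := fun k v τ hτ => by
    rw [Function.iterate_succ_apply']
    exact hasDerivAt_time (hsm k) v hτ
  have hmem : ∀ s ∈ Ioo 0 T, MemLp (fun v => g (s, v)) 2 (volume : Measure V3) := fun s hs => by
    have hcont : Continuous fun v => g (s, v) :=
      hg.smooth.continuousOn.comp_continuous (by fun_prop) fun v => ⟨hs, mem_univ _⟩
    refine ⟨hcont.aestronglyMeasurable, ?_⟩
    have h := (hb 0 (by norm_num) s hs).trans_lt ENNReal.ofReal_lt_top
    rw [lintegral_ofReal_sq] at h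
    exact (ENNReal.pow_lt_top_iff.1 h).resolve_right (by norm_num)
  classical
  set G : ℝ → L2 := fun s => if hs : s ∈ Ioo 0 T then (hmem s hs).toLp _ else 0 with hGdef
  have hG : ∀ s ∈ Ioo 0 T, G s =ᵐ[volume] fun v => g (s, v) := fun s hs => by
    rw [hGdef]
    simp only [dif_pos hs]
    exact (hmem s hs).coeFn_toLp
  have hlip : ∀ r ∈ Ioo 0 T, ∀ s ∈ Ioo 0 T, r ≤ s → ‖G s - G r‖ ≤ (s - r) * K :=
    fun r hr s hs hrs => by
    refine norm_le_of_lintegral_le (p := fun v => g (s, v) - g (r, v)) ?_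
      (mul_nonneg (sub_nonneg.2 hrs) hK) ?_
    · filter_upwards [Lp.coeFn_sub (G s) (G r), hG s hs, hG r hr] with v h1 h2 h3
      rw [h1, Pi.sub_apply, h2, h3]
    · rw [mul_pow, ENNReal.ofReal_mul (sq_nonneg _)]
      exact lintegral_sq_sub_le (hd 0) (hsm 1).continuousOn hr hs hrs fun τ hτ =>
        hb 1 (by norm_num) τ hτ
  refine ⟨G, hG, ?_, fun s hs => norm_le_of_lintegral_le (hG s hs) hK (hb 0 (by norm_num) s hs),
    fun h hh s hs => ?_, fun h hh s hs => ?_⟩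
  · refine (LipschitzOnWith.of_dist_le_mul (K := K.toNNReal) fun s hs r hr => ?_).continuousOn
    rw [dist_eq_norm, Real.dist_eq, Real.coe_toNNReal _ hK]
    rcases le_total r s with hrs | hrs
    · rw [abs_of_nonneg (sub_nonneg.2 hrs), mul_comm]
      exact hlip r hr s hs hrs
    · rw [abs_sub_comm, abs_of_nonneg (sub_nonneg.2 hrs), mul_comm, norm_sub_rev]
      exact hlip s hs r hr hrs
  · have h1 := hlip (s - h) ⟨by linarith [hs.1], by linarith [hs.2]⟩ s
      ⟨hh.trans hs.1, hs.2⟩ (by linarith)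
    rw [diffq, norm_smul, norm_inv, Real.norm_eq_abs, abs_of_pos hh, inv_mul_le_iff₀ hh]
    simpa using h1
  · have hs0 : s ∈ Ioo 0 T := ⟨by linarith [hs.1], hs.2⟩
    have hs1 : s - h ∈ Ioo 0 T := ⟨by linarith [hs.1], by linarith [hs.2]⟩
    have hs2 : s - h - h ∈ Ioo 0 T := ⟨by linarith [hs.1], by linarith [hs.2]⟩
    have hsub : ∀ τ ∈ Ioo h T, τ ∈ Ioo 0 T ∧ τ - h ∈ Ioo 0 T := fun τ hτ =>
      ⟨⟨hh.trans hτ.1, hτ.2⟩, by linarith [hτ.1], by linarith [hτ.2]⟩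
    have e : diffq h (diffq h G) s
        = (h⁻¹ * h⁻¹) • ((G s - G (s - h)) - (G (s - h) - G (s - h - h))) := by
      simp only [diffq, ← smul_sub, smul_smul]
    have h1 : ‖(G s - G (s - h)) - (G (s - h) - G (s - h - h))‖ ≤ h * (h * K) := by
      refine norm_le_of_lintegral_le
        (p := fun v => (g (s, v) - g (s - h, v)) - (g (s - h, v) - g (s - h - h, v))) ?_
        (by positivity) ?_
      · filter_upwards [Lp.coeFn_sub (G s - G (s - h)) (G (s - h) - G (s - h - h)),
          Lp.coeFn_sub (G s) (G (s - h)), Lp.coeFn_sub (G (s - h)) (G (s - h - h)),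
          hG s hs0, hG _ hs1, hG _ hs2] with v h1 h2 h3 h4 h5 h6
        rw [h1, Pi.sub_apply, h2, h3, Pi.sub_apply, Pi.sub_apply, h4, h5, h6]
      -- A second difference is the increment of x ↦ g(x) - g(x.1 - h, x.2). Its time derivative is
      -- an increment of ∂ₜg, which is in turn bounded by h times the bound of ∂ₜ²g.
      · have h2 := lintegral_sq_sub_le (u := fun x => g x - g (x.1 - h, x.2))
          (u' := fun x => (dirDeriv (1, 0))^[1] g x - (dirDeriv (1, 0))^[1] g (x.1 - h, x.2))
          (a := h) (b := T) (r := s - h) (s := s) (K := ENNReal.ofReal ((h * K) ^ 2))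
          (fun v τ hτ => (hd 0 v τ (hsub τ hτ).1).sub
            ((hd 0 v (τ - h) (hsub τ hτ).2).comp_sub_const τ h))
          (((hsm 1).continuousOn.mono (prod_mono (fun τ hτ => (hsub τ hτ).1) subset_rfl)).sub
            ((hsm 1).continuousOn.comp (by fun_prop) fun x hx => ⟨(hsub _ hx.1).2, mem_univ _⟩))
          ⟨by linarith [hs.1], by linarith [hs.2]⟩ ⟨by linarith [hs.1], hs.2⟩ (by linarith)
          (fun τ hτ => by
            have h3 := lintegral_sq_sub_le (hd 1) (hsm 2).continuousOn (hsub τ hτ).2 (hsub τ hτ).1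
              (by linarith) fun σ hσ => hb 2 (by norm_num) σ hσ
            rwa [sub_sub_cancel, ← ENNReal.ofReal_mul (sq_nonneg _), ← mul_pow] at h3)
        rw [sub_sub_cancel, ← ENNReal.ofReal_mul (sq_nonneg _), ← mul_pow] at h2
        exact h2
    rw [e, norm_smul, Real.norm_eq_abs, abs_of_pos (by positivity), mul_assoc,
      inv_mul_le_iff₀ hh, inv_mul_le_iff₀ hh]
    exact h1

lemma inner_eq_integral {z w : L2} {p φ : V3 → ℝ} (hz : z =ᵐ[volume] p) (hw : w =ᵐ[volume] φ) :
    inner ℝ z w = ∫ v, p v * φ v := by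
  rw [L2.inner_def]
  refine integral_congr_ae ?_
  filter_upwards [hz, hw] with v h1 h2
  rw [h1, h2]
  simp [mul_comm]

end Source

end Landau

/-! ### Conclusion -/

namespace Landau

/-- The abstract smoothing theorem applied to the Landau form. The derivative is obtained as a curve
in the energy space, which is what the bound of its A-norm requires. -/
lemma exists_bound_timeDeriv {γ : ℝ} (hγ₁ : -3 < γ) (hγ₂ : γ < 0) {T M A : ℝ} (hT : 0 < T)
    (hM : 0 ≤ M) (hA : 0 < A) (ρ : Root γ) :
    ∃ Λ : ℝ, 0 ≤ Λ ∧ ∀ (f₀ : L2) (g : ℝ × V3 → ℝ) (f : ℝ → L2), ‖f₀‖ ≤ M →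
      IsAnalyticL2 A (Ioo 0 T ×ˢ univ) g → IsWeakSolution γ T f₀ g f →
      ∃ F : ℝ → energySpace ρ, (∀ t ∈ Ioo 0 T, HasDerivAt f (emb ρ (F t)) t) ∧
        (∀ t ∈ Ioo 0 T, t ^ 2 * ‖emb ρ (F t)‖ ^ 2 ≤ Λ) ∧
        (∫⁻ t in Ioo 0 T, ENNReal.ofReal (t ^ 2 * ‖F t‖ ^ 2) ≤ ENNReal.ofReal Λ) ∧
        ∃ d, HasDerivWithinAt f d (Iic T) T ∧ T ^ 2 * ‖d‖ ^ 2 ≤ Λ := by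
  obtain ⟨b, B, C, hC, hb, hbB, hcoer⟩ := exists_energyForm hγ₁ hγ₂ ρ
  obtain ⟨K, hK, hsource⟩ := exists_source hT hA
  -- The maximum makes the constant nonnegative before any solution is given.
  refine ⟨max (energyConst T M K B C) 0, le_max_right _ _, fun f₀ g f hf₀ hg hf => ?_⟩
  obtain ⟨G, hG, hGc, hG0, hG1, hG2⟩ := hsource g hg
  obtain ⟨ft, hft, hlift⟩ := exists_integrable_lift ρ hf.continuousOn hf.energy
  obtain ⟨F, h1, h2, h3, d, h4, h5⟩ := smoothing_estimate (emb ρ) b hC hbB hcoer hT hK hM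
    (dense_testSpace ρ) hf.continuousOn (by rwa [hf.initial]) hft hlift hGc hG0 hG1 hG2 (by
      rintro φ ⟨ψ, hψ, hφ⟩ t ht
      have hw := hf.weak ψ hψ t ht
      rw [← inner_eq_integral (Filter.EventuallyEq.refl _ _) hφ,
        ← inner_eq_integral (Filter.EventuallyEq.refl _ _) hφ] at hw
      have hsub : Ioc 0 t ⊆ Ioc 0 T := Ioc_subset_Ioc_right ht.2
      rw [hf.initial]
      convert hw using 2
      · rw [intervalIntegral.integral_of_le ht.1, intervalIntegral.integral_of_le ht.1]
        refine integral_congr_ae ?_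
        filter_upwards [ae_restrict_of_ae_restrict_of_subset hsub hlift] with s hs
        rw [hb, ← pairL_eq ρ hγ₁ hγ₂ _ _ hψ hφ, hs]
      · rw [intervalIntegral.integral_of_le ht.1, intervalIntegral.integral_of_le ht.1,
          integral_Ioc_eq_integral_Ioo, integral_Ioc_eq_integral_Ioo]
        refine setIntegral_congr_fun measurableSet_Ioo fun s hs => ?_
        exact inner_eq_integral (hG s ⟨hs.1, hs.2.trans_le ht.2⟩) hφ)
  exact ⟨F, h1, fun t ht => (h2 t ht).trans (le_max_left _ _),
    h3.trans (ENNReal.ofReal_le_ofReal (le_max_left _ _)), d, h4, h5.trans (le_max_left _ _)⟩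

end Landau

theorem mainTheorem6 (γ : ℝ) (hγ₁ : -3 < γ) (hγ₂ : γ < 0) (T : ℝ) (hT : 0 < T)
    (M A : ℝ) (hM : 0 ≤ M) (hA : 0 < A) :
    ∃ C₆ : ℝ, 0 < C₆ ∧
      ∀ (f₀ : Landau.L2) (g : ℝ × Landau.V3 → ℝ) (f : ℝ → Landau.L2),
        ‖f₀‖ ≤ M →
        Landau.IsAnalyticL2 A (Set.Ioo 0 T ×ˢ Set.univ) g →
        Landau.IsWeakSolution γ T f₀ g f →
        DifferentiableOn ℝ f (Set.Ioc 0 T) ∧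
        (⨆ t ∈ Set.Ioc 0 T, ‖t • derivWithin f (Set.Ioc 0 T) t‖ₑ ^ 2)
            + ∫⁻ t in Set.Ioc 0 T, Landau.normASq γ (t • derivWithin f (Set.Ioc 0 T) t : Landau.L2)
          ≤ ENNReal.ofReal (C₆ ^ 2) := by
  obtain ⟨ρ⟩ := Landau.nonempty_root hγ₁ hγ₂
  obtain ⟨Λ, hΛ, hmain⟩ := Landau.exists_bound_timeDeriv hγ₁ hγ₂ hT hM hA ρ
  obtain ⟨K, hK, hnorm⟩ := Landau.exists_normASq_le ρ hγ₁ hγ₂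
  -- Λ bounds the supremum and KΛ the integral of the A-norm. Since (1 + x)² ≥ x for x ≥ 0, the
  -- square of this constant dominates their sum, and the 1 makes it positive.
  refine ⟨1 + (Λ + K * Λ), by positivity, fun f₀ g f hf₀ hg hf => ?_⟩
  obtain ⟨F, hF, hsup, hint, d, hd, hdΛ⟩ := hmain f₀ g f hf₀ hg hf
  have hunique := uniqueDiffOn_Ioc (0 : ℝ) T
  have hdT : HasDerivWithinAt f d (Set.Ioc 0 T) T := hd.mono Set.Ioc_subset_Iic_self
  have hderiv : ∀ t ∈ Set.Ioo 0 T, derivWithin f (Set.Ioc 0 T) t = Landau.emb ρ (F t) :=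
    fun t ht => (hF t ht).hasDerivWithinAt.derivWithin (hunique t (Set.Ioo_subset_Ioc_self ht))
  have hsq : ∀ (t : ℝ) (z : Landau.L2), t ^ 2 * ‖z‖ ^ 2 ≤ Λ →
      ‖t • z‖ₑ ^ 2 ≤ ENNReal.ofReal Λ := fun t z h => by
    rw [← ofReal_norm, ← ENNReal.ofReal_pow (norm_nonneg _), norm_smul, mul_pow,
      Real.norm_eq_abs, sq_abs]
    exact ENNReal.ofReal_le_ofReal h
  refine ⟨fun t ht => ?_, ?_⟩
  · rcases ht.2.eq_or_lt with rfl | h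
    · exact hdT.differentiableWithinAt
    · exact (hF t ⟨ht.1, h⟩).differentiableAt.differentiableWithinAt
  have h1 : (⨆ t ∈ Set.Ioc 0 T, ‖t • derivWithin f (Set.Ioc 0 T) t‖ₑ ^ 2) ≤ ENNReal.ofReal Λ := by
    refine iSup₂_le fun t ht => hsq t _ ?_
    rcases ht.2.eq_or_lt with rfl | h
    · rwa [hdT.derivWithin (hunique t ht)]
    · rw [hderiv t ⟨ht.1, h⟩]
      exact hsup t ⟨ht.1, h⟩
  have h2 : ∫⁻ t in Set.Ioc 0 T,
      Landau.normASq γ (t • derivWithin f (Set.Ioc 0 T) t : Landau.L2)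
        ≤ ENNReal.ofReal (K * Λ) := by
    -- The end point T is negligible, and inside the interval the derivative lies in the energy
    -- space.
    rw [← MeasureTheory.setLIntegral_congr MeasureTheory.Ioo_ae_eq_Ioc, ENNReal.ofReal_mul hK]
    calc _ ≤ ∫⁻ t in Set.Ioo 0 T, ENNReal.ofReal K * ENNReal.ofReal (t ^ 2 * ‖F t‖ ^ 2) := by
          refine MeasureTheory.setLIntegral_mono' measurableSet_Ioo fun t ht => ?_
          rw [hderiv t ht, ← map_smul, ← ENNReal.ofReal_mul hK]
          refine (hnorm (t • F t)).trans_eq ?_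
          rw [norm_smul, mul_pow, Real.norm_eq_abs, sq_abs]
      _ ≤ _ := by
          rw [MeasureTheory.lintegral_const_mul' _ _ ENNReal.ofReal_ne_top]
          exact mul_le_mul' le_rfl hint
  refine (add_le_add h1 h2).trans ?_
  have hKΛ : 0 ≤ K * Λ := mul_nonneg hK hΛ
  rw [← ENNReal.ofReal_add hΛ hKΛ]
  exact ENNReal.ofReal_le_ofReal (by nlinarith)
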